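/- **Model.** An economy consists of a horizon $T\in\mathbb N$; a finite set $\mathcal L$ of locations with travel times $\delta(a,b)\in\mathbb N$, $\delta(a,b)\ge 1$, $\delta(a,a)=1$; the feasible trips $\mathcal T=\{(a,b,t): a,b\in\mathcal L,\ t\in\mathbb{N},\ t+\delta(a,b)\le T\}$ with costs $c_{a,b,t}\ge 0$; costs $\kappa_\Delta\ge0$ ($0\le \Delta\le T$, $\kappa_0=0$) of exiting $\Delta$ periods before time $T$; a finite set $\mathcal D$ of drivers and a finite set $\mathcal R$ of riders. Driver $i$ has an entrance status $e_i\in\{0,1\}$ ($1$ if she has already entered), an entrance location $\ell_i$ and time $\underline\tau_i\le T$, and an exit time $\overline\tau_i\ge T$ with $\underline\tau_i<\overline\tau_i$. Rider $j$ requests one trip $(o_j,d_j,\tau_j)\in\mathcal T$ and has value $v_j\ge0$ for it. A feasible path of driver $i$ is a finite sequence of trips in $\mathcal T$, the first starting at $(\ell_i,\underline\tau_i)$ and each later one where and when the previous one ends. The empty path costs $0$ if $e_i=0$ (not entering) and $\kappa_{T-\underline\tau_i}$ if $e_i=1$ (exiting at once); a non-empty path costs the sum of its trip costs plus $\kappa_\Delta$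 if it ends at time $T-\Delta$. Denote by $\lambda_i(P)$ the cost of path $P$ to driver $i$. A feasible action path is a feasible path in which each trip is marked either as a relocation or as carrying a rider who requests that very trip. A dispatch $(x,\tilde z)$ consists of a feasible action path $\tilde z_i$ for every driver and of $x_j\in\{0,1\}$, where $x_j$ is the number of drivers $i$ whose $\tilde z_i$ carries rider $j$. Its welfare is $\sum_j x_jv_j-\sum_i\lambda_i(\tilde z_i)$; it is welfare-optimal if no dispatch has greater welfare. A plan is a dispatch together with payments $q_j$ by the riders and payments $\hat q_{i,t}$ to the drivers at times $t=0,\dots,T$. Put $\hat q_i=\sum_{t=0}^T\hat q_{i,t}$, and let $\pi_i=\hat q_i-\lambda_i(\tilde z_i)$ be the utility of driver $i$. Under anonymous trip prices $p=(p_{a,b,t})_{(a,b,t)\in\mathcal T}$, $p_{a,b,t}\in\mathbb R$, each rider $j$ pays $q_j=x_jp_{o_j,d_j,\tau_j}$, and each driver is paid $p_{a,b,t}$ at time $t$ for each trip $(a,b,t)$ on which she carries a rider, and nothing else. The plan $(x,\tilde z,p)$ is a competitive equilibrium (CE) if for every rider $j$, $v_j>p_{o_j,d_j,\tau_j}$ implies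 $x_j=1$ and $x_j=1$ implies $v_j\ge p_{o_j,d_j,\tau_j}$, and for every driver $i$, $\pi_i=\max_P\{\sum_{(a,b,t)\in P}\max(p_{a,b,t},0)-\lambda_i(P)\}$ over all feasible paths $P$ of $i$. **Lemma (Welfare Theorem).** 1. A dispatch $(x,\tilde z)$ is welfare-optimal if and only if there exist anonymous trip prices $p$ such that $(x,\tilde z,p)$ is a CE. 2. In every economy there exists a welfare-optimal dispatch with prices that make it a CE. 3. Such a plan can be computed efficiently: there are one program for a random access machine with natural-number and real-number memory, whose only operations on data are addition, subtraction and comparison at unit cost (the only real constant being $0$), and one polynomial $B$, such that for every economy the program, given the data of the economy, halts after at most $B(|\mathcal L|+|\mathcal D|+|\mathcal R|+T)$ steps and outputs a welfare-optimal dispatch $(x,\tilde z)$ together with trip prices $p$ for which $(x,\tilde z,p)$ is a CE. 4. Every CE plan $(x,\tilde z,p)$ is strictly budget balanced ($\sum_jq_j=\sum_i\hat q_i$), individually rational for riders ($x_jv_j\ge q_j$ for all $j$) and for drivers ($\pi_i\ge0$ for all $i$ with $e_i=0$), envy-free for riders ($x_jv_j-q_j\ge x_{j'}v_j-q_{j'}$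 whenever $j,j'$ request the same trip) and envy-free for drivers ($\pi_i=\pi_{i'}$ whenever $i,i'$ have the same entrance time, location and status). -/

import Mathlib

namespace Rideshare

/-- A trip `(a, b, t)`: origin, destination and starting time. -/
structure Trip (Loc : Type*) where
  orig : Loc
  dest : Loc
  start : ℕ

/-- A ridesharing economy with locations `Loc`, drivers `Drv` and riders `Rdr`.
Only the values of `tripCost` at trips within the horizon, and of `exitCost` up to the horizon,
are ever used. -/
structure Economy (Loc Drv Rdr : Type*) where
  /-- the length of the planning horizon -/
  T : ℕ
  /-- the time needed to travel between two locations -/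
  dist : Loc → Loc → ℕ
  dist_pos : ∀ a b, 1 ≤ dist a b
  dist_self : ∀ a, dist a a = 1
  /-- the cost of a trip to a driver -/
  tripCost : Trip Loc → ℝ
  tripCost_nonneg : ∀ r : Trip Loc, r.start + dist r.orig r.dest ≤ T → 0 ≤ tripCost r
  /-- the cost of exiting `Δ` periods before the end of the horizon -/
  exitCost : ℕ → ℝ
  exitCost_nonneg : ∀ Δ, Δ ≤ T → 0 ≤ exitCost Δ
  exitCost_zero : exitCost 0 = 0
  /-- whether the driver has already entered the platform -/
  entered : Drv → Bool
  entryLoc : Drv → Loc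
  entryTime : Drv → ℕ
  /-- the time at which the driver plans to leave -/
  exitTime : Drv → ℕ
  entryTime_lt_exitTime : ∀ i, entryTime i < exitTime i
  entryTime_le : ∀ i, entryTime i ≤ T
  /-- drivers stay at least until the end of the horizon -/
  le_exitTime : ∀ i, T ≤ exitTime i
  /-- the trip requested by the rider -/
  request : Rdr → Trip Loc
  request_mem : ∀ j, (request j).start + dist (request j).orig (request j).dest ≤ T
  /-- the rider's value for the requested trip -/
  value : Rdr → ℝ
  value_nonneg : ∀ j, 0 ≤ value j

/-- An action path: the successive trips of a driver, each without a rider (`none`) or with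
rider `j` (`some j`). -/
abbrev ActionPath (Loc Rdr : Type*) := List (Trip Loc × Option Rdr)

/-- A dispatch: rider pick-ups and an action path for every driver. -/
structure Dispatch (Loc Drv Rdr : Type*) where
  x : Rdr → ℕ
  z : Drv → ActionPath Loc Rdr

/-- A plan: a dispatch, the payment made by every rider, and the payment made to every driver
at every time. -/
structure Plan (Loc Drv Rdr : Type*) extends Dispatch Loc Drv Rdr where
  riderPay : Rdr → ℝ
  driverPay : Drv → ℕ → ℝ

namespace Economy

variable {Loc Drv Rdr : Type*} (E : Economy Loc Drv Rdr)

/-- The time at which a trip ends. -/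
def arrival (r : Trip Loc) : ℕ := r.start + E.dist r.orig r.dest

/-- The feasible trips within the planning horizon. -/
def trips : Set (Trip Loc) := {r | E.arrival r ≤ E.T}

/-- A sequence of feasible trips, the first of which starts at `(a, t)`, and each of the others
where and when the previous one ends. -/
def IsPathFrom : Loc → ℕ → List (Trip Loc) → Prop
  | _, _, [] => True
  | a, t, r :: P => r.orig = a ∧ r.start = t ∧ r ∈ E.trips ∧ IsPathFrom r.dest (E.arrival r) P

/-- The time at which a sequence of trips that begins at time `t` ends. -/
def endTime : ℕ → List (Trip Loc) → ℕ
  | t, [] => t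
  | _, r :: P => endTime (E.arrival r) P

/-- The feasible paths of driver `i`. The empty path means not entering, or, for a driver that
has entered already, exiting immediately. -/
def paths (i : Drv) : Set (List (Trip Loc)) :=
  {P | E.IsPathFrom (E.entryLoc i) (E.entryTime i) P}

open Classical in
/-- The total cost of a path to driver `i`: nothing if she does not enter, and otherwise the costs
of the trips plus the cost of exiting before the end of the horizon. -/
noncomputable def pathCost (i : Drv) (P : List (Trip Loc)) : ℝ :=
  if P = [] ∧ E.entered i = false then 0
  else (P.map E.tripCost).sum + E.exitCost (E.T - E.endTime (E.entryTime i) P)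

/-- The feasible action paths of driver `i`. -/
def actionPaths (i : Drv) : Set (ActionPath Loc Rdr) :=
  {w | w.map Prod.fst ∈ E.paths i ∧ ∀ r j, (r, some j) ∈ w → r = E.request j}

/-- The action path `w` includes the pick-up of rider `j`. -/
def PicksUp (w : ActionPath Loc Rdr) (j : Rdr) : Prop := (E.request j, some j) ∈ w

/-- The cost to driver `i` of the action path dispatched to her. -/
noncomputable def driverCost (d : Dispatch Loc Drv Rdr) (i : Drv) : ℝ :=
  E.pathCost i ((d.z i).map Prod.fst)

variable [Fintype Drv] [Fintype Rdr]

open Classical in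
/-- Feasible dispatches: drivers take feasible action paths, `x j ∈ {0, 1}`, and `x j` is the number
of drivers that pick up rider `j`. -/
def IsFeasible (d : Dispatch Loc Drv Rdr) : Prop :=
  (∀ i, d.z i ∈ E.actionPaths i) ∧
  ∀ j, d.x j = (∑ i, if E.PicksUp (d.z i) j then 1 else 0) ∧ (d.x j = 0 ∨ d.x j = 1)

/-- Social welfare: the values of the riders picked up minus the costs of the drivers. -/
noncomputable def welfare (d : Dispatch Loc Drv Rdr) : ℝ :=
  ∑ j, (d.x j : ℝ) * E.value j - ∑ i, E.driverCost d i

/-- A feasible dispatch of maximal welfare among the feasible dispatches. -/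
def IsWelfareOptimal (d : Dispatch Loc Drv Rdr) : Prop :=
  E.IsFeasible d ∧ ∀ d', E.IsFeasible d' → E.welfare d' ≤ E.welfare d

open Classical in
/-- The plan in which dispatch `d` is carried out at the anonymous trip prices `p`: a rider pays the
price of her trip if picked up and nothing otherwise, and a driver is paid the price of every rider
trip at the time at which it starts, and nothing else. -/
noncomputable def priced (d : Dispatch Loc Drv Rdr) (p : Trip Loc → ℝ) : Plan Loc Drv Rdr where
  toDispatch := d
  riderPay j := (d.x j : ℝ) * p (E.request j)
  driverPay i t :=
    ∑ j, if E.PicksUp (d.z i) j ∧ (E.request j).start = t then p (E.request j) else 0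

/-- The total payment to driver `i` over the planning horizon. -/
noncomputable def totalPay (π : Plan Loc Drv Rdr) (i : Drv) : ℝ :=
  ∑ t ∈ Finset.range (E.T + 1), π.driverPay i t

/-- The utility of driver `i`. -/
noncomputable def driverUtility (π : Plan Loc Drv Rdr) (i : Drv) : ℝ :=
  E.totalPay π i - E.driverCost π.toDispatch i

/-- The feasible dispatch `d` with anonymous trip prices `p` forms a competitive equilibrium. -/
def IsCE (d : Dispatch Loc Drv Rdr) (p : Trip Loc → ℝ) : Prop :=
  E.IsFeasible d ∧
  (∀ j, (p (E.request j) < E.value j → d.x j = 1) ∧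
    (d.x j = 1 → p (E.request j) ≤ E.value j)) ∧
  ∀ i, IsGreatest
    ((fun P : List (Trip Loc) => (P.map fun r => max (p r) 0).sum - E.pathCost i P) '' E.paths i)
    (E.driverUtility (E.priced d p) i)

/-- Strict budget balance. -/
def StrictBudgetBalance (π : Plan Loc Drv Rdr) : Prop :=
  ∑ j, π.riderPay j = ∑ i, E.totalPay π i

/-- Individual rationality for riders. -/
def RiderIR (π : Plan Loc Drv Rdr) : Prop :=
  ∀ j, π.riderPay j ≤ (π.x j : ℝ) * E.value j

/-- Individual rationality for drivers (that have not yet entered). -/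
def DriverIR (π : Plan Loc Drv Rdr) : Prop :=
  ∀ i, E.entered i = false → 0 ≤ E.driverUtility π i

/-- Envy-freeness for riders requesting the same trip. -/
def RiderEnvyFree (π : Plan Loc Drv Rdr) : Prop :=
  ∀ j j', E.request j = E.request j' →
    (π.x j' : ℝ) * E.value j - π.riderPay j' ≤ (π.x j : ℝ) * E.value j - π.riderPay j

/-- Envy-freeness for drivers: those with the same entrance time, location and status have the same
utility. -/
def DriverEnvyFree (π : Plan Loc Drv Rdr) : Prop :=
  ∀ i i', E.entryTime i = E.entryTime i' → E.entryLoc i = E.entryLoc i' →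
    E.entered i = E.entered i' → E.driverUtility π i = E.driverUtility π i'

end Economy

/-! ### A random access machine with real data

The store consists of arrays of natural numbers (used for control and for addresses) and arrays of
real numbers. An array is designated by a number and has three indices. The operations are addition,
subtraction and comparison, each of unit cost; there is no multiplication, no rounding and no real
constant but zero. Hence a computation of `s` steps on rational data only produces numbers whose
encoding length exceeds that of the data by `O(s)`. -/

structure Store where
  nat : ℕ → ℕ → ℕ → ℕ → ℕ
  real : ℕ → ℕ → ℕ → ℕ → ℝ

/-- Expressions with natural values; `cell A i j k` is the content of array `A` at `(i, j, k)`. -/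
inductive NExpr where
  | const (n : ℕ)
  | cell (A : ℕ) (i j k : NExpr)
  | add (e f : NExpr)
  | sub (e f : NExpr)

/-- Expressions with real values. -/
inductive RExpr where
  | zero
  | cell (A : ℕ) (i j k : NExpr)
  | add (e f : RExpr)
  | sub (e f : RExpr)

/-- Tests. -/
inductive Test where
  | nle (e f : NExpr)
  | rle (e f : RExpr)
  | not (b : Test)
  | and (b c : Test)

/-- Programs. -/
inductive Program where
  | skip
  | nset (A : ℕ) (i j k : NExpr) (e : NExpr)
  | rset (A : ℕ) (i j k : NExpr) (e : RExpr)
  | seq (c d : Program)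
  | ite (b : Test) (c d : Program)
  | loop (b : Test) (c : Program)

/-- Subtraction of natural numbers is truncated at zero. -/
def NExpr.eval (s : Store) : NExpr → ℕ
  | const n => n
  | cell A i j k => s.nat A (i.eval s) (j.eval s) (k.eval s)
  | add e f => e.eval s + f.eval s
  | sub e f => e.eval s - f.eval s

/-- The number of operations needed to evaluate an expression. -/
def NExpr.cost : NExpr → ℕ
  | const _ => 1
  | cell _ i j k => i.cost + j.cost + k.cost + 1
  | add e f => e.cost + f.cost + 1
  | sub e f => e.cost + f.cost + 1

noncomputable def RExpr.eval (s : Store) : RExpr → ℝ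
  | zero => 0
  | cell A i j k => s.real A (i.eval s) (j.eval s) (k.eval s)
  | add e f => e.eval s + f.eval s
  | sub e f => e.eval s - f.eval s

def RExpr.cost : RExpr → ℕ
  | zero => 1
  | cell _ i j k => i.cost + j.cost + k.cost + 1
  | add e f => e.cost + f.cost + 1
  | sub e f => e.cost + f.cost + 1

def Test.Holds (s : Store) : Test → Prop
  | nle e f => e.eval s ≤ f.eval s
  | rle e f => e.eval s ≤ f.eval s
  | not b => ¬ b.Holds s
  | and b c => b.Holds s ∧ c.Holds s

def Test.cost : Test → ℕ
  | nle e f => e.cost + f.cost + 1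
  | rle e f => e.cost + f.cost + 1
  | not b => b.cost + 1
  | and b c => b.cost + c.cost + 1

def Store.setNat (s : Store) (A i j k n : ℕ) : Store where
  nat A' i' j' k' := if A' = A ∧ i' = i ∧ j' = j ∧ k' = k then n else s.nat A' i' j' k'
  real := s.real

noncomputable def Store.setReal (s : Store) (A i j k : ℕ) (y : ℝ) : Store where
  nat := s.nat
  real A' i' j' k' := if A' = A ∧ i' = i ∧ j' = j ∧ k' = k then y else s.real A' i' j' k'

/-- `Exec c s n s'`: started in store `s`, program `c` halts in store `s'` after `n` steps. -/
inductive Exec : Program → Store → ℕ → Store → Prop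
  | skip (s : Store) : Exec .skip s 1 s
  | nset (s : Store) (A : ℕ) (i j k e : NExpr) :
      Exec (.nset A i j k e) s (i.cost + j.cost + k.cost + e.cost + 1)
        (s.setNat A (i.eval s) (j.eval s) (k.eval s) (e.eval s))
  | rset (s : Store) (A : ℕ) (i j k : NExpr) (e : RExpr) :
      Exec (.rset A i j k e) s (i.cost + j.cost + k.cost + e.cost + 1)
        (s.setReal A (i.eval s) (j.eval s) (k.eval s) (e.eval s))
  | seq {c d : Program} {s s' s'' : Store} {m n : ℕ} :
      Exec c s m s' → Exec d s' n s'' → Exec (.seq c d) s (m + n) s''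
  | ite_true {b : Test} {c d : Program} {s s' : Store} {n : ℕ} :
      b.Holds s → Exec c s n s' → Exec (.ite b c d) s (b.cost + n) s'
  | ite_false {b : Test} {c d : Program} {s s' : Store} {n : ℕ} :
      ¬ b.Holds s → Exec d s n s' → Exec (.ite b c d) s (b.cost + n) s'
  | loop_true {b : Test} {c : Program} {s s' s'' : Store} {m n : ℕ} :
      b.Holds s → Exec c s m s' → Exec (.loop b c) s' n s'' →
        Exec (.loop b c) s (b.cost + m + n) s''
  | loop_false {b : Test} {c : Program} {s : Store} :
      ¬ b.Holds s → Exec (.loop b c) s b.cost s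

/-- A finite sequence, continued by zeros. -/
def extend {α : Type*} [Zero α] {n : ℕ} (f : Fin n → α) (k : ℕ) : α :=
  if h : k < n then f ⟨k, h⟩ else 0

/-- The store that holds (the relevant data of) an economy with locations `0, …, l - 1`, drivers
`0, …, n - 1` and riders `0, …, m - 1`, and zeros everywhere else. -/
noncomputable def inputStore {l n m : ℕ} (E : Economy (Fin l) (Fin n) (Fin m)) : Store where
  nat
    | 0, 0, 0, 0 => l
    | 0, 1, 0, 0 => n
    | 0, 2, 0, 0 => m
    | 0, 3, 0, 0 => E.T
    | 1, a, b, 0 => extend (fun a : Fin l => extend (fun b : Fin l => E.dist a b) b) a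
    | 2, i, 0, 0 => extend (fun i : Fin n => (E.entered i).toNat) i
    | 2, i, 1, 0 => extend (fun i : Fin n => (E.entryLoc i : ℕ)) i
    | 2, i, 2, 0 => extend (fun i : Fin n => E.entryTime i) i
    | 2, i, 3, 0 => extend (fun i : Fin n => E.exitTime i) i
    | 3, j, 0, 0 => extend (fun j : Fin m => ((E.request j).orig : ℕ)) j
    | 3, j, 1, 0 => extend (fun j : Fin m => ((E.request j).dest : ℕ)) j
    | 3, j, 2, 0 => extend (fun j : Fin m => (E.request j).start) j
    | _, _, _, _ => 0
  real
    | 0, a, b, t => extend (fun a : Fin l => extend (fun b : Fin l =>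
        if t + E.dist a b ≤ E.T then E.tripCost ⟨a, b, t⟩ else 0) b) a
    | 1, Δ, 0, 0 => if Δ ≤ E.T then E.exitCost Δ else 0
    | 2, j, 0, 0 => extend (fun j : Fin m => E.value j) j
    | _, _, _, _ => 0

/-- The store `s` holds dispatch `d` and trip prices `p`: the pick-ups in array `4`, the lengths of
the action paths in array `5`, the actions in array `6` (origin, destination, start, and `0` for no
rider or `j + 1` for rider `j`), and the prices of the feasible trips in real array `3`. -/
def HoldsPlan {l n m : ℕ} (E : Economy (Fin l) (Fin n) (Fin m)) (s : Store)
    (d : Dispatch (Fin l) (Fin n) (Fin m)) (p : Trip (Fin l) → ℝ) : Prop :=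
  (∀ j : Fin m, s.nat 4 j 0 0 = d.x j) ∧
  (∀ i : Fin n, s.nat 5 i 0 0 = (d.z i).length) ∧
  (∀ (i : Fin n) (k : ℕ) (hk : k < (d.z i).length),
    s.nat 6 i k 0 = (d.z i)[k].1.orig ∧
    s.nat 6 i k 1 = (d.z i)[k].1.dest ∧
    s.nat 6 i k 2 = (d.z i)[k].1.start ∧
    s.nat 6 i k 3 = (d.z i)[k].2.elim 0 (fun j => (j : ℕ) + 1)) ∧
  ∀ r ∈ E.trips, s.real 3 r.orig r.dest r.start = p r

end Rideshare

/-! At any prices the payments of the riders and the revenues of the drivers cancel. So the welfare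
of a feasible dispatch is the sum of the surpluses `x j * (value j - p (request j))` of the riders
and the utilities of the drivers (`welfare_eq`). In an equilibrium each of these terms is as large
as it can be in any feasible dispatch. Hence an equilibrium is optimal (`IsCE.isWelfareOptimal`).
Conversely, another optimal dispatch has the same total, so it attains each of these maxima and is
supported by the same prices (`IsCE.of_isWelfareOptimal`). It remains to find a single equilibrium
in polynomial time.

An equilibrium comes from the duality of minimum cost flows. The nodes are the pairs of a location
and a time, and a sink that stands for having left. There is an arc of capacity one for the empty
path of each driver and for the trip of each rider, and an arc without limit for each exit and each
relocation. A potential `V` that vanishes at the sink yields the prices "trip cost plus `V` at the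
origin minus `V` at the destination". Profits then telescope along paths, and complementary
slackness between flow and potential becomes the equilibrium condition (`isCE_of_potential`).

Flow and potential are found by successive augmentation, as in the Hungarian method. For each driver
a tree of tight residual arcs grows from her entrance. The potential on the tree is lowered by the
least slack of an arc that leaves it, which makes that arc tight, until the sink is reached
(`holdsTree_attach`, `holdsTree_grow`). Then the path to the sink is flipped (`run_augment`). The
flow is integral throughout. As time increases along arcs there are no circulations, so the flow
decomposes into one path per driver with nothing left over (`run_writePaths`), and `isCE_of_routed`
reads off the equilibrium.

The method only adds, subtracts and compares real numbers. It is written in a language of bounded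
loops, where a program is a function of the store and is verified by loop invariants (`run_count`).
A single compilation theorem, `exec_compile`, bounds the running time by a polynomial in the lengths
of the loops. Existence for arbitrary finite types follows by renaming (`exists_isCE_of_reindex`).
-/

namespace Rideshare
namespace Economy

variable {Loc Drv Rdr : Type*} (E : Economy Loc Drv Rdr)

/-! ### Action paths and their revenue -/

/-- The revenue from an action path at trip prices `p`. -/
def revenue (p : Trip Loc → ℝ) (w : ActionPath Loc Rdr) : ℝ :=
  (w.map fun y => if y.2.isSome then p y.1 else 0).sum

lemma le_start_of_mem {a : Loc} {t : ℕ} {P : List (Trip Loc)} (h : E.IsPathFrom a t P)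
    {r : Trip Loc} (hr : r ∈ P) : t ≤ r.start := by
  induction P generalizing a t with
  | nil => simp at hr
  | cons q P ih =>
    obtain ⟨_, h2, _, h4⟩ := h
    rcases List.mem_cons.1 hr with rfl | hr
    · omega
    · have := ih h4 hr
      unfold arrival at this
      omega

lemma mem_trips_of_mem {a : Loc} {t : ℕ} {P : List (Trip Loc)} (h : E.IsPathFrom a t P)
    {r : Trip Loc} (hr : r ∈ P) : r ∈ E.trips := by
  induction P generalizing a t with
  | nil => simp at hr
  | cons q P ih =>
    obtain ⟨_, _, h3, h4⟩ := h
    rcases List.mem_cons.1 hr with rfl | hr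
    · exact h3
    · exact ih h4 hr

lemma start_lt_arrival (r : Trip Loc) : r.start < E.arrival r := by
  have := E.dist_pos r.orig r.dest
  unfold arrival
  omega

open Classical in
/-- A rider is picked up at most once along a path. -/
lemma sum_picksUp [Fintype Rdr] (p : Trip Loc → ℝ) {a : Loc} {t : ℕ} {w : ActionPath Loc Rdr}
    (hw : E.IsPathFrom a t (w.map Prod.fst)) (hm : ∀ r j, (r, some j) ∈ w → r = E.request j) :
    ∑ j, (if E.PicksUp w j then p (E.request j) else 0) = revenue p w := by
  induction w generalizing a t with
  | nil => simp [PicksUp, revenue]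
  | cons y w ih =>
    obtain ⟨r, o⟩ := y
    obtain ⟨_, _, _, h4⟩ := hw
    have ih' := ih h4 fun r j h => hm r j (List.mem_cons_of_mem _ h)
    cases o with
    | none =>
      have hsame : ∀ j, E.PicksUp ((r, none) :: w) j ↔ E.PicksUp w j := fun j => by
        simp [PicksUp]
      simp only [hsame, ih']
      simp [revenue]
    | some k =>
      have hr : r = E.request k := hm r k (by simp)
      -- The later trips start no earlier than `r` arrives, so the request of `k`, which is `r`
      -- itself, cannot recur.
      have hk : ¬ E.PicksUp w k := fun h => by
        have := E.le_start_of_mem h4 (List.mem_map_of_mem (f := Prod.fst) h)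
        have h' := E.start_lt_arrival r
        simp only [hr] at this h'
        omega
      have hsplit : ∀ j, (if E.PicksUp ((r, some k) :: w) j then p (E.request j) else 0) =
          (if j = k then p (E.request k) else 0) +
            (if E.PicksUp w j then p (E.request j) else 0) := by
        intro j
        by_cases hj : j = k
        · subst hj
          have : E.PicksUp ((r, some j) :: w) j := by simp [PicksUp, hr]
          simp [this, hk]
        · have : E.PicksUp ((r, some k) :: w) j ↔ E.PicksUp w j := by simp [PicksUp, hj]
          simp [this, hj]
      rw [Finset.sum_congr rfl fun j _ => hsplit j, Finset.sum_add_distrib, ih']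
      simp [revenue, hr]

lemma revenue_le (p : Trip Loc → ℝ) (w : ActionPath Loc Rdr) :
    revenue p w ≤ ((w.map Prod.fst).map fun r => max (p r) 0).sum := by
  unfold revenue
  rw [List.map_map]
  refine List.sum_le_sum fun y _ => ?_
  by_cases h : y.2.isSome <;> simp [h]

lemma mul_surplus_le [Fintype Drv] {d : Dispatch Loc Drv Rdr} (hd : E.IsFeasible d) (p : Trip Loc → ℝ)
    (j : Rdr) : (d.x j : ℝ) * (E.value j - p (E.request j)) ≤
      max (E.value j - p (E.request j)) 0 := by
  rcases (hd.2 j).2 with h | h <;> simp [h]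

/-! ### The decomposition of welfare, the welfare theorems and the properties of equilibria -/

section Finite

variable [Fintype Drv] [Fintype Rdr]

lemma totalPay_priced {d : Dispatch Loc Drv Rdr} (hd : E.IsFeasible d) (p : Trip Loc → ℝ)
    (i : Drv) : E.totalPay (E.priced d p) i = revenue p (d.z i) := by
  classical
  rw [← E.sum_picksUp p (hd.1 i).1 (hd.1 i).2]
  simp only [totalPay, priced]
  rw [Finset.sum_comm]
  refine Finset.sum_congr rfl fun j _ => ?_
  have hj : (E.request j).start ∈ Finset.range (E.T + 1) := by
    have := E.request_mem j
    simp only [Finset.mem_range]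
    omega
  by_cases h : E.PicksUp (d.z i) j
  · simp only [h, true_and, if_true]
    rw [Finset.sum_ite_eq]
    simp only [hj, if_true]
  · simp [h]

lemma driverUtility_priced {d : Dispatch Loc Drv Rdr} (hd : E.IsFeasible d) (p : Trip Loc → ℝ)
    (i : Drv) : E.driverUtility (E.priced d p) i = revenue p (d.z i) - E.driverCost d i := by
  rw [driverUtility, E.totalPay_priced hd]
  rfl

/-- What the riders pay is what the drivers receive. -/
lemma sum_price_eq_sum_revenue {d : Dispatch Loc Drv Rdr} (hd : E.IsFeasible d)
    (p : Trip Loc → ℝ) :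
    ∑ j, (d.x j : ℝ) * p (E.request j) = ∑ i, revenue p (d.z i) := by
  classical
  rw [Finset.sum_congr rfl fun i _ => (E.sum_picksUp p (hd.1 i).1 (hd.1 i).2).symm,
    Finset.sum_comm]
  refine Finset.sum_congr rfl fun j _ => ?_
  rw [(hd.2 j).1]
  push_cast
  rw [Finset.sum_mul]
  refine Finset.sum_congr rfl fun i _ => ?_
  by_cases h : E.PicksUp (d.z i) j <;> simp [h]

/-- Prices only redistribute, whatever they are. The point of the splitting is that an equilibrium
maximizes its terms one by one. -/
lemma welfare_eq {d : Dispatch Loc Drv Rdr} (hd : E.IsFeasible d) (p : Trip Loc → ℝ) :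
    E.welfare d = ∑ j, (d.x j : ℝ) * (E.value j - p (E.request j)) +
      ∑ i, (revenue p (d.z i) - E.driverCost d i) := by
  simp only [mul_sub, Finset.sum_sub_distrib, E.sum_price_eq_sum_revenue hd, welfare]
  ring

variable {E}

/-- A rider with positive surplus is served, one with negative surplus is not, and at surplus zero
both sides vanish. -/
lemma IsCE.mul_surplus {d : Dispatch Loc Drv Rdr} {p : Trip Loc → ℝ} (h : E.IsCE d p) (j : Rdr) :
    (d.x j : ℝ) * (E.value j - p (E.request j)) = max (E.value j - p (E.request j)) 0 := by
  obtain ⟨h1, h2⟩ := h.2.1 j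
  rcases (h.1.2 j).2 with h0 | h0
  · have : ¬ p (E.request j) < E.value j := fun hlt => by simp [h1 hlt] at h0
    simp only [h0, Nat.cast_zero, zero_mul]
    rw [max_eq_right (by linarith)]
  · have := h2 h0
    simp only [h0, Nat.cast_one, one_mul]
    rw [max_eq_left (by linarith)]

/-- In `d'` the driver follows a feasible path and earns at most the positive parts of its prices,
since relocations earn nothing. The equilibrium utility dominates that profit. -/
lemma IsCE.utility_le {d d' : Dispatch Loc Drv Rdr} {p : Trip Loc → ℝ} (h : E.IsCE d p)
    (hd' : E.IsFeasible d') (i : Drv) :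
    revenue p (d'.z i) - E.driverCost d' i ≤ revenue p (d.z i) - E.driverCost d i := by
  have h1 := (h.2.2 i).2 ⟨_, (hd'.1 i).1, rfl⟩
  rw [E.driverUtility_priced h.1] at h1
  have h2 := revenue_le p (d'.z i)
  simp only [driverCost] at h1 ⊢
  linarith

/-- First welfare theorem. -/
theorem IsCE.isWelfareOptimal {d : Dispatch Loc Drv Rdr} {p : Trip Loc → ℝ} (h : E.IsCE d p) :
    E.IsWelfareOptimal d := by
  refine ⟨h.1, fun d' hd' => ?_⟩
  rw [E.welfare_eq h.1 p, E.welfare_eq hd' p]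
  refine add_le_add (Finset.sum_le_sum fun j _ => ?_)
    (Finset.sum_le_sum fun i _ => h.utility_le hd' i)
  rw [h.mul_surplus]
  exact E.mul_surplus_le hd' p j

/-- Prices that support one dispatch support all the optimal ones. -/
theorem IsCE.of_isWelfareOptimal {d d' : Dispatch Loc Drv Rdr} {p : Trip Loc → ℝ}
    (h : E.IsCE d p) (hd' : E.IsWelfareOptimal d') : E.IsCE d' p := by
  have hW : E.welfare d' = E.welfare d :=
    le_antisymm (h.isWelfareOptimal.2 d' hd'.1) (hd'.2 d h.1)
  rw [E.welfare_eq h.1 p, E.welfare_eq hd'.1 p] at hW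
  have hj : ∀ j ∈ Finset.univ, (d'.x j : ℝ) * (E.value j - p (E.request j)) ≤
      (d.x j : ℝ) * (E.value j - p (E.request j)) := fun j _ => by
    rw [h.mul_surplus]
    exact E.mul_surplus_le hd'.1 p j
  have hi : ∀ i ∈ Finset.univ, revenue p (d'.z i) - E.driverCost d' i ≤
      revenue p (d.z i) - E.driverCost d i := fun i _ => h.utility_le hd'.1 i
  have hJ := Finset.sum_le_sum hj
  have hI := Finset.sum_le_sum hi
  -- Both sums are bounded term by term and the totals agree, so all the terms agree.
  have ej := (Finset.sum_eq_sum_iff_of_le hj).1 (by linarith)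
  have ei := (Finset.sum_eq_sum_iff_of_le hi).1 (by linarith)
  refine ⟨hd'.1, fun j => ?_, fun i => ?_⟩
  · have e := ej j (Finset.mem_univ j)
    rw [h.mul_surplus] at e
    rcases (hd'.1.2 j).2 with h0 | h0
    · simp only [h0, Nat.cast_zero, zero_mul] at e
      have := le_max_left (E.value j - p (E.request j)) 0
      exact ⟨fun hlt => absurd hlt (by linarith), by simp [h0]⟩
    · simp only [h0, Nat.cast_one, one_mul] at e
      have := le_max_right (E.value j - p (E.request j)) 0
      exact ⟨fun _ => h0, fun _ => by linarith⟩
  · rw [E.driverUtility_priced hd'.1, ei i (Finset.mem_univ i), ← E.driverUtility_priced h.1]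
    exact h.2.2 i

/-! ### Properties of equilibrium plans -/

theorem IsCE.strictBudgetBalance {d : Dispatch Loc Drv Rdr} {p : Trip Loc → ℝ} (h : E.IsCE d p) :
    E.StrictBudgetBalance (E.priced d p) := by
  simp only [StrictBudgetBalance, E.totalPay_priced h.1]
  exact E.sum_price_eq_sum_revenue h.1 p

theorem IsCE.riderIR {d : Dispatch Loc Drv Rdr} {p : Trip Loc → ℝ} (h : E.IsCE d p) :
    E.RiderIR (E.priced d p) := by
  intro j
  have h1 := h.mul_surplus j
  have h2 := le_max_right (E.value j - p (E.request j)) 0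
  simp only [priced]
  linarith

/-- The empty path is among the alternatives, and it is free for a driver who has not entered. -/
theorem IsCE.driverIR {d : Dispatch Loc Drv Rdr} {p : Trip Loc → ℝ} (h : E.IsCE d p) :
    E.DriverIR (E.priced d p) := by
  intro i hi
  refine (h.2.2 i).2 ⟨[], trivial, ?_⟩
  simp [pathCost, hi]

theorem IsCE.riderEnvyFree {d : Dispatch Loc Drv Rdr} {p : Trip Loc → ℝ} (h : E.IsCE d p) :
    E.RiderEnvyFree (E.priced d p) := by
  intro j j' hjj
  have h1 := h.mul_surplus j
  simp only [priced, ← hjj]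
  have h2 : (d.x j' : ℝ) * (E.value j - p (E.request j)) ≤
      max (E.value j - p (E.request j)) 0 := by
    rcases (h.1.2 j').2 with h | h <;> simp [h]
  linarith

/-- Both utilities are the greatest element of one and the same set, because paths and costs depend
on a driver only through her entrance data. -/
theorem IsCE.driverEnvyFree {d : Dispatch Loc Drv Rdr} {p : Trip Loc → ℝ} (h : E.IsCE d p) :
    E.DriverEnvyFree (E.priced d p) := by
  intro i i' ht hl he
  refine (h.2.2 i).unique ?_
  have hp : E.paths i = E.paths i' := by simp only [paths, ht, hl]
  have hc : E.pathCost i = E.pathCost i' := by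
    funext P
    simp only [pathCost, ht, he]
  rw [hp, hc]
  exact h.2.2 i'

end Finite

/-! ### Potentials -/

/-- The location at which a sequence of trips that begins at `a` ends. -/
def endLoc : Loc → List (Trip Loc) → Loc
  | a, [] => a
  | _, r :: P => endLoc r.dest P

lemma isPathFrom_concat {a : Loc} {t : ℕ} {P : List (Trip Loc)} {r : Trip Loc}
    (hP : E.IsPathFrom a t P) (ho : r.orig = endLoc a P) (hs : r.start = E.endTime t P)
    (hr : r ∈ E.trips) : E.IsPathFrom a t (P ++ [r]) := by
  induction P generalizing a t with
  | nil => exact ⟨ho, hs, hr, trivial⟩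
  | cons q P ih =>
    obtain ⟨h1, h2, h3, h4⟩ := hP
    exact ⟨h1, h2, h3, ih h4 ho hs⟩

lemma endLoc_concat (a : Loc) (P : List (Trip Loc)) (r : Trip Loc) :
    endLoc a (P ++ [r]) = r.dest := by
  induction P generalizing a with
  | nil => rfl
  | cons q P ih => exact ih _

lemma endTime_concat (t : ℕ) (P : List (Trip Loc)) (r : Trip Loc) :
    E.endTime t (P ++ [r]) = E.arrival r := by
  induction P generalizing t with
  | nil => rfl
  | cons q P ih => exact ih _

lemma endTime_le {a : Loc} {t : ℕ} {P : List (Trip Loc)} (hP : E.IsPathFrom a t P)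
    (ht : t ≤ E.T) : E.endTime t P ≤ E.T := by
  induction P generalizing a t with
  | nil => exact ht
  | cons q P ih =>
    obtain ⟨_, _, h3, h4⟩ := hP
    exact ih h4 h3

/-- The differences of potential telescope, so the profit before the exit cost depends on the two
end nodes only. -/
lemma sum_price_sub_cost {V : Loc → ℕ → ℝ} {p : Trip Loc → ℝ}
    (hp : ∀ r ∈ E.trips, p r = E.tripCost r + V r.orig r.start - V r.dest (E.arrival r))
    {a : Loc} {t : ℕ} {P : List (Trip Loc)} (hP : E.IsPathFrom a t P) :
    (P.map p).sum - (P.map E.tripCost).sum = V a t - V (endLoc a P) (E.endTime t P) := by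
  induction P generalizing a t with
  | nil => simp [endLoc, endTime]
  | cons q P ih =>
    obtain ⟨h1, h2, h3, h4⟩ := hP
    have := ih h4
    have h5 := hp q h3
    rw [h1, h2] at h5
    simp only [List.map_cons, List.sum_cons, endLoc, endTime]
    linarith

/-- Complementary slackness: prices that derive from a potential `V`, the value to a driver of
being available at a location at a time, and that fit the dispatch, form an equilibrium. -/
theorem isCE_of_potential [Fintype Drv] [Fintype Rdr] {d : Dispatch Loc Drv Rdr}
    {V : Loc → ℕ → ℝ} {p : Trip Loc → ℝ} (hd : E.IsFeasible d)
    (hp : ∀ r ∈ E.trips, p r = E.tripCost r + V r.orig r.start - V r.dest (E.arrival r))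
    (hp0 : ∀ r ∈ E.trips, 0 ≤ p r)
    (hV : ∀ a t, t ≤ E.T → - E.exitCost (E.T - t) ≤ V a t)
    (hx0 : ∀ j, d.x j = 0 → E.value j ≤ p (E.request j))
    (hx1 : ∀ j, d.x j = 1 → p (E.request j) ≤ E.value j)
    (hz : ∀ i r, (r, none) ∈ d.z i → p r ≤ 0)
    (hi : ∀ i, (d.z i = [] ∧ V (E.entryLoc i) (E.entryTime i) ≤ - E.pathCost i []) ∨
      (- E.pathCost i [] ≤ V (E.entryLoc i) (E.entryTime i) ∧
        V (endLoc (E.entryLoc i) ((d.z i).map Prod.fst))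
          (E.endTime (E.entryTime i) ((d.z i).map Prod.fst)) =
        - E.exitCost (E.T - E.endTime (E.entryTime i) ((d.z i).map Prod.fst)))) :
    E.IsCE d p := by
  classical
  have hmax : ∀ i, ∀ P ∈ E.paths i,
      (P.map fun r => max (p r) 0).sum = (P.map p).sum := fun i P hP => by
    congr 1
    refine List.map_congr_left fun r hr => ?_
    exact max_eq_left (hp0 r (E.mem_trips_of_mem hP hr))
  -- Relocations have price exactly zero by `hz` and `hp0`, so it does not matter that they are
  -- unpaid.
  have hrev : ∀ i, revenue p (d.z i) = (((d.z i).map Prod.fst).map p).sum := fun i => by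
    rw [revenue, List.map_map]
    congr 1
    refine List.map_congr_left fun y hy => ?_
    obtain ⟨r, o⟩ := y
    cases o with
    | some j => rfl
    | none =>
      have h1 := hz i r hy
      have h2 := hp0 r (E.mem_trips_of_mem (hd.1 i).1 (List.mem_map_of_mem (f := Prod.fst) hy))
      simpa using le_antisymm h2 h1
  refine ⟨hd, fun j => ⟨fun hlt => ?_, hx1 j⟩, fun i => ?_⟩
  · rcases (hd.2 j).2 with h | h
    · exact absurd hlt (not_lt.2 (hx0 j h))
    · exact h
  rw [E.driverUtility_priced hd, hrev]
  have hlong : ∀ P ∈ E.paths i, ¬ (P = [] ∧ E.entered i = false) →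
      (P.map p).sum - E.pathCost i P = V (E.entryLoc i) (E.entryTime i) -
        V (endLoc (E.entryLoc i) P) (E.endTime (E.entryTime i) P) -
        E.exitCost (E.T - E.endTime (E.entryTime i) P) := fun P hP h => by
    have := E.sum_price_sub_cost hp hP
    rw [pathCost, if_neg h]
    linarith
  -- By `hV` the potential at the end of the path is at least minus the exit cost there, so no path
  -- on which the driver enters earns more than the potential at the entrance.
  have hub : ∀ P ∈ E.paths i, ¬ (P = [] ∧ E.entered i = false) →
      (P.map p).sum - E.pathCost i P ≤ V (E.entryLoc i) (E.entryTime i) := fun P hP h => by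
    rw [hlong P hP h]
    linarith [hV (endLoc (E.entryLoc i) P) _ (E.endTime_le hP (E.entryTime_le i))]
  refine ⟨⟨_, (hd.1 i).1, by simp only [hmax i _ (hd.1 i).1]; rfl⟩, ?_⟩
  rintro _ ⟨P, hP, rfl⟩
  simp only [hmax i P hP, driverCost]
  rcases hi i with ⟨h1, h2⟩ | ⟨h1, h2⟩
  · simp only [h1, List.map_nil, List.sum_nil]
    by_cases h : P = [] ∧ E.entered i = false
    · simp [h.1]
    · linarith [hub P hP h]
  · have hut : V (E.entryLoc i) (E.entryTime i) ≤ (((d.z i).map Prod.fst).map p).sum -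
        E.pathCost i ((d.z i).map Prod.fst) := by
      -- The flow may send a driver who has not entered straight to the exit. Her utility is then
      -- zero, while the potential is minus an exit cost and hence at most zero.
      by_cases h : (d.z i).map Prod.fst = [] ∧ E.entered i = false
      · rw [h.1] at h2 ⊢
        simp only [endLoc, endTime] at h2
        have := E.exitCost_nonneg (E.T - E.entryTime i) (by omega)
        simp only [List.map_nil, List.sum_nil, pathCost, h.2, and_self, if_true]
        linarith
      · rw [hlong _ (hd.1 i).1 h, h2]
        linarith
    refine le_trans ?_ hut
    by_cases h : P = [] ∧ E.entered i = false
    · rw [h.1]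
      simpa using h1
    · exact hub P hP h

end Economy
end Rideshare

namespace Rideshare

/-! ### A language of bounded loops

Programs are written in a language in which all the loops run over initial segments of the natural
numbers, so that they denote functions of the store. -/

inductive Code where
  | skip
  | nset (A : ℕ) (i j k : NExpr) (e : NExpr)
  | rset (A : ℕ) (i j k : NExpr) (e : RExpr)
  | seq (c d : Code)
  | ite (b : Test) (c d : Code)
  /-- `count x e c` executes `c` with `x = 0, 1, …`, as long as `x` is less than `e`. -/
  | count (x : ℕ) (e : NExpr) (c : Code)

/-- The scalar variable `x`: the cell of array `x` at the origin. -/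
abbrev var (x : ℕ) : NExpr := .cell x (.const 0) (.const 0) (.const 0)

/-- The arrays that an expression refers to. -/
def NExpr.arrays : NExpr → List ℕ
  | const _ => []
  | cell A i j k => A :: (i.arrays ++ j.arrays ++ k.arrays)
  | add e f => e.arrays ++ f.arrays
  | sub e f => e.arrays ++ f.arrays

/-- The arrays of natural numbers that an expression with real values refers to. -/
def RExpr.arrays : RExpr → List ℕ
  | zero => []
  | cell _ i j k => i.arrays ++ j.arrays ++ k.arrays
  | add e f => e.arrays ++ f.arrays
  | sub e f => e.arrays ++ f.arrays

/-- The arrays of real numbers that an expression refers to. -/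
def RExpr.realArrays : RExpr → List ℕ
  | zero => []
  | cell A _ _ _ => [A]
  | add e f => e.realArrays ++ f.realArrays
  | sub e f => e.realArrays ++ f.realArrays

lemma NExpr.eval_congr {s s' : Store} (e : NExpr) (h : ∀ A ∈ e.arrays, s'.nat A = s.nat A) :
    e.eval s' = e.eval s := by
  induction e with
  | const n => rfl
  | cell A i j k hi hj hk =>
    simp only [arrays, List.mem_cons, List.mem_append] at h
    simp only [eval, h A (Or.inl rfl), hi fun B hB => h B (by tauto), hj fun B hB => h B (by tauto),
      hk fun B hB => h B (by tauto)]
  | add e f he hf =>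
    simp only [arrays, List.mem_append] at h
    simp only [eval, he fun B hB => h B (by tauto), hf fun B hB => h B (by tauto)]
  | sub e f he hf =>
    simp only [arrays, List.mem_append] at h
    simp only [eval, he fun B hB => h B (by tauto), hf fun B hB => h B (by tauto)]

lemma RExpr.eval_congr {s s' : Store} (e : RExpr) (h : ∀ A ∈ e.arrays, s'.nat A = s.nat A)
    (hr : ∀ A ∈ e.realArrays, s'.real A = s.real A) : e.eval s' = e.eval s := by
  induction e with
  | zero => rfl
  | cell A i j k =>
    simp only [arrays, List.mem_append] at h
    simp only [eval, hr A (List.mem_singleton.2 rfl), i.eval_congr fun B hB => h B (by tauto),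
      j.eval_congr fun B hB => h B (by tauto), k.eval_congr fun B hB => h B (by tauto)]
  | add e f he hf =>
    simp only [arrays, realArrays, List.mem_append] at h hr
    simp only [eval, he (fun B hB => h B (by tauto)) (fun B hB => hr B (by tauto)),
      hf (fun B hB => h B (by tauto)) (fun B hB => hr B (by tauto))]
  | sub e f he hf =>
    simp only [arrays, realArrays, List.mem_append] at h hr
    simp only [eval, he (fun B hB => h B (by tauto)) (fun B hB => hr B (by tauto)),
      hf (fun B hB => h B (by tauto)) (fun B hB => hr B (by tauto))]

/-! Updates of arrays -/

/-- The array `f` with the entry at `(i, j, k)` replaced. -/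
def upd {α : Type*} (f : ℕ → ℕ → ℕ → α) (i j k : ℕ) (y : α) (i' j' k' : ℕ) : α :=
  if i' = i ∧ j' = j ∧ k' = k then y else f i' j' k'

@[simp] lemma upd_self {α : Type*} (f : ℕ → ℕ → ℕ → α) (i j k : ℕ) (y : α) :
    upd f i j k y i j k = y := by simp [upd]

@[simp] lemma Store.setNat_nat_self (s : Store) (A i j k n : ℕ) :
    (s.setNat A i j k n).nat A = upd (s.nat A) i j k n := by
  funext i' j' k'
  simp [setNat, upd]

@[simp] lemma Store.setNat_nat_of_ne (s : Store) {A B : ℕ} (i j k n : ℕ) (h : B ≠ A) :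
    (s.setNat A i j k n).nat B = s.nat B := by
  funext i' j' k'
  simp [setNat, h]

@[simp] lemma Store.setNat_real (s : Store) (A i j k n : ℕ) :
    (s.setNat A i j k n).real = s.real := rfl

@[simp] lemma Store.setReal_nat (s : Store) (A i j k : ℕ) (y : ℝ) :
    (s.setReal A i j k y).nat = s.nat := rfl

@[simp] lemma Store.setReal_real_self (s : Store) (A i j k : ℕ) (y : ℝ) :
    (s.setReal A i j k y).real A = upd (s.real A) i j k y := by
  funext i' j' k'
  simp [setReal, upd]

@[simp] lemma Store.setReal_real_of_ne (s : Store) {A B : ℕ} (i j k : ℕ) (y : ℝ) (h : B ≠ A) :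
    (s.setReal A i j k y).real B = s.real B := by
  funext i' j' k'
  simp [setReal, h]

lemma NExpr.eval_setNat {A : ℕ} {e : NExpr} (h : A ∉ e.arrays) (s : Store) (i j k n : ℕ) :
    e.eval (s.setNat A i j k n) = e.eval s :=
  e.eval_congr fun _ hB => s.setNat_nat_of_ne i j k n fun hBA => h (hBA ▸ hB)

lemma NExpr.eval_setReal (e : NExpr) (s : Store) (A i j k : ℕ) (y : ℝ) :
    e.eval (s.setReal A i j k y) = e.eval s :=
  e.eval_congr fun _ _ => rfl

lemma RExpr.eval_setNat {A : ℕ} {e : RExpr} (h : A ∉ e.arrays) (s : Store) (i j k n : ℕ) :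
    e.eval (s.setNat A i j k n) = e.eval s :=
  e.eval_congr (fun _ hB => s.setNat_nat_of_ne i j k n fun hBA => h (hBA ▸ hB)) fun _ _ => rfl

lemma RExpr.eval_setReal {A : ℕ} {e : RExpr} (h : A ∉ e.realArrays) (s : Store) (i j k : ℕ)
    (y : ℝ) : e.eval (s.setReal A i j k y) = e.eval s :=
  e.eval_congr (fun _ _ => rfl) fun _ hB => s.setReal_real_of_ne i j k y fun hBA => h (hBA ▸ hB)

namespace Code

/-- The effect of `N` rounds of a loop with counter `x` whose body has the effect `f`. -/
def rounds (x : ℕ) (f : Store → Store) (s : Store) : ℕ → Store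
  | 0 => s.setNat x 0 0 0 0
  | k + 1 => (f (rounds x f s k)).setNat x 0 0 0 (k + 1)

open Classical in
/-- The effect of executing a piece of code. -/
noncomputable def run : Code → Store → Store
  | skip, s => s
  | nset A i j k e, s => s.setNat A (i.eval s) (j.eval s) (k.eval s) (e.eval s)
  | rset A i j k e, s => s.setReal A (i.eval s) (j.eval s) (k.eval s) (e.eval s)
  | seq c d, s => d.run (c.run s)
  | ite b c d, s => if b.Holds s then c.run s else d.run s
  | count x e c, s => rounds x c.run s (e.eval s)

/-- The arrays of natural numbers that are modified. -/
def writes : Code → List ℕ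
  | skip => []
  | nset A _ _ _ _ => [A]
  | rset _ _ _ _ _ => []
  | seq c d => c.writes ++ d.writes
  | ite _ c d => c.writes ++ d.writes
  | count x _ c => x :: c.writes

/-- The arrays of real numbers that are modified. -/
def realWrites : Code → List ℕ
  | skip => []
  | nset _ _ _ _ _ => []
  | rset A _ _ _ _ => [A]
  | seq c d => c.realWrites ++ d.realWrites
  | ite _ c d => c.realWrites ++ d.realWrites
  | count _ _ c => c.realWrites

lemma run_nat (c : Code) {A : ℕ} (h : A ∉ c.writes) (s : Store) : (c.run s).nat A = s.nat A := by
  induction c generalizing s with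
  | skip => rfl
  | nset B i j k e =>
    have : A ≠ B := by simpa [writes] using h
    simp [run, this]
  | rset B i j k e => rfl
  | seq c d hc hd =>
    simp only [writes, List.mem_append, not_or] at h
    rw [run, hd h.2, hc h.1]
  | ite b c d hc hd =>
    simp only [writes, List.mem_append, not_or] at h
    rw [run]
    split_ifs
    exacts [hc h.1 s, hd h.2 s]
  | count x e c hc =>
    simp only [writes, List.mem_cons, not_or] at h
    rw [run]
    induction e.eval s with
    | zero => simp [rounds, h.1]
    | succ k ih => simp [rounds, h.1, hc h.2, ih]

lemma run_real (c : Code) {A : ℕ} (h : A ∉ c.realWrites) (s : Store) :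
    (c.run s).real A = s.real A := by
  induction c generalizing s with
  | skip => rfl
  | nset B i j k e => rfl
  | rset B i j k e =>
    have : A ≠ B := by simpa [realWrites] using h
    simp [run, this]
  | seq c d hc hd =>
    simp only [realWrites, List.mem_append, not_or] at h
    rw [run, hd h.2, hc h.1]
  | ite b c d hc hd =>
    simp only [realWrites, List.mem_append, not_or] at h
    rw [run]
    split_ifs
    exacts [hc h.1 s, hd h.2 s]
  | count x e c hc =>
    simp only [realWrites] at h
    rw [run]
    induction e.eval s with
    | zero => simp [rounds]
    | succ k ih => simp [rounds, hc h, ih]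

/-- Loops preserve invariants. -/
theorem run_count {x : ℕ} {e : NExpr} {c : Code} {s : Store} (I : ℕ → Store → Prop) {N : ℕ}
    (hN : e.eval s = N) (h0 : I 0 (s.setNat x 0 0 0 0))
    (hs : ∀ k < N, ∀ s', s'.nat x 0 0 0 = k → I k s' →
      I (k + 1) ((c.run s').setNat x 0 0 0 (k + 1))) :
    I N ((count x e c).run s) := by
  rw [run, hN]
  have key : ∀ k ≤ N, (rounds x c.run s k).nat x 0 0 0 = k ∧ I k (rounds x c.run s k) := by
    intro k hk
    induction k with
    | zero => exact ⟨by simp [rounds], h0⟩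
    | succ k ih =>
      obtain ⟨h1, h2⟩ := ih (by omega)
      exact ⟨by simp [rounds], hs k (by omega) _ h1 h2⟩
  exact (key N le_rfl).2

/-! ### Compilation -/

def compile : Code → Program
  | skip => .skip
  | nset A i j k e => .nset A i j k e
  | rset A i j k e => .rset A i j k e
  | seq c d => .seq c.compile d.compile
  | ite b c d => .ite b c.compile d.compile
  | count x e c => .seq (.nset x (.const 0) (.const 0) (.const 0) (.const 0))
      (.loop (.nle (.add (var x) (.const 1)) e)
        (.seq c.compile (.nset x (.const 0) (.const 0) (.const 0) (.add (var x) (.const 1)))))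

/-- The bounds of the loops are expressions that refer to the arrays `ro` only, which are never
modified, and the bodies of the loops do not modify the counters. -/
def WellFormed (ro : List ℕ) : Code → Prop
  | skip => True
  | nset A _ _ _ _ => A ∉ ro
  | rset _ _ _ _ _ => True
  | seq c d => c.WellFormed ro ∧ d.WellFormed ro
  | ite _ c d => c.WellFormed ro ∧ d.WellFormed ro
  | count x e c => x ∉ ro ∧ (∀ A ∈ e.arrays, A ∈ ro) ∧ x ∉ c.writes ∧ c.WellFormed ro

/-- Well-formedness of concrete code is thereby settled by `decide`. -/
instance decidableWellFormed (ro : List ℕ) : (c : Code) → Decidable (c.WellFormed ro)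
  | skip => inferInstanceAs (Decidable True)
  | nset A _ _ _ _ => inferInstanceAs (Decidable (A ∉ ro))
  | rset _ _ _ _ _ => inferInstanceAs (Decidable True)
  | seq c d =>
    haveI := decidableWellFormed ro c
    haveI := decidableWellFormed ro d
    inferInstanceAs (Decidable (c.WellFormed ro ∧ d.WellFormed ro))
  | ite _ c d =>
    haveI := decidableWellFormed ro c
    haveI := decidableWellFormed ro d
    inferInstanceAs (Decidable (c.WellFormed ro ∧ d.WellFormed ro))
  | count x e c =>
    haveI := decidableWellFormed ro c
    inferInstanceAs (Decidable
      (x ∉ ro ∧ (∀ A ∈ e.arrays, A ∈ ro) ∧ x ∉ c.writes ∧ c.WellFormed ro))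

/-- The bounds of the loops. -/
def bounds : Code → List NExpr
  | skip => []
  | nset _ _ _ _ _ => []
  | rset _ _ _ _ _ => []
  | seq c d => c.bounds ++ d.bounds
  | ite _ c d => c.bounds ++ d.bounds
  | count _ e c => e :: c.bounds

open Polynomial in
/-- A bound for the running time in terms of a bound for the lengths of the loops. -/
noncomputable def time : Code → ℕ[X]
  | skip => 1
  | nset _ i j k e => C (i.cost + j.cost + k.cost + e.cost + 1)
  | rset _ i j k e => C (i.cost + j.cost + k.cost + e.cost + 1)
  | seq c d => c.time + d.time
  | ite b c d => C b.cost + c.time + d.time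
  | count _ e c => X * (c.time + C (e.cost + 20)) + C (e.cost + 20)

lemma notMem_writes {ro : List ℕ} {c : Code} (h : c.WellFormed ro) {A : ℕ} (hA : A ∈ ro) :
    A ∉ c.writes := by
  induction c with
  | skip => simp [writes]
  | nset B i j k e =>
    simp only [WellFormed] at h
    simp only [writes, List.mem_singleton]
    rintro rfl
    exact h hA
  | rset B i j k e => simp [writes]
  | seq c d hc hd => simp [writes, hc h.1, hd h.2]
  | ite b c d hc hd => simp [writes, hc h.1, hd h.2]
  | count x e c hc =>
    obtain ⟨h1, _, _, h4⟩ := h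
    simp only [writes, List.mem_cons, hc h4, or_false]
    rintro rfl
    exact h1 hA

/-- Together with `notMem_writes` this shows that loop bounds keep their values during execution, so
it suffices to estimate them in the initial store. -/
lemma arrays_of_mem_bounds {ro : List ℕ} {c : Code} (h : c.WellFormed ro) {e : NExpr}
    (he : e ∈ c.bounds) {A : ℕ} (hA : A ∈ e.arrays) : A ∈ ro := by
  induction c with
  | skip => simp [bounds] at he
  | nset B i j k e => simp [bounds] at he
  | rset B i j k e => simp [bounds] at he
  | seq c d hc hd => exact (List.mem_append.1 he).elim (hc h.1) (hd h.2)
  | ite b c d hc hd => exact (List.mem_append.1 he).elim (hc h.1) (hd h.2)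
  | count x f c hc =>
    obtain ⟨_, h2, _, h4⟩ := h
    rcases List.mem_cons.1 he with rfl | he
    exacts [h2 A hA, hc h4 he]

/-- The compiled code computes the effect of the code, in polynomial time. -/
theorem exec_compile {ro : List ℕ} {c : Code} (h : c.WellFormed ro) {K : ℕ} {s : Store}
    (hK : ∀ e ∈ c.bounds, e.eval s ≤ K) :
    ∃ t ≤ c.time.eval K, Exec c.compile s t (c.run s) := by
  induction c generalizing s with
  | skip => exact ⟨1, by simp [time], Exec.skip s⟩
  | nset A i j k e => exact ⟨_, by simp [time], Exec.nset s A i j k e⟩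
  | rset A i j k e => exact ⟨_, by simp [time], Exec.rset s A i j k e⟩
  | seq c d hc hd =>
    obtain ⟨t, ht, hct⟩ := hc h.1 (s := s) fun e he => hK e (List.mem_append_left _ he)
    obtain ⟨t', ht', hdt⟩ := hd h.2 (s := c.run s) fun e he => by
      rw [e.eval_congr fun A hA =>
        run_nat c (notMem_writes h.1 (arrays_of_mem_bounds h.2 he hA)) s]
      exact hK e (List.mem_append_right _ he)
    exact ⟨t + t', by simp only [time, Polynomial.eval_add]; omega, hct.seq hdt⟩
  | ite b c d hc hd =>
    rw [run]
    by_cases hb : b.Holds s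
    · obtain ⟨t, ht, hct⟩ := hc h.1 (s := s) fun e he => hK e (List.mem_append_left _ he)
      exact ⟨b.cost + t, by simp only [time, Polynomial.eval_add, Polynomial.eval_C]; omega,
        by simpa [hb, compile] using hct.ite_true hb⟩
    · obtain ⟨t, ht, hct⟩ := hd h.2 (s := s) fun e he => hK e (List.mem_append_right _ he)
      exact ⟨b.cost + t, by simp only [time, Polynomial.eval_add, Polynomial.eval_C]; omega,
        by simpa [hb, compile] using hct.ite_false hb⟩
  | count x e c hc =>
    obtain ⟨h1, h2, h3, h4⟩ := h
    set N := e.eval s with hN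
    have hNK : N ≤ K := hK e (List.mem_cons_self ..)
    -- The arrays in `ro` survive every round, so the bound evaluates to `N` at each test.
    have hro : ∀ k, ∀ A ∈ ro, (rounds x c.run s k).nat A = s.nat A := fun k A hA => by
      have hne : A ≠ x := fun h => h1 (h ▸ hA)
      induction k with
      | zero => simp [rounds, hne]
      | succ k ih => simp [rounds, hne, run_nat c (notMem_writes h4 hA), ih]
    have hev : ∀ k, e.eval (rounds x c.run s k) = N := fun k =>
      e.eval_congr fun A hA => hro k A (h2 A hA)
    have hx : ∀ k, (rounds x c.run s k).nat x 0 0 0 = k := fun k => by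
      cases k <;> simp [rounds]
    -- Induction on the number `j` of remaining rounds. Apart from the body, a round costs `e.cost +
    -- 7` for the test and 10 for the increment, and the last, failing test costs `e.cost + 7`. The
    -- constants are rounded up, with room for the initialization of the counter.
    have loop : ∀ j ≤ N, ∃ t ≤ j * (c.time.eval K + (e.cost + 20)) + (e.cost + 10),
        Exec (.loop (.nle (.add (var x) (.const 1)) e) (.seq c.compile
          (.nset x (.const 0) (.const 0) (.const 0) (.add (var x) (.const 1)))))
          (rounds x c.run s (N - j)) t (rounds x c.run s N) := by
      intro j
      induction j with
      | zero =>
        intro _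
        refine ⟨_, ?_, Exec.loop_false ?_⟩
        · simp only [Test.cost, NExpr.cost]
          omega
        · simp [Test.Holds, NExpr.eval, hx, hev]
      | succ j ih =>
        intro hj
        obtain ⟨t, ht, hrest⟩ := ih (by omega)
        obtain ⟨t', ht', hbody⟩ := hc h4 (s := rounds x c.run s (N - (j + 1))) fun f hf => by
          rw [f.eval_congr fun A hA => hro _ A (arrays_of_mem_bounds h4 hf hA)]
          exact hK f (List.mem_cons_of_mem _ hf)
        have hstep := hbody.seq (Exec.nset (c.run (rounds x c.run s (N - (j + 1)))) x (.const 0)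
          (.const 0) (.const 0) (.add (var x) (.const 1)))
        -- `rounds` assigns the next value of the counter, whereas the compiled loop increments the
        -- cell. The two agree because the body does not write to the counter.
        have hnext : (c.run (rounds x c.run s (N - (j + 1)))).setNat x 0 0 0
            (NExpr.eval (c.run (rounds x c.run s (N - (j + 1)))) (.add (var x) (.const 1))) =
            rounds x c.run s (N - j) := by
          have : N - j = N - (j + 1) + 1 := by omega
          rw [this, rounds]
          simp [NExpr.eval, run_nat c h3, hx]
        simp only [NExpr.eval] at hstep hnext
        rw [hnext] at hstep
        refine ⟨_, ?_, Exec.loop_true ?_ hstep hrest⟩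
        · simp only [Test.cost, NExpr.cost]
          rw [add_mul]
          omega
        · simp only [Test.Holds, NExpr.eval, hx, hev]
          omega
    obtain ⟨t, ht, hl⟩ := loop N le_rfl
    have h0 := Exec.nset s x (.const 0) (.const 0) (.const 0) (.const 0)
    simp only [NExpr.eval] at h0
    rw [Nat.sub_self] at hl
    refine ⟨_, ?_, h0.seq hl⟩
    · simp only [NExpr.cost, time, Polynomial.eval_add, Polynomial.eval_mul, Polynomial.eval_C,
        Polynomial.eval_X]
      have := Nat.mul_le_mul_right (c.time.eval K + (e.cost + 20)) hNK
      omega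

end Code
end Rideshare

namespace Rideshare

/-! ### Networks

The nodes of a network are pairs of a location and a time. Arc `e` has two ends, `0` (the tail) and
`1` (the head), and can be used from end `d` to end `1 - d` if its residual capacity `r e d 0` is
positive. The flow on arc `e` is `r e 1 0`. -/

/-- The entry of an array at a node. -/
def nodeVal {α : Type*} (V : ℕ → ℕ → ℕ → α) (v : ℕ × ℕ) : α := V v.1 v.2 0

lemma nodeVal_upd {α : Type*} (V : ℕ → ℕ → ℕ → α) (v w : ℕ × ℕ) (y : α) :
    nodeVal (upd V v.1 v.2 0 y) w = if w = v then y else nodeVal V w := by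
  simp only [nodeVal, upd, Prod.ext_iff, and_true]

/-- The static data of a network. -/
structure Net where
  /-- the number of arcs -/
  M : ℕ
  /-- `ends e 0 d` and `ends e 1 d` are the location and the time of end `d` of arc `e` -/
  ends : ℕ → ℕ → ℕ → ℕ
  /-- `gain e d 0` is the gain from the use of arc `e` from end `d` to end `1 - d` -/
  gain : ℕ → ℕ → ℕ → ℝ
  /-- `dec e d 0` is the amount of residual capacity of arc `e` at end `d` that is used up -/
  dec : ℕ → ℕ → ℕ → ℕ
  l : ℕ
  T : ℕ

namespace Net

variable (G : Net)

/-- End `d` of arc `e`. -/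
def node (e d : ℕ) : ℕ × ℕ := (G.ends e 0 d, G.ends e 1 d)

/-- The sink. -/
def sink : ℕ × ℕ := (0, G.T + 1)

/-- The nodes of a network that are not the sink. -/
def Inner (v : ℕ × ℕ) : Prop := v.1 < G.l ∧ v.2 ≤ G.T

/-- The properties required of a network. -/
structure Proper : Prop where
  inner_tail : ∀ e < G.M, G.Inner (G.node e 0)
  head : ∀ e < G.M, G.Inner (G.node e 1) ∨ G.node e 1 = G.sink
  exit : ∀ v, G.Inner v → ∃ e < G.M, G.node e 0 = v ∧ G.node e 1 = G.sink ∧ G.dec e 0 0 = 0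
  gain_one : ∀ e < G.M, G.gain e 1 0 = - G.gain e 0 0
  dec_one : ∀ e < G.M, G.dec e 1 0 = 1
  time_lt : ∀ e < G.M, (G.node e 0).2 < (G.node e 1).2

variable {G}

lemma sink_not_inner : ¬ G.Inner G.sink := fun h => by
  have := h.2
  simp [sink] at this

lemma Proper.node (hG : G.Proper) {e d : ℕ} (he : e < G.M) (hd : d < 2) :
    G.Inner (G.node e d) ∨ G.node e d = G.sink := by
  interval_cases d
  exacts [Or.inl (hG.inner_tail e he), hG.head e he]

lemma Proper.gain_flip (hG : G.Proper) {e d : ℕ} (he : e < G.M) (hd : d < 2) :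
    G.gain e (1 - d) 0 = - G.gain e d 0 := by
  interval_cases d
  · exact hG.gain_one e he
  · simp [hG.gain_one e he]

variable (G)

/-- The gain from an arc never exceeds the loss of potential. -/
def Valid (r : ℕ → ℕ → ℕ → ℕ) (V : ℕ → ℕ → ℕ → ℝ) : Prop :=
  ∀ e < G.M, ∀ d < 2, 1 ≤ r e d 0 →
    G.gain e d 0 + nodeVal V (G.node e (1 - d)) ≤ nodeVal V (G.node e d)

/-- Arc `e` can be used from end `d`, and its gain equals the loss of potential. -/
def Tight (r : ℕ → ℕ → ℕ → ℕ) (V : ℕ → ℕ → ℕ → ℝ) (e d : ℕ) : Prop :=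
  e < G.M ∧ d < 2 ∧ 1 ≤ r e d 0 ∧
    G.gain e d 0 + nodeVal V (G.node e (1 - d)) = nodeVal V (G.node e d)

/-- Residual capacities: arcs with `dec e 0 0 = 0` have no limit, the others have capacity one. -/
def Capacities (r : ℕ → ℕ → ℕ → ℕ) : Prop :=
  ∀ e < G.M, (G.dec e 0 0 = 0 → 1 ≤ r e 0 0) ∧ (G.dec e 0 0 = 1 → r e 0 0 + r e 1 0 = 1)

/-- The outflow minus the inflow at a node. -/
def net (f : ℕ → ℕ) (v : ℕ × ℕ) : ℤ :=
  ∑ e ∈ Finset.range G.M,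
    (f e : ℤ) * ((if G.node e 0 = v then 1 else 0) - (if G.node e 1 = v then 1 else 0))

lemma net_of_eq {f f' : ℕ → ℕ} {e : ℕ} {c : ℤ} (he : e < G.M) (h : ∀ e', e' ≠ e → f' e' = f e')
    (hc : (f' e : ℤ) = f e + c) (v : ℕ × ℕ) :
    G.net f' v = G.net f v +
      c * ((if G.node e 0 = v then 1 else 0) - (if G.node e 1 = v then 1 else 0)) := by
  have he' : e ∈ Finset.range G.M := Finset.mem_range.2 he
  rw [net, net, ← Finset.add_sum_erase _ _ he', ← Finset.add_sum_erase _ _ he', hc,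
    Finset.sum_congr rfl fun e' h' => by rw [h e' (Finset.ne_of_mem_erase h')]]
  ring

/-- Where there is more outflow than inflow, there is an outgoing arc in use. -/
lemma exists_of_net_pos {f : ℕ → ℕ} {v : ℕ × ℕ} (h : 0 < G.net f v) :
    ∃ e < G.M, 1 ≤ f e ∧ G.node e 0 = v := by
  by_contra! hcon
  refine absurd h (not_lt.2 (Finset.sum_nonpos fun e he => ?_))
  have := hcon e (Finset.mem_range.1 he)
  by_cases hf : 1 ≤ f e
  · simp only [this hf, if_false]
    split_ifs <;> simp
  · have : f e = 0 := by omega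
    simp [this]

variable {G}

/-- There are no circulations. -/
lemma Proper.eq_zero_of_net (hG : G.Proper) {f : ℕ → ℕ} (h : ∀ v, v ≠ G.sink → G.net f v = 0)
    {e : ℕ} (he : e < G.M) : f e = 0 := by
  -- Induction on the time of the tail: the arcs into a node have earlier tails, hence no flow, so
  -- conservation forces all the flow out of the node to vanish.
  suffices key : ∀ t, ∀ e < G.M, (G.node e 0).2 < t → f e = 0 from key _ e he (Nat.lt_succ_self _)
  intro t
  induction t with
  | zero => intro e _ h0; omega
  | succ t ih =>
    intro e he ht
    have hns : G.node e 0 ≠ G.sink := fun h0 => sink_not_inner (h0 ▸ hG.inner_tail e he)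
    have hsum := h _ hns
    have hterm : ∀ e' ∈ Finset.range G.M, (f e' : ℤ) *
        ((if G.node e' 0 = G.node e 0 then 1 else 0) -
          (if G.node e' 1 = G.node e 0 then 1 else 0)) =
        (f e' : ℤ) * (if G.node e' 0 = G.node e 0 then 1 else 0) := by
      intro e' he'
      have he' := Finset.mem_range.1 he'
      by_cases h1 : G.node e' 1 = G.node e 0
      · have h2 := hG.time_lt e' he'
        rw [h1] at h2
        simp [ih e' he' (by omega)]
      · simp [h1]
    rw [net, Finset.sum_congr rfl hterm, Finset.sum_eq_zero_iff_of_nonneg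
      (fun e' _ => by split_ifs <;> simp)] at hsum
    have := hsum e (Finset.mem_range.2 he)
    simpa using this

/-- The residual capacities after the use of arc `e` from end `d`. -/
def flip (G : Net) (r : ℕ → ℕ → ℕ → ℕ) (e d : ℕ) : ℕ → ℕ → ℕ → ℕ :=
  upd (upd r e d 0 (r e d 0 - G.dec e d 0)) e (1 - d) 0 (r e (1 - d) 0 + 1)

lemma flip_of_ne {r : ℕ → ℕ → ℕ → ℕ} {e d e' : ℕ} (h : e' ≠ e) (d' : ℕ) :
    G.flip r e d e' d' 0 = r e' d' 0 := by
  simp [flip, upd, h]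

/-- The only direction that may become available is the reverse of a tight arc. Its gain is the
opposite, so it is tight as well. -/
lemma Tight.valid_flip (hG : G.Proper) {r : ℕ → ℕ → ℕ → ℕ} {V : ℕ → ℕ → ℕ → ℝ} {e d : ℕ}
    (ht : G.Tight r V e d) (hV : G.Valid r V) : G.Valid (G.flip r e d) V := by
  obtain ⟨he, hd, _, h3⟩ := ht
  intro e' he' d' hd' h'
  by_cases hee : e' = e
  · subst hee
    have hf := hG.gain_flip he hd
    by_cases hdd : d' = d
    · subst hdd
      exact h3.le
    · have h4 : d' = 1 - d := by omega
      have h5 : 1 - d' = d := by omega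
      rw [h5, h4, hf]
      linarith
  · rw [flip_of_ne hee] at h'
    exact hV e' he' d' hd' h'

/-- On an unlimited arc forward use takes nothing off the forward residual and backward use adds to
it. On a unit arc the single unit moves from one end to the other. -/
lemma Tight.capacities_flip (hG : G.Proper) {r : ℕ → ℕ → ℕ → ℕ} {V : ℕ → ℕ → ℕ → ℝ} {e d : ℕ}
    (ht : G.Tight r V e d) (hr : G.Capacities r) : G.Capacities (G.flip r e d) := by
  obtain ⟨he, hd, h2, _⟩ := ht
  intro e' he'
  by_cases hee : e' = e
  · subst hee
    obtain ⟨h3, h4⟩ := hr e' he'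
    have h5 := hG.dec_one e' he'
    interval_cases d
    · refine ⟨fun h => ?_, fun h => ?_⟩
      · simp [flip, upd, h, h3 h]
      · have := h4 h
        simp only [flip, upd, h]
        simp
        omega
    · refine ⟨fun h => ?_, fun h => ?_⟩
      · simp [flip, upd]
      · have := h4 h
        simp only [flip, upd, h5]
        simp
        omega
  · simp only [flip_of_ne hee]
    exact hr e' he'

/-- Use from the tail adds a unit of flow and use from the head cancels one. Either way one more net
unit leaves end `d` and one fewer leaves the other end. -/
lemma Tight.net_flip (hG : G.Proper) {r : ℕ → ℕ → ℕ → ℕ} {V : ℕ → ℕ → ℕ → ℝ} {e d : ℕ}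
    (ht : G.Tight r V e d) (v : ℕ × ℕ) :
    G.net (fun e' => G.flip r e d e' 1 0) v = G.net (fun e' => r e' 1 0) v +
      (if G.node e d = v then 1 else 0) - (if G.node e (1 - d) = v then 1 else 0) := by
  obtain ⟨he, hd, h2, _⟩ := ht
  have h5 := hG.dec_one e he
  interval_cases d
  · rw [net_of_eq G (c := 1) he (f := fun e' => r e' 1 0) (fun e' h => flip_of_ne h 1)
      (by simp [flip, upd])]
    simp
    ring
  · rw [net_of_eq G (c := -1) he (f := fun e' => r e' 1 0) (fun e' h => flip_of_ne h 1) (by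
      simp only [flip, upd, h5]
      simp
      omega)]
    simp
    ring

/-- The potential may be lowered by the least slack on a set of nodes. -/
lemma valid_shift {r : ℕ → ℕ → ℕ → ℕ} {V V' : ℕ → ℕ → ℕ → ℝ} (hV : G.Valid r V)
    {L : List (ℕ × ℕ)} {c : ℝ} (hc : 0 ≤ c)
    (hin : ∀ e < G.M, ∀ d < 2, G.node e d ∈ L →
      nodeVal V' (G.node e d) = nodeVal V (G.node e d) - c)
    (hout : ∀ e < G.M, ∀ d < 2, G.node e d ∉ L →
      nodeVal V' (G.node e d) = nodeVal V (G.node e d))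
    (hmin : ∀ e < G.M, ∀ d < 2, 1 ≤ r e d 0 → G.node e d ∈ L → G.node e (1 - d) ∉ L →
      c ≤ nodeVal V (G.node e d) - nodeVal V (G.node e (1 - d)) - G.gain e d 0) :
    G.Valid r V' := by
  intro e he d hd hr
  have h := hV e he d hd hr
  have hd' : 1 - d < 2 := by omega
  -- Inside the set both ends fall together, and for arcs into the set only the head falls. Just the
  -- arcs that leave the set need the bound on `c`.
  by_cases h1 : G.node e d ∈ L <;> by_cases h2 : G.node e (1 - d) ∈ L
  · rw [hin e he d hd h1, hin e he _ hd' h2]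
    linarith
  · have := hmin e he d hd hr h1 h2
    rw [hin e he d hd h1, hout e he _ hd' h2]
    linarith
  · rw [hout e he d hd h1, hin e he _ hd' h2]
    linarith
  · rw [hout e he d hd h1, hout e he _ hd' h2]
    exact h

/-- The nodes of a tree rooted at `src`, latest first: to each node `w` but the root leads an arc
with property `A`, arc `pe w` from end `pd w`, from an earlier node. -/
def Tree (G : Net) (A : ℕ → ℕ → Prop) (pe pd : ℕ → ℕ → ℕ → ℕ) (src : ℕ × ℕ) :
    List (ℕ × ℕ) → Prop
  | [] => False
  | w :: L => (L = [] ∧ w = src) ∨ (w ∉ L ∧ Tree G A pe pd src L ∧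
      A (nodeVal pe w) (nodeVal pd w) ∧ G.node (nodeVal pe w) (nodeVal pd w) ∈ L ∧
      G.node (nodeVal pe w) (1 - nodeVal pd w) = w)

/-- Needed both when the potential is lowered on the tree and when an arc is flipped. In both cases
the property of arcs can be transferred only where both ends lie in the tree. -/
lemma Tree.congr {A A' : ℕ → ℕ → Prop} {pe pd pe' pd' : ℕ → ℕ → ℕ → ℕ} {src : ℕ × ℕ}
    {L : List (ℕ × ℕ)} (h : G.Tree A pe pd src L)
    (hA : ∀ e d, G.node e d ∈ L → G.node e (1 - d) ∈ L → A e d → A' e d)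
    (hp : ∀ v ∈ L, nodeVal pe' v = nodeVal pe v ∧ nodeVal pd' v = nodeVal pd v) :
    G.Tree A' pe' pd' src L := by
  induction L with
  | nil => exact h
  | cons w L ih =>
    rcases h with h | ⟨h1, h2, h3, h4, h5⟩
    · exact Or.inl h
    · obtain ⟨hw1, hw2⟩ := hp w (List.mem_cons_self ..)
      refine Or.inr ⟨h1, ih h2 (fun e d h h' => hA e d (List.mem_cons_of_mem _ h)
        (List.mem_cons_of_mem _ h')) fun v hv => hp v (List.mem_cons_of_mem _ hv), ?_⟩
      rw [hw1, hw2]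
      exact ⟨hA _ _ (List.mem_cons_of_mem _ h4) (by rw [h5]; exact List.mem_cons_self ..) h3,
        h4, h5⟩

lemma Tree.src_mem {A : ℕ → ℕ → Prop} {pe pd : ℕ → ℕ → ℕ → ℕ} {src : ℕ × ℕ}
    {L : List (ℕ × ℕ)} (h : G.Tree A pe pd src L) : src ∈ L := by
  induction L with
  | nil => exact h.elim
  | cons w L ih =>
    rcases h with ⟨_, h⟩ | ⟨_, h2, _⟩
    · simp [h]
    · exact List.mem_cons_of_mem _ (ih h2)

lemma Tree.nodup {A : ℕ → ℕ → Prop} {pe pd : ℕ → ℕ → ℕ → ℕ} {src : ℕ × ℕ}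
    {L : List (ℕ × ℕ)} (h : G.Tree A pe pd src L) : L.Nodup := by
  induction L with
  | nil => exact h.elim
  | cons w L ih =>
    rcases h with ⟨h, _⟩ | ⟨h1, h2, _⟩
    · simp [h]
    · exact List.nodup_cons.2 ⟨h1, ih h2⟩

/-- The latest node comes first, so every nonempty suffix is again a tree. This allows a walk back
to the root in which the list of remaining nodes keeps shrinking. -/
lemma Tree.exists_cons {A : ℕ → ℕ → Prop} {pe pd : ℕ → ℕ → ℕ → ℕ} {src w : ℕ × ℕ}
    {L : List (ℕ × ℕ)} (h : G.Tree A pe pd src L) (hw : w ∈ L) :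
    ∃ L', G.Tree A pe pd src (w :: L') ∧ L'.length < L.length := by
  induction L with
  | nil => exact h.elim
  | cons v L ih =>
    rcases List.mem_cons.1 hw with rfl | hw
    · exact ⟨L, h, by simp⟩
    · rcases h with ⟨rfl, _⟩ | ⟨_, h2, _⟩
      · simp at hw
      · obtain ⟨L', h3, h4⟩ := ih h2 hw
        exact ⟨L', h3, by simp; omega⟩

end Net
end Rideshare

namespace Rideshare

/-! ### The algorithm

Each driver in turn is routed along a shortest augmenting path from her entrance to the sink, which
stands for having left. The algorithm uses the following arrays of natural numbers, apart from those
that hold the input and the output: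
* `10`, `11`, `12`: ends, residual capacities and decrements of the arcs of the network;
* `13`: the number of arcs;
* `14`, `15`, `16`: membership in the tree, arc leading to a node, and the end of the arc from which
  it leads to the node;
* `20`, `21`, `22`: counters for drivers or riders, rounds and arcs;
* `23`, `24`, `25`: counters for locations and times;
* `26`, `27`, `28`: whether an arc has been found, the arc, and its end;
* `29`, `30`: location and time of the current node;

and the following arrays of real numbers:
* `10`: gains from the arcs;
* `11`: the potential of the nodes;
* `12`, `13`: the least slack, and the sum of the values of the riders. -/

namespace Algorithm

notation:60 c:61 ";;" d:60 => Code.seq c d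

instance (n : ℕ) : OfNat NExpr n := ⟨.const n⟩
instance : Add NExpr := ⟨.add⟩
instance : Sub NExpr := ⟨.sub⟩
instance : Zero RExpr := ⟨.zero⟩
instance : Add RExpr := ⟨.add⟩
instance : Sub RExpr := ⟨.sub⟩

@[simp] lemma eval_zero (s : Store) : NExpr.eval s 0 = 0 := rfl
@[simp] lemma eval_one (s : Store) : NExpr.eval s 1 = 1 := rfl
@[simp] lemma eval_two (s : Store) : NExpr.eval s 2 = 2 := rfl
@[simp] lemma eval_three (s : Store) : NExpr.eval s 3 = 3 := rfl
@[simp] lemma eval_const (s : Store) (n : ℕ) : NExpr.eval s (.const n) = n := rfl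
@[simp] lemma eval_cell (s : Store) (A : ℕ) (i j k : NExpr) :
    NExpr.eval s (.cell A i j k) = s.nat A (i.eval s) (j.eval s) (k.eval s) := rfl
@[simp] lemma eval_add (s : Store) (e f : NExpr) : (e + f).eval s = e.eval s + f.eval s := rfl
@[simp] lemma eval_sub (s : Store) (e f : NExpr) : (e - f).eval s = e.eval s - f.eval s := rfl
@[simp] lemma reval_zero (s : Store) : RExpr.eval s 0 = 0 := rfl
@[simp] lemma reval_cell (s : Store) (A : ℕ) (i j k : NExpr) :
    RExpr.eval s (.cell A i j k) = s.real A (i.eval s) (j.eval s) (k.eval s) := rfl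
@[simp] lemma reval_add (s : Store) (e f : RExpr) : (e + f).eval s = e.eval s + f.eval s := rfl
@[simp] lemma reval_sub (s : Store) (e f : RExpr) : (e - f).eval s = e.eval s - f.eval s := rfl
@[simp] lemma holds_nle (s : Store) (e f : NExpr) :
    (Test.nle e f).Holds s ↔ e.eval s ≤ f.eval s := Iff.rfl
@[simp] lemma holds_rle (s : Store) (e f : RExpr) :
    (Test.rle e f).Holds s ↔ e.eval s ≤ f.eval s := Iff.rfl
@[simp] lemma holds_not (s : Store) (b : Test) : (Test.not b).Holds s ↔ ¬ b.Holds s := Iff.rfl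
@[simp] lemma holds_and (s : Store) (b c : Test) :
    (Test.and b c).Holds s ↔ b.Holds s ∧ c.Holds s := Iff.rfl

open Code

/-- Assignment to a scalar variable. -/
abbrev assign (x : ℕ) (e : NExpr) : Code := nset x 0 0 0 e

abbrev locs : NExpr := .cell 0 0 0 0
abbrev drivers : NExpr := .cell 0 1 0 0
abbrev riders : NExpr := .cell 0 2 0 0
abbrev horizon : NExpr := .cell 0 3 0 0

/-! Construction of the network -/

/-- Append an arc to the network. -/
def addArc (tl tt hl ht : NExpr) (g : RExpr) (u : NExpr) : Code :=
  nset 10 (var 13) 0 0 tl ;; nset 10 (var 13) 1 0 tt ;;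
  nset 10 (var 13) 0 1 hl ;; nset 10 (var 13) 1 1 ht ;;
  rset 10 (var 13) 0 0 g ;; rset 10 (var 13) 1 0 (0 - g) ;;
  nset 12 (var 13) 0 0 u ;; nset 12 (var 13) 1 0 1 ;; nset 11 (var 13) 0 0 1 ;;
  nset 11 (var 13) 1 0 0 ;; assign 13 (var 13 + 1)

/-- For every driver an arc for her empty path. -/
def addEmptyPaths : Code :=
  count 20 drivers
    (ite (.nle (.cell 2 (var 20) 0 0) 0)
      (addArc (.cell 2 (var 20) 1 0) (.cell 2 (var 20) 2 0) 0 (horizon + 1) 0 1)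
      (addArc (.cell 2 (var 20) 1 0) (.cell 2 (var 20) 2 0) 0 (horizon + 1)
        (0 - .cell 1 (horizon - .cell 2 (var 20) 2 0) 0 0) 1))

/-- For every rider an arc for her trip. -/
def addRiders : Code :=
  count 20 riders
    (addArc (.cell 3 (var 20) 0 0) (.cell 3 (var 20) 2 0) (.cell 3 (var 20) 1 0)
      (.cell 3 (var 20) 2 0 + .cell 1 (.cell 3 (var 20) 0 0) (.cell 3 (var 20) 1 0) 0)
      (.cell 2 (var 20) 0 0 -
        .cell 0 (.cell 3 (var 20) 0 0) (.cell 3 (var 20) 1 0) (.cell 3 (var 20) 2 0)) 1)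

/-- For every location and time an arc for exiting. -/
def addExits : Code :=
  count 23 locs (count 25 (horizon + 1)
    (addArc (var 23) (var 25) 0 (horizon + 1) (0 - .cell 1 (horizon - var 25) 0 0) 0))

/-- For every feasible trip an arc for relocations. -/
def addRelocations : Code :=
  count 23 locs (count 24 locs (count 25 (horizon + 1)
    (ite (.nle (var 25 + .cell 1 (var 23) (var 24) 0) horizon)
      (addArc (var 23) (var 25) (var 24) (var 25 + .cell 1 (var 23) (var 24) 0)
        (0 - .cell 0 (var 23) (var 24) (var 25)) 0)
      skip)))

/-- The initial potential: the sum of the riders' values times the remaining time. -/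
def initPotential : Code :=
  count 20 riders (rset 13 0 0 0 (.cell 13 0 0 0 + .cell 2 (var 20) 0 0)) ;;
  count 23 locs (count 25 (horizon + 1)
    (rset 11 (var 23) (horizon - var 25) 0
      (.cell 11 (var 23) (horizon + 1 - var 25) 0 + .cell 13 0 0 0)))

def network : Code := addEmptyPaths ;; addRiders ;; addExits ;; addRelocations

def setup : Code := network ;; initPotential

/-! Routing of the drivers -/

/-- The entry of an array at end `d` of arc `e`. -/
abbrev atEnd (A : ℕ) (e d : NExpr) : NExpr := .cell A (.cell 10 e 0 d) (.cell 10 e 1 d) 0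

/-- The potential of end `d` of arc `e`. -/
abbrev potAtEnd (e d : NExpr) : RExpr := .cell 11 (.cell 10 e 0 d) (.cell 10 e 1 d) 0

/-- Begin the tree of the current driver. -/
def initTree : Code :=
  count 23 locs (count 25 (horizon + 2) (nset 14 (var 23) (var 25) 0 0)) ;;
  nset 14 (.cell 2 (var 20) 1 0) (.cell 2 (var 20) 2 0) 0 1

/-- See if the current arc, used from end `d`, is the one with least slack that leaves the tree. -/
def probe (d : ℕ) : Code :=
  ite (.and (.nle 1 (atEnd 14 (var 22) (.const d)))
      (.and (.nle (atEnd 14 (var 22) (.const (1 - d))) 0) (.nle 1 (.cell 11 (var 22) (.const d) 0))))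
    (ite (.and (.nle 1 (var 26)) (.rle (.cell 12 0 0 0)
        (potAtEnd (var 22) (.const d) - potAtEnd (var 22) (.const (1 - d)) -
          .cell 10 (var 22) (.const d) 0)))
      skip
      (rset 12 0 0 0 (potAtEnd (var 22) (.const d) - potAtEnd (var 22) (.const (1 - d)) -
          .cell 10 (var 22) (.const d) 0) ;;
        assign 26 1 ;; assign 27 (var 22) ;; assign 28 (.const d)))
    skip

/-- Find the arc with least slack that leaves the tree. -/
def scan : Code := assign 26 0 ;; count 22 (var 13) (probe 0 ;; probe 1)

/-- Lower the potential on the tree by the least slack. -/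
def lower : Code :=
  count 23 locs (count 25 (horizon + 2)
    (ite (.nle 1 (.cell 14 (var 23) (var 25) 0))
      (rset 11 (var 23) (var 25) 0 (.cell 11 (var 23) (var 25) 0 - .cell 12 0 0 0)) skip))

/-- Add a node to the tree. -/
def attach : Code :=
  nset 15 (.cell 10 (var 27) 0 (1 - var 28)) (.cell 10 (var 27) 1 (1 - var 28)) 0 (var 27) ;;
  nset 16 (.cell 10 (var 27) 0 (1 - var 28)) (.cell 10 (var 27) 1 (1 - var 28)) 0 (var 28) ;;
  nset 14 (.cell 10 (var 27) 0 (1 - var 28)) (.cell 10 (var 27) 1 (1 - var 28)) 0 1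

/-- Grow the tree until it contains the sink. -/
def grow : Code :=
  count 21 (var 13) (ite (.nle (.cell 14 0 (horizon + 1) 0) 0) (scan ;; lower ;; attach) skip)

/-- Use the arc that leads to the current node. -/
def stepBack : Code :=
  assign 27 (.cell 15 (var 29) (var 30) 0) ;; assign 28 (.cell 16 (var 29) (var 30) 0) ;;
  nset 11 (var 27) (var 28) 0 (.cell 11 (var 27) (var 28) 0 - .cell 12 (var 27) (var 28) 0) ;;
  nset 11 (var 27) (1 - var 28) 0 (.cell 11 (var 27) (1 - var 28) 0 + 1) ;;
  assign 29 (.cell 10 (var 27) 0 (var 28)) ;; assign 30 (.cell 10 (var 27) 1 (var 28))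

/-- Use the arcs on the path from the entrance of the current driver to the sink. -/
def augment : Code :=
  assign 29 0 ;; assign 30 (horizon + 1) ;;
  count 21 (var 13 + 1)
    (ite (.and (.and (.nle (var 29) (.cell 2 (var 20) 1 0)) (.nle (.cell 2 (var 20) 1 0) (var 29)))
        (.and (.nle (var 30) (.cell 2 (var 20) 2 0)) (.nle (.cell 2 (var 20) 2 0) (var 30))))
      skip stepBack)

def route : Code := count 20 drivers (initTree ;; grow ;; augment)

/-! Output -/

/-- Output the trip prices and the pick-ups. -/
def writePrices : Code :=
  count 23 locs (count 24 locs (count 25 (horizon + 1)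
    (rset 3 (var 23) (var 24) (var 25) (.cell 0 (var 23) (var 24) (var 25) +
      .cell 11 (var 23) (var 25) 0 -
      .cell 11 (var 24) (var 25 + .cell 1 (var 23) (var 24) 0) 0)))) ;;
  count 20 riders (nset 4 (var 20) 0 0 (.cell 11 (drivers + var 20) 1 0))

/-- Find an arc with flow, other than those for empty paths, that leaves the current node. -/
def findArc : Code :=
  count 22 (var 13)
    (ite (.and (.nle drivers (var 22)) (.and (.nle 1 (.cell 11 (var 22) 1 0))
        (.and (.and (.nle (var 29) (.cell 10 (var 22) 0 0)) (.nle (.cell 10 (var 22) 0 0) (var 29)))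
          (.and (.nle (var 30) (.cell 10 (var 22) 1 0)) (.nle (.cell 10 (var 22) 1 0) (var 30))))))
      (assign 27 (var 22)) skip)

/-- Append a trip along the arc found to the action path of the current driver. -/
def recordTrip : Code :=
  nset 6 (var 20) (.cell 5 (var 20) 0 0) 0 (var 29) ;;
  nset 6 (var 20) (.cell 5 (var 20) 0 0) 1 (.cell 10 (var 27) 0 1) ;;
  nset 6 (var 20) (.cell 5 (var 20) 0 0) 2 (var 30) ;;
  ite (.nle (drivers + riders) (var 27)) (nset 6 (var 20) (.cell 5 (var 20) 0 0) 3 0)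
    (nset 6 (var 20) (.cell 5 (var 20) 0 0) 3 (var 27 - drivers + 1)) ;;
  nset 5 (var 20) 0 0 (.cell 5 (var 20) 0 0 + 1)

/-- Follow the flow along one arc. -/
def stepForward : Code :=
  findArc ;;
  nset 11 (var 27) 1 0 (.cell 11 (var 27) 1 0 - 1) ;;
  ite (.nle (.cell 10 (var 27) 1 1) horizon) recordTrip skip ;;
  assign 29 (.cell 10 (var 27) 0 1) ;; assign 30 (.cell 10 (var 27) 1 1)

/-- Follow the flow from the entrance of the current driver to the sink. -/
def follow : Code :=
  assign 29 (.cell 2 (var 20) 1 0) ;; assign 30 (.cell 2 (var 20) 2 0) ;;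
  count 21 (horizon + 1) (ite (.nle (var 30) horizon) stepForward skip)

/-- Output the action paths. -/
def writePaths : Code :=
  count 20 drivers (ite (.nle (.cell 11 (var 20) 1 0) 0) follow skip)

def solve : Code := route ;; writePrices ;; writePaths

/-- The program has two phases because the number of arcs in array `13`, which `setup` computes,
bounds loops of `solve` and must be read-only there. -/
lemma wellFormed_setup : setup.WellFormed [0] := by decide

lemma wellFormed_solve : solve.WellFormed [0, 13] := by decide

end Algorithm
end Rideshare

namespace Rideshare

/-! ### Correctness of the construction of the network -/

namespace Algorithm

open Code

variable {l n m : ℕ}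

/-- The store contains the data of the economy. -/
structure Input (E : Economy (Fin l) (Fin n) (Fin m)) (s : Store) : Prop where
  nat : ∀ A < 4, s.nat A = (inputStore E).nat A
  real : ∀ A < 3, s.real A = (inputStore E).real A

namespace Input

variable {E : Economy (Fin l) (Fin n) (Fin m)} {s : Store}

lemma locs (h : Input E s) : s.nat 0 0 0 0 = l := by rw [h.nat 0 (by omega)]; rfl
lemma drivers (h : Input E s) : s.nat 0 1 0 0 = n := by rw [h.nat 0 (by omega)]; rfl
lemma riders (h : Input E s) : s.nat 0 2 0 0 = m := by rw [h.nat 0 (by omega)]; rfl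
lemma horizon (h : Input E s) : s.nat 0 3 0 0 = E.T := by rw [h.nat 0 (by omega)]; rfl

lemma dist (h : Input E s) (a b : Fin l) : s.nat 1 a b 0 = E.dist a b := by
  rw [h.nat 1 (by omega)]
  simp [inputStore, extend]

lemma entered (h : Input E s) (i : Fin n) : s.nat 2 i 0 0 = (E.entered i).toNat := by
  rw [h.nat 2 (by omega)]
  simp [inputStore, extend]

lemma entryLoc (h : Input E s) (i : Fin n) : s.nat 2 i 1 0 = E.entryLoc i := by
  rw [h.nat 2 (by omega)]
  simp [inputStore, extend]

lemma entryTime (h : Input E s) (i : Fin n) : s.nat 2 i 2 0 = E.entryTime i := by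
  rw [h.nat 2 (by omega)]
  simp [inputStore, extend]

lemma orig (h : Input E s) (j : Fin m) : s.nat 3 j 0 0 = (E.request j).orig := by
  rw [h.nat 3 (by omega)]
  simp [inputStore, extend]

lemma dest (h : Input E s) (j : Fin m) : s.nat 3 j 1 0 = (E.request j).dest := by
  rw [h.nat 3 (by omega)]
  simp [inputStore, extend]

lemma start (h : Input E s) (j : Fin m) : s.nat 3 j 2 0 = (E.request j).start := by
  rw [h.nat 3 (by omega)]
  simp [inputStore, extend]

lemma tripCost (h : Input E s) {r : Trip (Fin l)} (hr : r ∈ E.trips) :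
    s.real 0 r.orig r.dest r.start = E.tripCost r := by
  rw [h.real 0 (by omega)]
  have : r.start + E.dist r.orig r.dest ≤ E.T := hr
  simp [inputStore, extend, this]

lemma exitCost (h : Input E s) {Δ : ℕ} (hΔ : Δ ≤ E.T) : s.real 1 Δ 0 0 = E.exitCost Δ := by
  rw [h.real 1 (by omega)]
  simp [inputStore, hΔ]

lemma value (h : Input E s) (j : Fin m) : s.real 2 j 0 0 = E.value j := by
  rw [h.real 2 (by omega)]
  simp [inputStore, extend]

lemma of_eq (h : Input E s) {s' : Store} (hn : ∀ A < 4, s'.nat A = s.nat A) (hr : ∀ A < 3, s'.real A = s.real A) :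
    Input E s' :=
  ⟨fun A hA => (hn A hA).trans (h.nat A hA), fun A hA => (hr A hA).trans (h.real A hA)⟩

lemma run (h : Input E s) {c : Code} (hn : ∀ A < 4, A ∉ c.writes) (hr : ∀ A < 3, A ∉ c.realWrites) :
    Input E (c.run s) :=
  h.of_eq (fun A hA => run_nat c (hn A hA) s) fun A hA => run_real c (hr A hA) s

end Input

/-- The data of an arc; `unit` is `1` if it has capacity one and `0` if there is no limit. -/
structure Row where
  tail : ℕ × ℕ
  head : ℕ × ℕ
  gain : ℝ
  unit : ℕ

/-- Arc `e` of a network has the data `R`. -/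
structure IsRow (G : Net) (e : ℕ) (R : Row) : Prop where
  tail : G.node e 0 = R.tail
  head : G.node e 1 = R.head
  gain : G.gain e 0 0 = R.gain
  gain_one : G.gain e 1 0 = - R.gain
  dec : G.dec e 0 0 = R.unit
  dec_one : G.dec e 1 0 = 1

/-- The network in a store. -/
def netOf (s : Store) : Net where
  M := s.nat 13 0 0 0
  ends := s.nat 10
  gain := s.real 10
  dec := s.nat 12
  l := s.nat 0 0 0 0
  T := s.nat 0 3 0 0

/-- The store holds the arcs listed, with no flow. -/
structure HoldsArcs (s : Store) (L : List Row) : Prop where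
  length : s.nat 13 0 0 0 = L.length
  row : ∀ (e : ℕ) (he : e < L.length), IsRow (netOf s) e L[e]
  res : ∀ e < L.length, s.nat 11 e 0 0 = 1 ∧ s.nat 11 e 1 0 = 0

/-- The expressions after `tl` are evaluated when arrays `10` have been partly overwritten, and
therefore must not refer to them. -/
lemma holdsArcs_addArc {s : Store} {L : List Row} (h : HoldsArcs s L) {tl tt hl ht u : NExpr}
    {g : RExpr} (htt : 10 ∉ tt.arrays) (hhl : 10 ∉ hl.arrays)
    (hht : 10 ∉ ht.arrays) (hu : 10 ∉ u.arrays) (hg : 10 ∉ g.arrays) (hg' : 10 ∉ g.realArrays) :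
    HoldsArcs ((addArc tl tt hl ht g u).run s)
      (L ++ [⟨(tl.eval s, tt.eval s), (hl.eval s, ht.eval s), g.eval s, u.eval s⟩]) := by
  obtain ⟨h1, h2, h3⟩ := h
  have hrun : (addArc tl tt hl ht g u).run s =
      ((((((((((s.setNat 10 L.length 0 0 (tl.eval s)).setNat 10 L.length 1 0 (tt.eval s)).setNat 10
        L.length 0 1 (hl.eval s)).setNat 10 L.length 1 1 (ht.eval s)).setReal 10
        L.length 0 0 (g.eval s)).setReal 10 L.length 1 0 (- g.eval s)).setNat 12
        L.length 0 0 (u.eval s)).setNat 12 L.length 1 0 1).setNat 11 L.length 0 0 1).setNat 11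
        L.length 1 0 0).setNat 13 0 0 0 (L.length + 1) := by
    simp [addArc, Code.run, NExpr.eval_setNat, NExpr.eval_setReal, RExpr.eval_setNat,
      RExpr.eval_setReal, *]
  rw [hrun]
  refine ⟨by simp, fun e he => ?_, fun e he => ?_⟩
  · rcases Nat.lt_or_ge e L.length with hlt | hge
    · have hne : e ≠ L.length := hlt.ne
      rw [List.getElem_append_left hlt]
      obtain ⟨r1, r2, r3, r4, r5, r6⟩ := h2 e hlt
      constructor
      · simpa [netOf, Net.node, upd, hne] using r1
      · simpa [netOf, Net.node, upd, hne] using r2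
      · simpa [netOf, upd, hne] using r3
      · simpa [netOf, upd, hne] using r4
      · simpa [netOf, upd, hne] using r5
      · simpa [netOf, upd, hne] using r6
    · have heq : e = L.length := by simp at he; omega
      subst heq
      constructor <;> simp [netOf, Net.node, upd]
  · rcases Nat.lt_or_ge e L.length with hlt | hge
    · simp [upd, hlt.ne, h3 e hlt]
    · have heq : e = L.length := by simp at he; omega
      simp [upd, heq]

/-- Only one round has to be analysed, in any store that agrees with `s` on the arrays the loop
leaves alone. As the body is arbitrary, nested loops are covered by repeated use. -/
lemma holdsArcs_count {x : ℕ} {e : NExpr} {c : Code} {s : Store} {L : List Row} {N : ℕ}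
    (hL : HoldsArcs s L) (f : Fin N → List Row) (hN : e.eval s = N) (hx : x ∉ [0, 10, 11, 12, 13])
    (h : ∀ (k : Fin N) (s' : Store) (L' : List Row), s'.nat x 0 0 0 = k →
      (∀ A, A ≠ x → A ∉ c.writes → s'.nat A = s.nat A) →
      (∀ A, A ∉ c.realWrites → s'.real A = s.real A) →
      HoldsArcs s' L' → HoldsArcs (c.run s') (L' ++ f k)) :
    HoldsArcs ((count x e c).run s) (L ++ (List.finRange N).flatMap f) := by
  have hset : ∀ (s' : Store) (L' : List Row) (k : ℕ), HoldsArcs s' L' →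
      HoldsArcs (s'.setNat x 0 0 0 k) L' := by
    intro s' L' k ⟨h1, h2, h3⟩
    simp only [List.mem_cons, List.not_mem_nil, or_false, not_or] at hx
    obtain ⟨x0, x10, x11, x12, x13⟩ := hx
    have hnet : netOf (s'.setNat x 0 0 0 k) = netOf s' := by
      simp [netOf, Ne.symm x0, Ne.symm x10, Ne.symm x12, Ne.symm x13]
    exact ⟨by simpa [Ne.symm x13] using h1, by rwa [hnet], by simpa [Ne.symm x11] using h3⟩
  have key := run_count (x := x) (e := e) (c := c) (s := s)
    (fun k s' => HoldsArcs s' (L ++ ((List.finRange N).take k).flatMap f) ∧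
      (∀ A, A ≠ x → A ∉ c.writes → s'.nat A = s.nat A) ∧
      (∀ A, A ∉ c.realWrites → s'.real A = s.real A)) hN
    ⟨by simpa using hset _ _ _ hL, fun A hA _ => by simp [hA], fun A _ => rfl⟩ ?_
  · have := key.1
    rwa [List.take_of_length_le (by simp)] at this
  · rintro k hk s' hk' ⟨h1, h2, h3⟩
    refine ⟨?_, fun A hA hA' => by simp [hA, run_nat c hA', h2 A hA hA'], fun A hA => by
      simp [run_real c hA, h3 A hA]⟩
    have := hset _ _ (k + 1) (h ⟨k, hk⟩ s' _ hk' h2 h3 h1)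
    rwa [List.take_succ_eq_append_getElem (by simpa using hk), List.flatMap_append,
      ← List.append_assoc, List.getElem_finRange, List.flatMap_singleton]

section Arcs

variable (E : Economy (Fin l) (Fin n) (Fin m))

/-- The arc for the empty path of a driver. -/
noncomputable def emptyPathRow (i : Fin n) : Row :=
  ⟨(E.entryLoc i, E.entryTime i), (0, E.T + 1), - E.pathCost i [], 1⟩

/-- The arc for a rider. -/
def riderRow (j : Fin m) : Row :=
  ⟨((E.request j).orig, (E.request j).start), ((E.request j).dest, E.arrival (E.request j)),
    E.value j - E.tripCost (E.request j), 1⟩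

/-- The arc for exiting. -/
def exitRow (a : Fin l) (t : ℕ) : Row := ⟨(a, t), (0, E.T + 1), - E.exitCost (E.T - t), 0⟩

/-- The arc for relocating. -/
def relocationRow (r : Trip (Fin l)) : Row :=
  ⟨(r.orig, r.start), (r.dest, E.arrival r), - E.tripCost r, 0⟩

/-- The arcs for exiting and relocating. -/
def freeArcs : List Row :=
  ((List.finRange l).flatMap fun a =>
    (List.finRange (E.T + 1)).flatMap fun t : Fin (E.T + 1) => [exitRow E a t]) ++
  (List.finRange l).flatMap fun a => (List.finRange l).flatMap fun b =>
    (List.finRange (E.T + 1)).flatMap fun t : Fin (E.T + 1) =>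
      if (t : ℕ) + E.dist a b ≤ E.T then [relocationRow E ⟨a, b, t⟩] else []

/-- All the arcs. -/
noncomputable def arcs : List Row :=
  ((List.finRange n).flatMap fun i => [emptyPathRow E i]) ++
    ((List.finRange m).flatMap fun j => [riderRow E j]) ++ freeArcs E

variable {E} {s : Store} {L : List Row}

lemma holdsArcs_addEmptyPaths (hE : Input E s) (h : HoldsArcs s L) :
    HoldsArcs (addEmptyPaths.run s)
      (L ++ (List.finRange n).flatMap fun i => [emptyPathRow E i]) := by
  refine holdsArcs_count h _ (by simpa using hE.drivers) (by decide) fun i s' L' hi hn hr h' => ?_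
  have hE' : Input E s' := hE.of_eq (fun A hA => hn A (by omega) (by interval_cases A <;> decide))
    fun A hA => hr A (by interval_cases A <;> decide)
  rw [Code.run]
  have hκ := hE'.exitCost (Δ := E.T - E.entryTime i) (by omega)
  split_ifs with hb
  · convert holdsArcs_addArc h' _ _ _ _ _ _ using 3
    · have : E.entered i = false := by
        simp [hi, hE'.entered] at hb
        simpa using hb
      simp [emptyPathRow, hi, hE'.entryLoc, hE'.entryTime, hE'.horizon, Economy.pathCost, this]
    all_goals decide
  · convert holdsArcs_addArc h' _ _ _ _ _ _ using 3
    · have : E.entered i = true := by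
        simp [hi, hE'.entered] at hb
        simpa using hb
      simp [emptyPathRow, hi, hE'.entryLoc, hE'.entryTime, hE'.horizon, Economy.pathCost, this,
        Economy.endTime, hκ]
    all_goals decide

lemma holdsArcs_addRiders (hE : Input E s) (h : HoldsArcs s L) :
    HoldsArcs (addRiders.run s) (L ++ (List.finRange m).flatMap fun j => [riderRow E j]) := by
  refine holdsArcs_count h _ (by simpa using hE.riders) (by decide) fun j s' L' hj hn hr h' => ?_
  have hE' : Input E s' := hE.of_eq (fun A hA => hn A (by omega) (by interval_cases A <;> decide))
    fun A hA => hr A (by interval_cases A <;> decide)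
  have hc := hE'.tripCost (E.request_mem j)
  convert holdsArcs_addArc h' _ _ _ _ _ _ using 3
  · simp [riderRow, hj, hE'.orig, hE'.dest, hE'.start, hE'.dist, hE'.value, hc, Economy.arrival]
  all_goals decide

lemma holdsArcs_addExits (hE : Input E s) (h : HoldsArcs s L) :
    HoldsArcs (addExits.run s) (L ++ (List.finRange l).flatMap fun a =>
      (List.finRange (E.T + 1)).flatMap fun t : Fin (E.T + 1) => [exitRow E a t]) := by
  refine holdsArcs_count h _ (by simpa using hE.locs) (by decide) fun a s' L' ha hn hr h' => ?_
  have hE' : Input E s' := hE.of_eq (fun A hA => hn A (by omega) (by interval_cases A <;> decide))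
    fun A hA => hr A (by interval_cases A <;> decide)
  refine holdsArcs_count (x := 25) (e := horizon + 1) (N := E.T + 1) h'
    (fun t => [exitRow E a t]) (by simpa using hE'.horizon) (by decide)
    fun t s'' L'' ht hn' hr' h'' => ?_
  have hE'' : Input E s'' := hE'.of_eq
    (fun A hA => hn' A (by omega) (by interval_cases A <;> decide))
    fun A hA => hr' A (by interval_cases A <;> decide)
  have ha' : s''.nat 23 0 0 0 = a := by rw [hn' 23 (by omega) (by decide), ha]
  have hκ := hE''.exitCost (Δ := E.T - t) (by omega)
  convert holdsArcs_addArc h'' _ _ _ _ _ _ using 3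
  · simp [exitRow, ha', ht, hE''.horizon, hκ]
  all_goals decide

lemma holdsArcs_addRelocations (hE : Input E s) (h : HoldsArcs s L) :
    HoldsArcs (addRelocations.run s) (L ++ (List.finRange l).flatMap fun a =>
      (List.finRange l).flatMap fun b =>
        (List.finRange (E.T + 1)).flatMap fun t : Fin (E.T + 1) =>
          if (t : ℕ) + E.dist a b ≤ E.T then [relocationRow E ⟨a, b, t⟩] else []) := by
  refine holdsArcs_count h _ (by simpa using hE.locs) (by decide) fun a s' L' ha hn hr h' => ?_
  have hE' : Input E s' := hE.of_eq (fun A hA => hn A (by omega) (by interval_cases A <;> decide))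
    fun A hA => hr A (by interval_cases A <;> decide)
  refine holdsArcs_count h' _ (by simpa using hE'.locs) (by decide)
    fun b s'' L'' hb hn' hr' h'' => ?_
  have hE'' : Input E s'' := hE'.of_eq
    (fun A hA => hn' A (by omega) (by interval_cases A <;> decide))
    fun A hA => hr' A (by interval_cases A <;> decide)
  refine holdsArcs_count (x := 25) (e := horizon + 1) (N := E.T + 1) h'' (fun t =>
      if (t : ℕ) + E.dist a b ≤ E.T then [relocationRow E ⟨a, b, t⟩] else [])
    (by simpa using hE''.horizon) (by decide)
    fun t s₃ L₃ ht hn₃ hr₃ h₃ => ?_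
  have hE₃ : Input E s₃ := hE''.of_eq
    (fun A hA => hn₃ A (by omega) (by interval_cases A <;> decide))
    fun A hA => hr₃ A (by interval_cases A <;> decide)
  have ha₃ : s₃.nat 23 0 0 0 = a := by
    rw [hn₃ 23 (by omega) (by decide), hn' 23 (by omega) (by decide), ha]
  have hb₃ : s₃.nat 24 0 0 0 = b := by rw [hn₃ 24 (by omega) (by decide), hb]
  rw [Code.run]
  have htest : (Test.nle (var 25 + .cell 1 (var 23) (var 24) 0) horizon).Holds s₃ ↔
      (t : ℕ) + E.dist a b ≤ E.T := by
    simp [ha₃, hb₃, ht, hE₃.horizon, hE₃.dist]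
  simp only [htest]
  split_ifs with hle
  · have hc := hE₃.tripCost (r := ⟨a, b, t⟩) hle
    simp only at hc
    convert holdsArcs_addArc h₃ _ _ _ _ _ _ using 3
    · simp [relocationRow, ha₃, hb₃, ht, hE₃.dist, Economy.arrival, hc]
    all_goals decide
  · simpa [Code.run] using h₃

end Arcs

end Algorithm
end Rideshare

/-! ### The network of an economy and its initial potential -/

namespace Rideshare

namespace Algorithm

open Code

variable {l n m : ℕ}

/-- The network consists of the arcs of the economy. -/
structure Represents (E : Economy (Fin l) (Fin n) (Fin m)) (G : Net) : Prop where
  l_eq : G.l = l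
  T_eq : G.T = E.T
  le_M : n + m ≤ G.M
  empty : ∀ i : Fin n, IsRow G i (emptyPathRow E i)
  rider : ∀ j : Fin m, IsRow G (n + j) (riderRow E j)
  free : ∀ e, n + m ≤ e → e < G.M → (∃ (a : Fin l) (t : ℕ), t ≤ E.T ∧ IsRow G e (exitRow E a t)) ∨
    ∃ r ∈ E.trips, IsRow G e (relocationRow E r)
  exit : ∀ (a : Fin l) (t : ℕ), t ≤ E.T → ∃ e < G.M, n + m ≤ e ∧ IsRow G e (exitRow E a t)
  relocation : ∀ r ∈ E.trips, ∃ e < G.M, n + m ≤ e ∧ IsRow G e (relocationRow E r)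

section

variable {E : Economy (Fin l) (Fin n) (Fin m)} {s : Store}

lemma length_arcs : (arcs E).length = n + m + (freeArcs E).length := by
  simp [arcs, Nat.add_assoc]

/-- This serves the running time, since the number of arcs bounds the loops of the routing. -/
lemma length_freeArcs : (freeArcs E).length ≤ l * (E.T + 1) + l * (l * (E.T + 1)) := by
  have h1 : ∀ a b : Fin l, ((List.finRange (E.T + 1)).flatMap fun t : Fin (E.T + 1) =>
      if (t : ℕ) + E.dist a b ≤ E.T then [relocationRow E ⟨a, b, t⟩] else []).length ≤
      E.T + 1 := fun a b => by
    rw [List.length_flatMap]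
    refine (List.sum_le_card_nsmul _ 1 ?_).trans (by simp)
    intro x hx
    obtain ⟨t, _, rfl⟩ := List.mem_map.1 hx
    split_ifs <;> simp
  rw [freeArcs, List.length_append]
  refine Nat.add_le_add (by simp) ?_
  rw [List.length_flatMap]
  refine (List.sum_le_card_nsmul _ (l * (E.T + 1)) ?_).trans (by simp)
  intro x hx
  obtain ⟨a, _, rfl⟩ := List.mem_map.1 hx
  rw [List.length_flatMap]
  refine (List.sum_le_card_nsmul _ (E.T + 1) ?_).trans (by simp)
  intro x hx
  obtain ⟨b, _, rfl⟩ := List.mem_map.1 hx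
  exact h1 a b

lemma mem_freeArcs {R : Row} : R ∈ freeArcs E ↔
    (∃ (a : Fin l) (t : ℕ), t ≤ E.T ∧ R = exitRow E a t) ∨
    ∃ r ∈ E.trips, R = relocationRow E r := by
  simp only [freeArcs, List.mem_append, List.mem_flatMap, List.mem_finRange, true_and,
    List.mem_singleton]
  refine or_congr ⟨?_, ?_⟩ ⟨?_, ?_⟩
  · rintro ⟨a, t, h⟩
    exact ⟨a, t, by omega, h⟩
  · rintro ⟨a, t, ht, h⟩
    exact ⟨a, ⟨t, by omega⟩, h⟩
  · rintro ⟨a, b, t, h⟩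
    split_ifs at h with hle
    · exact ⟨⟨a, b, t⟩, hle, by simpa using h⟩
    · simp at h
  · rintro ⟨r, hr, h⟩
    have hr' : r.start + E.dist r.orig r.dest ≤ E.T := hr
    refine ⟨r.orig, r.dest, ⟨r.start, by omega⟩, ?_⟩
    simp [hr', h]

/-- Arcs are identified by their position in the list: driver `i` has number `i`, rider `j` has
number `n + j`, and the unlimited arcs follow. -/
lemma HoldsArcs.represents (hE : Input E s) (h : HoldsArcs s (arcs E)) :
    Represents E (netOf s) := by
  have hM : (netOf s).M = n + m + (freeArcs E).length := by
    rw [← length_arcs, ← h.length]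
    rfl
  have hlen := length_arcs (E := E)
  have hfree : ∀ (k : ℕ) (hk : k < (freeArcs E).length),
      IsRow (netOf s) (n + m + k) (freeArcs E)[k] := by
    intro k hk
    have := h.row (n + m + k) (by omega)
    simp only [arcs] at this
    rw [List.getElem_append_right (by simp)] at this
    simpa using this
  constructor
  · exact hE.locs
  · exact hE.horizon
  · omega
  · intro i
    have := h.row i (by omega)
    simp only [arcs] at this
    rw [List.getElem_append_left (by simp; omega), List.getElem_append_left (by simp)] at this
    simpa [← List.map_eq_flatMap] using this
  · intro j
    have := h.row (n + j) (by omega)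
    simp only [arcs] at this
    rw [List.getElem_append_left (by simp), List.getElem_append_right (by simp)] at this
    simpa [← List.map_eq_flatMap] using this
  · intro e he he'
    have h1 := hfree (e - (n + m)) (by omega)
    rw [show n + m + (e - (n + m)) = e by omega] at h1
    rcases mem_freeArcs.1 (List.getElem_mem (l := freeArcs E) (n := e - (n + m)) (by omega)) with
      ⟨a, t, ht, h2⟩ | ⟨r, hr, h2⟩
    · exact Or.inl ⟨a, t, ht, h2 ▸ h1⟩
    · exact Or.inr ⟨r, hr, h2 ▸ h1⟩
  · intro a t ht
    obtain ⟨k, hk, h1⟩ := List.mem_iff_getElem.1 (mem_freeArcs.2 (Or.inl ⟨a, t, ht, rfl⟩))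
    exact ⟨n + m + k, by omega, by omega, h1 ▸ hfree k hk⟩
  · intro r hr
    obtain ⟨k, hk, h1⟩ := List.mem_iff_getElem.1 (mem_freeArcs.2 (Or.inr ⟨r, hr, rfl⟩))
    exact ⟨n + m + k, by omega, by omega, h1 ▸ hfree k hk⟩

namespace Represents

variable {G : Net}

/-- A case distinction for arcs. -/
lemma exists_row (h : Represents E G) {e : ℕ} (he : e < G.M) :
    (∃ i : Fin n, e = i ∧ IsRow G e (emptyPathRow E i)) ∨
    (∃ j : Fin m, e = n + j ∧ IsRow G e (riderRow E j)) ∨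
    (n + m ≤ e ∧ ∃ (a : Fin l) (t : ℕ), t ≤ E.T ∧ IsRow G e (exitRow E a t)) ∨
    (n + m ≤ e ∧ ∃ r ∈ E.trips, IsRow G e (relocationRow E r)) := by
  rcases Nat.lt_or_ge e n with h1 | h1
  · exact Or.inl ⟨⟨e, h1⟩, rfl, h.empty ⟨e, h1⟩⟩
  rcases Nat.lt_or_ge e (n + m) with h2 | h2
  · refine Or.inr (Or.inl ⟨⟨e - n, by omega⟩, by simp; omega, ?_⟩)
    have := h.rider ⟨e - n, by omega⟩
    rwa [show n + (e - n) = e by omega] at this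
  · rcases h.free e h2 he with h3 | h3
    · exact Or.inr (Or.inr (Or.inl ⟨h2, h3⟩))
    · exact Or.inr (Or.inr (Or.inr ⟨h2, h3⟩))

/-- What the four kinds of arcs have in common, as needed for `proper`. -/
lemma exists_isRow (h : Represents E G) {e : ℕ} (he : e < G.M) :
    ∃ R, IsRow G e R ∧ (R.tail.1 < l ∧ R.tail.2 ≤ E.T) ∧
      ((R.head.1 < l ∧ R.head.2 ≤ E.T) ∨ R.head = (0, E.T + 1)) ∧ R.tail.2 < R.head.2 := by
  have key : ∀ r ∈ E.trips, r.start ≤ E.T ∧ r.start < E.arrival r := fun r hr => by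
    have h1 : E.arrival r ≤ E.T := hr
    have h2 := E.start_lt_arrival r
    omega
  rcases h.exists_row he with ⟨i, _, hr⟩ | ⟨j, _, hr⟩ | ⟨_, a, t, ht, hr⟩ | ⟨_, r, hrt, hr⟩
  · have := E.entryTime_le i
    exact ⟨_, hr, ⟨(E.entryLoc i).2, this⟩, Or.inr rfl, by simp [emptyPathRow]; omega⟩
  · obtain ⟨h1, h2⟩ := key _ (E.request_mem j)
    exact ⟨_, hr, ⟨Fin.is_lt _, h1⟩, Or.inl ⟨Fin.is_lt _, E.request_mem j⟩, h2⟩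
  · exact ⟨_, hr, ⟨a.2, ht⟩, Or.inr rfl, by simp [exitRow]; omega⟩
  · obtain ⟨h1, h2⟩ := key r hrt
    exact ⟨_, hr, ⟨Fin.is_lt _, h1⟩, Or.inl ⟨Fin.is_lt _, hrt⟩, h2⟩

lemma proper (h : Represents E G) : G.Proper := by
  constructor
  · intro e he
    obtain ⟨R, hR, h1, -⟩ := h.exists_isRow he
    rw [hR.tail]
    exact ⟨by rw [h.l_eq]; exact h1.1, by rw [h.T_eq]; exact h1.2⟩
  · intro e he
    obtain ⟨R, hR, -, h1, -⟩ := h.exists_isRow he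
    rw [hR.head, Net.Inner, Net.sink, h.l_eq, h.T_eq]
    exact h1
  · rintro ⟨a, t⟩ ⟨ha, ht⟩
    rw [h.l_eq] at ha
    rw [h.T_eq] at ht
    obtain ⟨e, he, -, hR⟩ := h.exit ⟨a, ha⟩ t ht
    exact ⟨e, he, hR.tail, by rw [hR.head, Net.sink, h.T_eq]; rfl, hR.dec⟩
  · intro e he
    obtain ⟨R, hR, -⟩ := h.exists_isRow he
    rw [hR.gain, hR.gain_one]
  · intro e he
    obtain ⟨R, hR, -⟩ := h.exists_isRow he
    exact hR.dec_one
  · intro e he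
    obtain ⟨R, hR, -, -, h1⟩ := h.exists_isRow he
    rwa [hR.tail, hR.head]

end Represents

/-! ### The initial potential -/

lemma run_sumValues (hE : Input E s) (h0 : s.real 13 0 0 0 = 0) :
    ((count 20 riders (rset 13 0 0 0 (.cell 13 0 0 0 + .cell 2 (var 20) 0 0))).run s).real 13 0 0 0 =
      ∑ j, E.value j := by
  have key := run_count (x := 20) (e := riders) (s := s)
    (c := rset 13 0 0 0 (.cell 13 0 0 0 + .cell 2 (var 20) 0 0)) (N := m)
    (fun k s' => s'.real 2 = s.real 2 ∧
      s'.real 13 0 0 0 = ∑ j ∈ Finset.range k, s.real 2 j 0 0)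
    (by simpa using hE.riders) (by simp [h0]) (by
      rintro k hk s' hk' ⟨h1, h2⟩
      simp [Code.run, hk', h1, h2, Finset.sum_range_succ])
  rw [key.2, Finset.sum_range]
  exact Finset.sum_congr rfl fun j _ => hE.value j

lemma run_initPotential (hE : Input E s) (h0 : s.real 13 0 0 0 = 0)
    (hV : ∀ a, s.real 11 a (E.T + 1) 0 = 0) :
    (∀ a, (initPotential.run s).real 11 a (E.T + 1) 0 = 0) ∧
    ∀ a < l, ∀ t ≤ E.T + 1,
      (initPotential.run s).real 11 a t 0 = ((E.T + 1 - t : ℕ) : ℝ) * ∑ j, E.value j := by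
  rw [initPotential, Code.run]
  have hb := run_sumValues hE h0
  set c := count 20 riders (rset 13 0 0 0 (.cell 13 0 0 0 + .cell 2 (var 20) 0 0)) with hc
  have hE₁ : Input E (c.run s) := hE.run (fun A hA => by interval_cases A <;> decide)
    fun A hA => by interval_cases A <;> decide
  have hV₁ : ∀ a, (c.run s).real 11 a (E.T + 1) 0 = 0 := by
    rw [run_real c (by decide)]
    exact hV
  generalize c.run s = s₁ at hE₁ hV₁ hb ⊢
  set β := ∑ j, E.value j
  refine (run_count (s := s₁) (fun k s' => (Input E s' ∧ s'.real 13 0 0 0 = β) ∧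
    (∀ a, s'.real 11 a (E.T + 1) 0 = 0) ∧ ∀ a < k, ∀ t ≤ E.T + 1,
      s'.real 11 a t 0 = ((E.T + 1 - t : ℕ) : ℝ) * β) (N := l) (by simpa using hE₁.locs)
    ⟨⟨hE₁.of_eq (fun A hA => by simp [show A ≠ 23 by omega]) fun A hA => rfl, hb⟩,
      by simpa using hV₁, by simp⟩ ?_).2
  rintro a - s₂ ha ⟨⟨hE₂, hb₂⟩, hV₂, hV₂'⟩
  -- Times are treated downwards from `T`: after `k` rounds the entries with `T + 1 ≤ t + k` are in
  -- place. For `k = 0` this is time `T + 1` alone, where the initial zero is correct.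
  have key := run_count (x := 25) (e := horizon + 1) (s := s₂)
    (c := rset 11 (var 23) (horizon - var 25) 0
      (.cell 11 (var 23) (horizon + 1 - var 25) 0 + .cell 13 0 0 0))
    (fun k s' => (Input E s' ∧ s'.real 13 0 0 0 = β ∧ s'.nat 23 0 0 0 = a) ∧
    (∀ a, s'.real 11 a (E.T + 1) 0 = 0) ∧ (∀ t ≤ E.T + 1, E.T + 1 ≤ t + k →
      s'.real 11 a t 0 = ((E.T + 1 - t : ℕ) : ℝ) * β) ∧ ∀ b < a, ∀ t ≤ E.T + 1,
      s'.real 11 b t 0 = ((E.T + 1 - t : ℕ) : ℝ) * β) (N := E.T + 1) (by simp [hE₂.horizon])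
    ⟨⟨hE₂.of_eq (fun A hA => by simp [show A ≠ 25 by omega]) fun A hA => rfl, hb₂, by simpa using ha⟩,
      by simpa using hV₂, fun t ht ht' => by simp [show t = E.T + 1 by omega, hV₂],
      by simpa using hV₂'⟩ ?_
  · obtain ⟨⟨k1, k2, k3⟩, k4, k5, k6⟩ := key
    refine ⟨⟨k1.of_eq (fun A hA => by simp [show A ≠ 23 by omega]) fun A hA => rfl, by simpa using k2⟩,
      by simpa using k4, fun b hb' t ht => ?_⟩
    rcases Nat.lt_succ_iff_lt_or_eq.1 hb' with h | rfl
    · simpa using k6 b h t ht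
    · simpa using k5 t ht (by omega)
  · rintro k hk s₃ hk' ⟨⟨hE₃, hb₃, ha₃⟩, h1, h2, h3⟩
    have hr : (Code.run (rset 11 (var 23) (horizon - var 25) 0
      (.cell 11 (var 23) (horizon + 1 - var 25) 0 + .cell 13 0 0 0)) s₃) =
      s₃.setReal 11 a (E.T - k) 0 (((E.T + 1 - (E.T - k) : ℕ) : ℝ) * β) := by
      have h4 := h2 (E.T + 1 - k) (by omega) (by omega)
      have h5 : E.T + 1 - (E.T + 1 - k) = k := by omega
      have h6 : E.T + 1 - (E.T - k) = k + 1 := by omega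
      simp only [Code.run, eval_cell, eval_zero, eval_sub, eval_add, eval_one, reval_add,
        reval_cell, ha₃, hE₃.horizon, hk', h4, hb₃, eval_const, eval_three]
      rw [h5, h6]
      congr 1
      push_cast
      ring
    rw [hr]
    refine ⟨⟨hE₃.of_eq (fun A hA => by simp [show A ≠ 25 by omega])
      fun A hA => by simp [show A ≠ 11 by omega], by simpa using hb₃, by simpa using ha₃⟩,
      fun b => ?_, fun t ht ht' => ?_, fun b hb' t ht => ?_⟩
    · simpa [upd, show E.T + 1 ≠ E.T - k by omega] using h1 b
    · by_cases h7 : t = E.T - k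
      · simp [h7, upd]
      · simpa [upd, h7] using h2 t ht (by omega)
    · simpa [upd, hb'.ne] using h3 b hb' t ht

end

/-- The properties of the store after the construction of the network. -/
structure SetUp (E : Economy (Fin l) (Fin n) (Fin m)) (s : Store) : Prop where
  input : Input E s
  rep : Represents E (netOf s)
  caps : (netOf s).Capacities (s.nat 11)
  valid : (netOf s).Valid (s.nat 11) (s.real 11)
  sink : nodeVal (s.real 11) (netOf s).sink = 0
  flow : ∀ e < (netOf s).M, s.nat 11 e 1 0 = 0
  len : ∀ i, s.nat 5 i 0 0 = 0
  M_le : (netOf s).M ≤ n + m + (l * (E.T + 1) + l * (l * (E.T + 1)))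

lemma holdsArcs_network (E : Economy (Fin l) (Fin n) (Fin m)) :
    HoldsArcs (network.run (inputStore E)) (arcs E) ∧ Input E (network.run (inputStore E)) := by
  have h₀ : HoldsArcs (inputStore E) [] := ⟨rfl, by simp, by simp⟩
  have hE₀ : Input E (inputStore E) := ⟨fun _ _ => rfl, fun _ _ => rfl⟩
  have h₁ := holdsArcs_addEmptyPaths hE₀ h₀
  have hE₁ : Input E (addEmptyPaths.run (inputStore E)) :=
    hE₀.run (fun A hA => by interval_cases A <;> decide) fun A hA => by interval_cases A <;> decide
  have h₂ := holdsArcs_addRiders hE₁ h₁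
  have hE₂ : Input E (addRiders.run (addEmptyPaths.run (inputStore E))) :=
    hE₁.run (fun A hA => by interval_cases A <;> decide) fun A hA => by interval_cases A <;> decide
  have h₃ := holdsArcs_addExits hE₂ h₂
  have hE₃ : Input E (addExits.run (addRiders.run (addEmptyPaths.run (inputStore E)))) :=
    hE₂.run (fun A hA => by interval_cases A <;> decide) fun A hA => by interval_cases A <;> decide
  have h₄ := holdsArcs_addRelocations hE₃ h₃
  have hE₄ := hE₃.run (c := addRelocations) (fun A hA => by interval_cases A <;> decide)
    fun A hA => by interval_cases A <;> decide
  simp only [network, Code.run]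
  refine ⟨?_, hE₄⟩
  have harcs : [] ++ ((List.finRange n).flatMap fun i => [emptyPathRow E i]) ++
      ((List.finRange m).flatMap fun j => [riderRow E j]) ++
      ((List.finRange l).flatMap fun a =>
        (List.finRange (E.T + 1)).flatMap fun t : Fin (E.T + 1) => [exitRow E a t]) ++
      ((List.finRange l).flatMap fun a => (List.finRange l).flatMap fun b =>
        (List.finRange (E.T + 1)).flatMap fun t : Fin (E.T + 1) =>
          if (t : ℕ) + E.dist a b ≤ E.T then [relocationRow E ⟨a, b, t⟩] else []) = arcs E := by
    simp only [arcs, freeArcs, List.nil_append, List.append_assoc]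
  rwa [harcs] at h₄

/-- Without flow only forward use is possible. A trip takes at least one period, during which the
potential falls by at least the sum of all values, and no trip gains more than that. Arcs to the
sink have nonpositive gain and start at nonnegative potential. -/
lemma valid_initial {E : Economy (Fin l) (Fin n) (Fin m)} {G : Net} (hG : Represents E G)
    {r : ℕ → ℕ → ℕ → ℕ} (hr : ∀ e < G.M, r e 1 0 = 0) {V : ℕ → ℕ → ℕ → ℝ}
    (hV₀ : ∀ a, V a (E.T + 1) 0 = 0)
    (hV : ∀ a < l, ∀ t ≤ E.T + 1, V a t 0 = ((E.T + 1 - t : ℕ) : ℝ) * ∑ j, E.value j) :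
    G.Valid r V := by
  have hβ : 0 ≤ ∑ j, E.value j := Finset.sum_nonneg fun j _ => E.value_nonneg j
  have hpos : ∀ a < l, ∀ t ≤ E.T + 1, 0 ≤ V a t 0 := fun a ha t ht => by
    rw [hV a ha t ht]
    positivity
  have htrip : ∀ r ∈ E.trips, ∑ j, E.value j + V r.dest (E.arrival r) 0 ≤ V r.orig r.start 0 := by
    intro q hq
    have h1 : E.arrival q ≤ E.T := hq
    have h2 := E.start_lt_arrival q
    rw [hV _ q.dest.2 _ (by omega), hV _ q.orig.2 _ (by omega)]
    have h3 : ((E.T + 1 - E.arrival q : ℕ) : ℝ) + 1 ≤ ((E.T + 1 - q.start : ℕ) : ℝ) := by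
      exact_mod_cast (by omega : E.T + 1 - E.arrival q + 1 ≤ E.T + 1 - q.start)
    nlinarith
  intro e he d hd hr'
  interval_cases d
  · have hcost : ∀ i, 0 ≤ E.pathCost i [] := fun i => by
      rw [Economy.pathCost]
      split_ifs
      · exact le_rfl
      · simpa using E.exitCost_nonneg _ (by omega)
    rcases hG.exists_row he with ⟨i, _, hR⟩ | ⟨j, _, hR⟩ | ⟨_, a, t, ht, hR⟩ | ⟨_, q, hq, hR⟩
    · have h1 := hcost i
      have h2 := hpos _ (E.entryLoc i).2 (E.entryTime i) (by have := E.entryTime_le i; omega)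
      simp only [hR.tail, hR.head, hR.gain, emptyPathRow, nodeVal, hV₀]
      linarith
    · have h1 := htrip _ (E.request_mem j)
      have h2 := E.tripCost_nonneg _ (E.request_mem j)
      have h3 : E.value j ≤ ∑ j, E.value j :=
        Finset.single_le_sum (fun j _ => E.value_nonneg j) (Finset.mem_univ j)
      simp only [hR.tail, hR.head, hR.gain, riderRow, nodeVal]
      linarith
    · have h1 := E.exitCost_nonneg (E.T - t) (by omega)
      have h2 := hpos _ a.2 t (by omega)
      simp only [hR.tail, hR.head, hR.gain, exitRow, nodeVal, hV₀]
      linarith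
    · have h1 := htrip q hq
      have h2 := E.tripCost_nonneg q hq
      simp only [hR.tail, hR.head, hR.gain, relocationRow, nodeVal]
      linarith
  · rw [hr e he] at hr'
    omega

lemma setUp_setup (E : Economy (Fin l) (Fin n) (Fin m)) : SetUp E (setup.run (inputStore E)) := by
  obtain ⟨hA, hE⟩ := holdsArcs_network E
  have hrep := hA.represents hE
  have hlen : ∀ i, (network.run (inputStore E)).nat 5 i 0 0 = 0 := fun i => by
    rw [run_nat network (by decide)]
    rfl
  obtain ⟨hV₀, hV⟩ := run_initPotential hE
    (by rw [run_real network (by decide)]; rfl)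
    (fun a => by rw [run_real network (by decide)]; rfl)
  rw [setup, Code.run]
  generalize network.run (inputStore E) = s at *
  have h11 := run_nat initPotential (show 11 ∉ _ by decide) s
  have hnet : netOf (initPotential.run s) = netOf s := by
    simp only [netOf, run_nat initPotential (show 0 ∉ _ by decide),
      run_nat initPotential (show 10 ∉ _ by decide), run_nat initPotential (show 12 ∉ _ by decide),
      run_nat initPotential (show 13 ∉ _ by decide),
      run_real initPotential (show 10 ∉ _ by decide)]
  have hM : (netOf s).M = (arcs E).length := hA.length
  have hflow : ∀ e < (netOf s).M, s.nat 11 e 1 0 = 0 := fun e he => (hA.res e (hM ▸ he)).2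
  refine ⟨hE.run (fun A hA => by interval_cases A <;> decide)
    fun A hA => by interval_cases A <;> decide, hnet ▸ hrep, ?_, ?_, ?_, ?_, ?_, ?_⟩
  · rw [hnet, h11]
    intro e he
    obtain ⟨h1, h2⟩ := hA.res e (hM ▸ he)
    omega
  · rw [hnet, h11]
    exact valid_initial hrep hflow hV₀ hV
  · rw [hnet, Net.sink, hrep.T_eq]
    exact hV₀ 0
  · rw [hnet, h11]
    exact hflow
  · rw [run_nat initPotential (by decide)]
    exact hlen
  · rw [hnet, hM, length_arcs]
    have := length_freeArcs (E := E)
    omega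

end Algorithm
end Rideshare

namespace Rideshare

/-! ### Correctness of the routing -/

namespace Algorithm

open Code

lemma netOf_eq {s s' : Store} (h0 : s'.nat 0 = s.nat 0) (h10 : s'.nat 10 = s.nat 10)
    (h12 : s'.nat 12 = s.nat 12) (h13 : s'.nat 13 = s.nat 13) (hr : s'.real 10 = s.real 10) :
    netOf s' = netOf s := by
  simp only [netOf, h0, h10, h12, h13, hr]

lemma netOf_run {c : Code} (h : ∀ A ∈ [0, 10, 12, 13], A ∉ c.writes) (hr : 10 ∉ c.realWrites)
    (s : Store) : netOf (c.run s) = netOf s :=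
  netOf_eq (run_nat c (h 0 (by simp)) s) (run_nat c (h 10 (by simp)) s)
    (run_nat c (h 12 (by simp)) s) (run_nat c (h 13 (by simp)) s) (run_real c hr s)

variable {G : Net} {r S : ℕ → ℕ → ℕ → ℕ} {V : ℕ → ℕ → ℕ → ℝ}

/-! The arc with least slack -/

/-- Arc `e`, used from end `d`, leaves the set of nodes `S`. -/
def Leaves (G : Net) (r S : ℕ → ℕ → ℕ → ℕ) (e d : ℕ) : Prop :=
  e < G.M ∧ d < 2 ∧ 1 ≤ nodeVal S (G.node e d) ∧ nodeVal S (G.node e (1 - d)) = 0 ∧ 1 ≤ r e d 0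

/-- The loss of potential along an arc minus the gain. -/
def slack (G : Net) (V : ℕ → ℕ → ℕ → ℝ) (e d : ℕ) : ℝ :=
  nodeVal V (G.node e d) - nodeVal V (G.node e (1 - d)) - G.gain e d 0

/-- The store holds the arc with the least slack among those with property `Q` that leave `S`. -/
structure HoldsBest (G : Net) (r S : ℕ → ℕ → ℕ → ℕ) (V : ℕ → ℕ → ℕ → ℝ) (Q : ℕ → ℕ → Prop)
    (s : Store) : Prop where
  none : s.nat 26 0 0 0 = 0 → ∀ e d, Q e d → ¬ Leaves G r S e d
  some : s.nat 26 0 0 0 ≠ 0 → Leaves G r S (s.nat 27 0 0 0) (s.nat 28 0 0 0) ∧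
    s.real 12 0 0 0 = slack G V (s.nat 27 0 0 0) (s.nat 28 0 0 0) ∧
    ∀ e d, Q e d → Leaves G r S e d → s.real 12 0 0 0 ≤ slack G V e d

/-- The store holds the network `G` with residual capacities `r`, potential `V` and set `S`. -/
structure Holds (G : Net) (r S : ℕ → ℕ → ℕ → ℕ) (V : ℕ → ℕ → ℕ → ℝ) (s : Store) : Prop where
  net : netOf s = G
  res : s.nat 11 = r
  mem : s.nat 14 = S
  pot : s.real 11 = V

lemma Holds.of_eq {s s' : Store} (h : Holds G r S V s) (hn : ∀ A ≤ 14, s'.nat A = s.nat A)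
    (hr : ∀ A ∈ [10, 11], s'.real A = s.real A) : Holds G r S V s' :=
  ⟨(netOf_eq (hn 0 (by omega)) (hn 10 (by omega)) (hn 12 (by omega)) (hn 13 (by omega))
    (hr 10 (by simp))).trans h.net, (hn 11 (by omega)).trans h.res,
    (hn 14 (by omega)).trans h.mem, (hr 11 (by simp)).trans h.pot⟩

/-- One step of a running minimum: `Q` collects the candidates seen so far, and the stored arc is
replaced only if there was none or its slack is larger. -/
lemma holdsBest_probe {s : Store} {Q : ℕ → ℕ → Prop} (h : Holds G r S V s)
    (hQ : HoldsBest G r S V Q s) {k d : ℕ} (hk : s.nat 22 0 0 0 = k) (hkM : k < G.M) (hd : d < 2) :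
    HoldsBest G r S V (fun e d' => Q e d' ∨ e = k ∧ d' = d) ((probe d).run s) := by
  obtain ⟨rfl, rfl, rfl, rfl⟩ := h
  have hL : (1 ≤ s.nat 14 (s.nat 10 k 0 d) (s.nat 10 k 1 d) 0 ∧
      s.nat 14 (s.nat 10 k 0 (1 - d)) (s.nat 10 k 1 (1 - d)) 0 ≤ 0 ∧ 1 ≤ s.nat 11 k d 0) ↔
      Leaves (netOf s) (s.nat 11) (s.nat 14) k d := by
    rw [Nat.le_zero]
    exact ⟨fun h => ⟨hkM, hd, h⟩, fun h => h.2.2⟩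
  have hsl : s.real 11 (s.nat 10 k 0 d) (s.nat 10 k 1 d) 0 -
      s.real 11 (s.nat 10 k 0 (1 - d)) (s.nat 10 k 1 (1 - d)) 0 - s.real 10 k d 0 =
      slack (netOf s) (s.real 11) k d := rfl
  simp only [probe, Code.run, holds_and, holds_nle, holds_rle, eval_cell, eval_zero, eval_one,
    eval_const, hk, reval_sub, reval_cell, hsl]
  split_ifs with h1 h2 <;> rw [hL] at h1
  · refine ⟨fun h0 => absurd h0 (by omega), fun h0 => ?_⟩
    obtain ⟨a, b, c⟩ := hQ.some h0
    refine ⟨a, b, ?_⟩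
    rintro e d' (hq | ⟨rfl, rfl⟩) hl
    · exact c e d' hq hl
    · exact h2.2
  · refine ⟨fun h0 => by simp at h0, fun _ => ?_⟩
    simp only [Store.setNat_real, Store.setReal_real_self, upd_self, Store.setNat_nat_self, ne_eq,
      Store.setNat_nat_of_ne, Store.setReal_nat, Nat.reduceEqDiff,
      not_false_eq_true, hk]
    refine ⟨h1, trivial, ?_⟩
    rintro e d' (hq | ⟨rfl, rfl⟩) hl
    · by_cases h0 : s.nat 26 0 0 0 = 0
      · exact absurd hl (hQ.none h0 e d' hq)
      · have h3 : ¬ s.real 12 0 0 0 ≤ slack (netOf s) (s.real 11) k d := fun h4 =>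
          h2 ⟨by omega, h4⟩
        exact (not_le.1 h3).le.trans ((hQ.some h0).2.2 e d' hq hl)
    · exact le_rfl
  · refine ⟨?_, fun h0 => ?_⟩
    · rintro h0 e d' (hq | ⟨rfl, rfl⟩) hl
      exacts [hQ.none h0 e d' hq hl, h1 hl]
    · obtain ⟨a, b, c⟩ := hQ.some h0
      refine ⟨a, b, ?_⟩
      rintro e d' (hq | ⟨rfl, rfl⟩) hl
      exacts [c e d' hq hl, absurd hl h1]

lemma holdsBest_scan {s : Store} (h : Holds G r S V s) :
    HoldsBest G r S V (fun e d => e < G.M ∧ d < 2) (scan.run s) ∧ Holds G r S V (scan.run s) := by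
  rw [scan, Code.run]
  have key := run_count (x := 22) (e := var 13) (c := probe 0 ;; probe 1)
    (s := (assign 26 0).run s) (fun k s' => HoldsBest G r S V (fun e d => e < k ∧ d < 2) s' ∧
      Holds G r S V s') (N := G.M) (by rw [← h.net]; simp [Code.run, netOf]) ?_ ?_
  · exact key
  · refine ⟨⟨fun _ e d hq => by omega, fun h0 => absurd h0 (by simp [Code.run])⟩, ?_⟩
    refine h.of_eq (fun A hA => ?_) fun A hA => rfl
    simp [Code.run, show A ≠ 22 by omega, show A ≠ 26 by omega]
  · rintro k hk s' hk' ⟨h1, h2⟩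
    have h3 := holdsBest_probe h2 h1 hk' hk (d := 0) (by omega)
    have hp : ∀ d < 2, ∀ s' : Store, Holds G r S V s' → Holds G r S V ((probe d).run s') := by
      intro d hd s' hs'
      refine hs'.of_eq (fun A hA => run_nat _ ?_ _) fun A hA => run_real _ ?_ _
      · interval_cases d <;> interval_cases A <;> decide
      · simp only [List.mem_cons, List.not_mem_nil, or_false] at hA
        rcases hA with rfl | rfl <;> interval_cases d <;> decide
    have h4 := hp 0 (by omega) s' h2
    have h5 := holdsBest_probe h4 h3 (k := k) (d := 1)
      (by rw [run_nat _ (by decide)]; exact hk') hk (by omega)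
    have h6 := hp 1 (by omega) _ h4
    refine ⟨⟨fun h0 e d hq => ?_, fun h0 => ?_⟩, ?_⟩
    · exact h5.none (by simpa [Code.run] using h0) e d (by omega)
    · obtain ⟨a, b, c⟩ := h5.some (by simpa [Code.run] using h0)
      simp only [Code.run, Store.setNat_nat_of_ne, Store.setNat_real, ne_eq,
        Nat.reduceEqDiff, not_false_eq_true]
      exact ⟨a, b, fun e d hq => c e d (by omega)⟩
    · exact h6.of_eq (fun A hA => by simp [Code.run, show A ≠ 22 by omega]) fun A hA => rfl

/-! Lowering the potential -/

lemma run_lower {s : Store} (h : Holds G r S V s) (a t : ℕ) :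
    (lower.run s).real 11 a t 0 = if a < G.l ∧ t < G.T + 2 ∧ 1 ≤ S a t 0 then
      V a t 0 - s.real 12 0 0 0 else V a t 0 := by
  have hl : s.nat 0 0 0 0 = G.l := congrArg Net.l h.net
  have hT : s.nat 0 3 0 0 = G.T := congrArg Net.T h.net
  obtain ⟨-, -, rfl, rfl⟩ := h
  refine (run_count (s := s) (fun k s' => (s'.nat 0 = s.nat 0 ∧ s'.nat 14 = s.nat 14 ∧
    s'.real 12 = s.real 12) ∧ ∀ a t, s'.real 11 a t 0 =
      if a < k ∧ t < G.T + 2 ∧ 1 ≤ s.nat 14 a t 0 then s.real 11 a t 0 - s.real 12 0 0 0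
        else s.real 11 a t 0) (N := G.l) (by simpa using hl) (by simp) ?_).2 a t
  rintro b - s₁ hb ⟨⟨h0, h14, h12⟩, hV⟩
  have key := run_count (x := 25) (e := horizon + 2) (s := s₁)
    (c := ite (.nle 1 (.cell 14 (var 23) (var 25) 0))
      (rset 11 (var 23) (var 25) 0 (.cell 11 (var 23) (var 25) 0 - .cell 12 0 0 0)) skip)
    (fun k s' => (s'.nat 0 = s.nat 0 ∧ s'.nat 14 = s.nat 14 ∧ s'.real 12 = s.real 12 ∧
      s'.nat 23 0 0 0 = b) ∧ ∀ a t, s'.real 11 a t 0 =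
      if (a < b ∧ t < G.T + 2 ∨ a = b ∧ t < k) ∧ 1 ≤ s.nat 14 a t 0 then
        s.real 11 a t 0 - s.real 12 0 0 0 else s.real 11 a t 0) (N := G.T + 2)
    (by simp [h0, hT]) (by simp [h0, h14, h12, hV, hb, and_assoc]) ?_
  · obtain ⟨⟨k1, k2, k3, -⟩, k4⟩ := key
    refine ⟨by simp [k1, k2, k3], fun a t => ?_⟩
    rw [Store.setNat_real, k4]
    refine if_congr ?_ rfl rfl
    rw [← and_assoc]
    refine and_congr_left fun _ => ?_
    omega
  · rintro k hk s₂ hk' ⟨⟨k1, k2, k3, k4⟩, k5⟩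
    -- The entry at hand still has its original value, so it is lowered only once.
    have k5' := k5 b k
    simp only [lt_irrefl, false_and, or_false, if_false, and_false] at k5'
    simp only [Code.run, holds_nle, eval_one, eval_cell, eval_zero, eval_const, k4, hk', k2,
      reval_sub, reval_cell, k3, k5']
    split_ifs with hS
    · refine ⟨by simp [k1, k2, k3, k4], fun a t => ?_⟩
      simp only [Store.setNat_real, Store.setReal_real_self, upd, and_true, k5]
      by_cases hat : a = b ∧ t = k
      · obtain ⟨rfl, rfl⟩ := hat
        simp [hS]
      · rw [if_neg hat]
        refine if_congr (and_congr_left fun _ => ?_) rfl rfl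
        omega
    · refine ⟨by simp [k1, k2, k3, k4], fun a t => ?_⟩
      rw [Store.setNat_real, k5]
      refine if_congr ?_ rfl rfl
      by_cases hat : a = b ∧ t = k
      · obtain ⟨rfl, rfl⟩ := hat
        simp only [hS, and_false]
      · refine and_congr_left fun _ => ?_
        omega

/-! Growing the tree -/

/-- The store holds a tree of tight arcs with nodes `L`. -/
structure HoldsTree (G : Net) (r : ℕ → ℕ → ℕ → ℕ) (src : ℕ × ℕ) (L : List (ℕ × ℕ))
    (s : Store) : Prop where
  net : netOf s = G
  res : s.nat 11 = r
  tree : G.Tree (G.Tight r (s.real 11)) (s.nat 15) (s.nat 16) src L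
  mem : ∀ v, (G.Inner v ∨ v = G.sink) → nodeVal (s.nat 14) v = if v ∈ L then 1 else 0
  nodes : ∀ v ∈ L, G.Inner v ∨ v = G.sink
  valid : G.Valid r (s.real 11)
  sink : nodeVal (s.real 11) G.sink = 0

lemma HoldsTree.of_eq {src : ℕ × ℕ} {L : List (ℕ × ℕ)} {s s' : Store} (h : HoldsTree G r src L s)
    (hn : ∀ A ≤ 16, s'.nat A = s.nat A) (hr : ∀ A ∈ [10, 11], s'.real A = s.real A) :
    HoldsTree G r src L s' := by
  obtain ⟨h1, h2, h3, h4, h5, h6, h7⟩ := h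
  have e11 : s'.real 11 = s.real 11 := hr 11 (by simp)
  constructor
  · rw [← h1]
    exact netOf_eq (hn 0 (by omega)) (hn 10 (by omega)) (hn 12 (by omega)) (hn 13 (by omega))
      (hr 10 (by simp))
  · rw [hn 11 (by omega), h2]
  · rwa [hn 15 (by omega), hn 16 (by omega), e11]
  · rwa [hn 14 (by omega)]
  · exact h5
  · rwa [e11]
  · rwa [e11]

/-- Lowering the potential on the tree by the least slack keeps the arcs of the tree tight, as both
their ends move, and keeps the potential valid by minimality. It makes the arc found tight, so that
its far end can join. The sink is not in the tree and stays at potential zero. -/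
lemma holdsTree_attach (hG : G.Proper) (hr : G.Capacities r) {src : ℕ × ℕ} {L : List (ℕ × ℕ)}
    {s : Store} (h : HoldsTree G r src L s) (hL : G.sink ∉ L) :
    ∃ w, HoldsTree G r src (w :: L) ((scan ;; lower ;; attach).run s) := by
  obtain ⟨h1, h2, h3, h4, h5, h6, h7⟩ := h
  have hH : Holds G r (s.nat 14) (s.real 11) s := ⟨h1, h2, rfl, rfl⟩
  obtain ⟨hB, hH₁⟩ := holdsBest_scan hH
  have hsrc := h3.src_mem
  have hmem : ∀ e < G.M, ∀ d < 2, (1 ≤ nodeVal (s.nat 14) (G.node e d) ↔ G.node e d ∈ L) ∧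
      (nodeVal (s.nat 14) (G.node e d) = 0 ↔ G.node e d ∉ L) := fun e he d hd => by
    rw [h4 _ (hG.node he hd)]
    by_cases hv : G.node e d ∈ L <;> simp [hv]
  -- Some arc leaves the tree, for instance the unlimited exit arc at the root.
  have hfound : (scan.run s).nat 26 0 0 0 ≠ 0 := fun h0 => by
    have hin : G.Inner src := (h5 src hsrc).resolve_right fun h => hL (h ▸ hsrc)
    obtain ⟨e, he, he0, he1, hdec⟩ := hG.exit src hin
    refine hB.none h0 e 0 ⟨he, by omega⟩ ⟨he, by omega, ?_, ?_, (hr e he).1 hdec⟩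
    · rw [(hmem e he 0 (by omega)).1, he0]
      exact hsrc
    · rw [(hmem e he 1 (by omega)).2, he1]
      exact hL
  obtain ⟨⟨he, hd, hfrom, hto, hres⟩, hbest, hmin⟩ := hB.some hfound
  simp only [Code.run]
  have e15 := run_nat scan (show 15 ∉ _ by decide) s
  have e16 := run_nat scan (show 16 ∉ _ by decide) s
  generalize scan.run s = s₁ at *
  set e := s₁.nat 27 0 0 0
  set d := s₁.nat 28 0 0 0
  have hd' : 1 - d < 2 := by omega
  have hlow := run_lower hH₁
  have f10 := run_nat lower (show 10 ∉ _ by decide) s₁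
  have f11 := run_nat lower (show 11 ∉ _ by decide) s₁
  have f14 := run_nat lower (show 14 ∉ _ by decide) s₁
  have f15 := run_nat lower (show 15 ∉ _ by decide) s₁
  have f16 := run_nat lower (show 16 ∉ _ by decide) s₁
  have f27 := run_nat lower (show 27 ∉ _ by decide) s₁
  have f28 := run_nat lower (show 28 ∉ _ by decide) s₁
  have fnet := netOf_run (c := lower) (by decide) (by decide) s₁
  generalize lower.run s₁ = s₂ at *
  rw [hH₁.net] at fnet
  have hnode : G.node e (1 - d) = (s₂.nat 10 e 0 (1 - d), s₂.nat 10 e 1 (1 - d)) := by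
    rw [← fnet]
    rfl
  rw [(hmem e he d hd).1] at hfrom
  rw [(hmem e he _ hd').2] at hto
  have hV' : ∀ v, G.Inner v ∨ v = G.sink → nodeVal (s₂.real 11) v =
      if v ∈ L then nodeVal (s.real 11) v - s₁.real 12 0 0 0 else nodeVal (s.real 11) v := by
    intro v hv
    have hS := h4 v hv
    rw [nodeVal] at hS
    rw [nodeVal, hlow, hS]
    by_cases hvL : v ∈ L
    · have hvi : G.Inner v := hv.resolve_right fun h => hL (h ▸ hvL)
      have hvT := hvi.2
      simp [hvL, hvi.1, show v.2 < G.T + 2 by omega, nodeVal]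
    · simp [hvL, nodeVal]
  have hc : 0 ≤ s₁.real 12 0 0 0 := by
    have := h6 e he d hd hres
    rw [hbest, slack]
    linarith
  have hrun : attach.run s₂ = ((s₂.setNat 15 (G.node e (1 - d)).1 (G.node e (1 - d)).2 0 e).setNat
      16 (G.node e (1 - d)).1 (G.node e (1 - d)).2 0 d).setNat 14 (G.node e (1 - d)).1
      (G.node e (1 - d)).2 0 1 := by
    simp [attach, Code.run, hnode, f27, f28, e, d]
  set w := G.node e (1 - d)
  have hpair : ∀ v ∈ L, v ≠ w := fun v hv hvw => hto (hvw ▸ hv)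
  refine ⟨w, ?_⟩
  rw [hrun]
  constructor
  · rw [← fnet]
    exact netOf_eq (by simp) (by simp) (by simp) (by simp) (by simp)
  · simp [f11, hH₁.res]
  · refine Or.inr ⟨hto, h3.congr ?_ ?_, ?_⟩
    · rintro e' d' hin hin' ⟨t1, t2, t3, t4⟩
      refine ⟨t1, t2, t3, ?_⟩
      simp only [Store.setNat_real]
      rw [hV' _ (h5 _ hin), hV' _ (h5 _ hin'), if_pos hin, if_pos hin']
      linarith
    · intro v hv
      simp [nodeVal_upd, hpair v hv, f15, f16, e15, e16]
    · simp only [Store.setNat_real, Store.setNat_nat_of_ne, Store.setNat_nat_self, ne_eq,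
        Nat.reduceEqDiff, not_false_eq_true, nodeVal_upd, if_true]
      refine ⟨⟨he, hd, hres, ?_⟩, hfrom, rfl⟩
      -- Only the near end of the new arc is lowered, and by exactly the slack of the arc.
      rw [hV' _ (hG.node he hd), hV' _ (hG.node he hd'), if_pos hfrom, if_neg hto, hbest, slack]
      ring
  · intro v hv
    simp only [Store.setNat_nat_self, Store.setNat_nat_of_ne, ne_eq,
        Nat.reduceEqDiff, not_false_eq_true, nodeVal_upd, f14, hH₁.mem, h4 v hv]
    by_cases hvw : v = w <;> simp [hvw]
  · intro v hv
    rcases List.mem_cons.1 hv with rfl | hv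
    exacts [hG.node he hd', h5 v hv]
  · simp only [Store.setNat_real]
    refine Net.valid_shift h6 hc (L := L) (fun e' he' d' hd' h => ?_) (fun e' he' d' hd' h => ?_) ?_
    · rw [hV' _ (hG.node he' hd'), if_pos h]
    · rw [hV' _ (hG.node he' hd'), if_neg h]
    · intro e' he' d' hd₁ hr' hin hout
      have hd₂ : 1 - d' < 2 := by omega
      exact hmin e' d' ⟨he', hd₁⟩ ⟨he', hd₁, (hmem e' he' d' hd₁).1.2 hin,
        (hmem e' he' _ hd₂).2.2 hout, hr'⟩
  · simp only [Store.setNat_real]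
    rw [hV' _ (Or.inr rfl), if_neg hL, h7]

/-- There are at least as many arcs as there are nodes other than the sink. -/
lemma length_le_of_inner (hG : G.Proper) {L : List (ℕ × ℕ)} (hL : L.Nodup)
    (h : ∀ v ∈ L, G.Inner v) : L.length ≤ G.M := by
  classical
  -- Distinct nodes have distinct exit arcs, since the tail of the arc recovers the node.
  choose! f hf using hG.exit
  have := Finset.card_le_card_of_injOn (s := L.toFinset) (t := Finset.range G.M) f
    (fun v hv => by simpa using (hf v (h v (by simpa using hv))).1)
    (fun v hv w hw hvw => by
      have h1 := (hf v (h v (by simpa using hv))).2.1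
      have h2 := (hf w (h w (by simpa using hw))).2.1
      rw [← h1, ← h2, hvw])
  rwa [List.toFinset_card_of_nodup hL, Finset.card_range] at this

/-- Every round adds a node until the sink appears. A tree without the sink has at most `G.M` nodes,
whereas `G.M` successful rounds starting from the root would give `G.M + 1`. -/
lemma holdsTree_grow (hG : G.Proper) (hr : G.Capacities r) {src : ℕ × ℕ} {s : Store}
    (h : HoldsTree G r src [src] s) :
    ∃ L, HoldsTree G r src L (grow.run s) ∧ L.length ≤ G.M + 1 ∧ G.sink ∈ L := by
  have key := run_count (x := 21) (e := var 13) (s := s)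
    (c := ite (.nle (.cell 14 0 (horizon + 1) 0) 0) (scan ;; lower ;; attach) skip)
    (fun k s' => ∃ L, HoldsTree G r src L s' ∧ L.length ≤ k + 1 ∧ (k + 1 ≤ L.length ∨ G.sink ∈ L))
    (N := G.M) (by rw [← h.net]; rfl)
    ⟨[src], h.of_eq (fun A hA => by simp [show A ≠ 21 by omega]) fun A hA => rfl, by simp⟩ ?_
  · obtain ⟨L, h1, h2, h3⟩ := key
    refine ⟨L, h1, h2, ?_⟩
    by_contra hcon
    have := length_le_of_inner hG h1.tree.nodup fun v hv =>
      (h1.nodes v hv).resolve_right fun h => hcon (h ▸ hv)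
    have := h3.resolve_right hcon
    omega
  · rintro k hk s' - ⟨L, h1, h2, h3⟩
    have hset : ∀ {L : List (ℕ × ℕ)} {s' : Store}, HoldsTree G r src L s' →
        HoldsTree G r src L (s'.setNat 21 0 0 0 (k + 1)) := fun h =>
      h.of_eq (fun A hA => by simp [show A ≠ 21 by omega]) fun A hA => rfl
    have htest : (Test.nle (.cell 14 0 (horizon + 1) 0) 0).Holds s' ↔ G.sink ∉ L := by
      have h4 := h1.mem G.sink (Or.inr rfl)
      have h5 : s'.nat 0 3 0 0 = G.T := congrArg Net.T h1.net
      simp only [nodeVal, Net.sink] at h4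
      simp only [holds_nle, eval_cell, eval_zero, eval_add, eval_three, eval_one, h5, h4, Net.sink]
      split_ifs with h6 <;> simp [h6]
    rw [Code.run]
    split_ifs with hs <;> rw [htest] at hs
    · obtain ⟨w, hw⟩ := holdsTree_attach hG hr h1 hs
      have := h3.resolve_right hs
      exact ⟨w :: L, hset hw, by simp; omega, Or.inl (by simp; omega)⟩
    · exact ⟨L, hset h1, by omega, Or.inr (not_not.1 hs)⟩

end Algorithm
end Rideshare

/-! ### Augmentation along the tree, and the routing of all drivers -/

namespace Rideshare

namespace Algorithm

open Code

variable {G : Net}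

lemma run_initTree {s : Store} (hG : netOf s = G) {a t : ℕ} (ha : a < G.l) (ht : t < G.T + 2) :
    (initTree.run s).nat 14 a t 0 =
      if a = s.nat 2 (s.nat 20 0 0 0) 1 0 ∧ t = s.nat 2 (s.nat 20 0 0 0) 2 0 then 1 else 0 := by
  have hl : s.nat 0 0 0 0 = G.l := congrArg Net.l hG
  have hT : s.nat 0 3 0 0 = G.T := congrArg Net.T hG
  set c := count 23 locs (count 25 (horizon + 2) (nset 14 (var 23) (var 25) 0 0)) with hc
  have key : ∀ a < G.l, ∀ t < G.T + 2, (c.run s).nat 14 a t 0 = 0 := by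
    refine (run_count (s := s) (fun k s' => s'.nat 0 = s.nat 0 ∧
      ∀ a < k, ∀ t < G.T + 2, s'.nat 14 a t 0 = 0) (N := G.l) (by simpa using hl) (by simp) ?_).2
    rintro b - s₁ hb ⟨h0, h1⟩
    have key := run_count (x := 25) (e := horizon + 2) (s := s₁)
      (c := nset 14 (var 23) (var 25) 0 0)
      (fun k s' => (s'.nat 0 = s.nat 0 ∧ s'.nat 23 0 0 0 = b) ∧ ∀ a t,
        (a < b ∧ t < G.T + 2 ∨ a = b ∧ t < k) → s'.nat 14 a t 0 = 0) (N := G.T + 2)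
      (by simp [h0, hT]) ⟨by simp [h0, hb], fun a t h => by simp [h1 a (by omega) t (by omega)]⟩ ?_
    · refine ⟨by simp [key.1.1], fun a ha t ht => ?_⟩
      simpa using key.2 a t (by omega)
    · rintro k hk s₂ hk' ⟨⟨k1, k2⟩, k3⟩
      refine ⟨by simp [Code.run, k1, k2], fun a t h => ?_⟩
      simp only [Code.run, eval_cell, eval_zero, eval_const, k2, hk', Store.setNat_nat_of_ne, ne_eq,
        Nat.reduceEqDiff, not_false_eq_true, Store.setNat_nat_self, upd, and_true]
      split_ifs with hat
      · rfl
      · exact k3 a t (by omega)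
  have e2 := run_nat c (show 2 ∉ _ by decide) s
  have e20 := run_nat c (show 20 ∉ _ by decide) s
  have h := key a ha t ht
  simp [initTree, Code.run, ← hc, e2, e20, upd, h]

lemma holdsTree_initTree {r : ℕ → ℕ → ℕ → ℕ} {s : Store} (hG : netOf s = G) (hr : s.nat 11 = r)
    (hV : G.Valid r (s.real 11)) (hs : nodeVal (s.real 11) G.sink = 0) {src : ℕ × ℕ}
    (h1 : s.nat 2 (s.nat 20 0 0 0) 1 0 = src.1) (h2 : s.nat 2 (s.nat 20 0 0 0) 2 0 = src.2)
    (hsrc : G.Inner src) : HoldsTree G r src [src] (initTree.run s) := by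
  have e := run_real initTree (show 11 ∉ _ by decide) s
  constructor
  · rw [netOf_run (by decide) (by decide), hG]
  · rw [run_nat initTree (by decide), hr]
  · exact Or.inl ⟨rfl, rfl⟩
  · intro v hv
    have hb : v.1 < G.l ∧ v.2 < G.T + 2 := by
      rcases hv with ⟨hv1, hv2⟩ | rfl
      · omega
      · have := hsrc.1
        simp only [Net.sink]
        omega
    rw [nodeVal, run_initTree hG hb.1 hb.2, h1, h2]
    simp only [List.mem_singleton, Prod.ext_iff]
  · simpa using Or.inl hsrc
  · rwa [e]
  · rwa [e]

/-- The store during the augmentation, when there is still one unit too many that leaves the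
current node. -/
structure Augmenting (G : Net) (V : ℕ → ℕ → ℕ → ℝ) (pe pd : ℕ → ℕ → ℕ → ℕ) (ν : ℕ × ℕ → ℤ)
    (src : ℕ × ℕ) (L : List (ℕ × ℕ)) (s : Store) : Prop where
  net : netOf s = G
  pe_eq : s.nat 15 = pe
  pd_eq : s.nat 16 = pd
  loc : s.nat 2 (s.nat 20 0 0 0) 1 0 = src.1
  time : s.nat 2 (s.nat 20 0 0 0) 2 0 = src.2
  cur : (s.nat 29 0 0 0, s.nat 30 0 0 0) ∈ L
  tree : G.Tree (G.Tight (s.nat 11) V) pe pd src L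
  caps : G.Capacities (s.nat 11)
  valid : G.Valid (s.nat 11) V
  flow : ∀ v, v ≠ G.sink → G.net (fun e => s.nat 11 e 1 0) v =
    ν v + if (s.nat 29 0 0 0, s.nat 30 0 0 0) = v then 1 else 0

lemma Augmenting.setNat {V : ℕ → ℕ → ℕ → ℝ} {pe pd : ℕ → ℕ → ℕ → ℕ}
    {ν : ℕ × ℕ → ℤ} {src : ℕ × ℕ} {L : List (ℕ × ℕ)} {s : Store}
    (h : Augmenting G V pe pd ν src L s) (k : ℕ) :
    Augmenting G V pe pd ν src L (s.setNat 21 0 0 0 k) := by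
  obtain ⟨h1, h2, h3, h4, h5, h6, h7, h8, h9, h10⟩ := h
  refine ⟨?_, by simpa using h2, by simpa using h3, by simpa using h4, by simpa using h5,
    by simpa using h6, by simpa using h7, by simpa using h8, by simpa using h9,
    by simpa using h10⟩
  rw [← h1]
  exact netOf_eq (by simp) (by simp) (by simp) (by simp) (by simp)

/-- Flipping the arc that leads to the current node moves the surplus unit to the other end of the
arc, one step closer to the root. -/
lemma augmenting_stepBack (hG : G.Proper) {V : ℕ → ℕ → ℕ → ℝ} {pe pd : ℕ → ℕ → ℕ → ℕ}
    {ν : ℕ × ℕ → ℤ} {src : ℕ × ℕ} {L : List (ℕ × ℕ)} {s : Store}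
    (h : Augmenting G V pe pd ν src L s) (hcur : (s.nat 29 0 0 0, s.nat 30 0 0 0) ≠ src) :
    ∃ L', Augmenting G V pe pd ν src L' (stepBack.run s) ∧ L'.length < L.length := by
  obtain ⟨h1, h2, h3, h4, h5, h6, h7, h8, h9, h10⟩ := h
  obtain ⟨L', hL', hlen⟩ := h7.exists_cons h6
  set cur := (s.nat 29 0 0 0, s.nat 30 0 0 0) with hcurdef
  rcases hL' with ⟨_, h⟩ | ⟨hnot, htree, htight, hmem, hend⟩
  · exact absurd h hcur
  set e := nodeVal pe cur with he
  set d := nodeVal pd cur with hd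
  have hd2 : d < 2 := htight.2.1
  have hdec : G.dec = s.nat 12 := by rw [← h1]; rfl
  have hends : G.ends = s.nat 10 := by rw [← h1]; rfl
  have hes : s.nat 15 (s.nat 29 0 0 0) (s.nat 30 0 0 0) 0 = e := by rw [h2]; rfl
  have hds : s.nat 16 (s.nat 29 0 0 0) (s.nat 30 0 0 0) 0 = d := by rw [h3]; rfl
  have hdd : 1 - d ≠ d := by omega
  have hrun : stepBack.run s = (((((s.setNat 27 0 0 0 e).setNat 28 0 0 0 d).setNat 11 e d 0
      (s.nat 11 e d 0 - G.dec e d 0)).setNat 11 e (1 - d) 0 (s.nat 11 e (1 - d) 0 + 1)).setNat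
      29 0 0 0 (G.node e d).1).setNat 30 0 0 0 (G.node e d).2 := by
    simp [stepBack, Code.run, hes, hds, hdec, Net.node, hends, upd, hdd]
  rw [hrun]
  have h11 : ((((((s.setNat 27 0 0 0 e).setNat 28 0 0 0 d).setNat 11 e d 0
      (s.nat 11 e d 0 - G.dec e d 0)).setNat 11 e (1 - d) 0 (s.nat 11 e (1 - d) 0 + 1)).setNat
      29 0 0 0 (G.node e d).1).setNat 30 0 0 0 (G.node e d).2).nat 11 = G.flip (s.nat 11) e d := by
    simp [Net.flip]
  refine ⟨L', ⟨?_, ?_, ?_, ?_, ?_, ?_, ?_, ?_, ?_, ?_⟩, hlen⟩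
  · rw [← h1]
    exact netOf_eq (by simp) (by simp) (by simp) (by simp) (by simp)
  · simpa using h2
  · simpa using h3
  · simpa using h4
  · simpa using h5
  · simpa using hmem
  · rw [h11]
    refine htree.congr (fun e' d' hin hin' ht => ?_) fun v _ => ⟨rfl, rfl⟩
    -- The flipped arc has the current node as an end, and `L'` does not contain this node. So the
    -- flip does not touch the rest of the tree.
    have hne : e' ≠ e := by
      rintro rfl
      have hd' := ht.2.1
      refine hnot ?_
      rw [← hend]
      by_cases hdd' : d' = d
      · exact hdd' ▸ hin'
      · rwa [show d' = 1 - d by omega] at hin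
    obtain ⟨t1, t2, t3, t4⟩ := ht
    exact ⟨t1, t2, by rwa [Net.flip_of_ne hne], t4⟩
  · rw [h11]
    exact htight.capacities_flip hG h8
  · rw [h11]
    exact htight.valid_flip hG h9
  · intro v hv
    rw [h11, htight.net_flip hG, h10 v hv, hend]
    simp
    ring

/-- The surplus unit starts at the sink, where no balance is required, and on arrival at the root it
accounts for the new driver. The list of remaining nodes shrinks in every step, so `G.M + 1` rounds
suffice. -/
lemma run_augment (hG : G.Proper) {src : ℕ × ℕ} {r : ℕ → ℕ → ℕ → ℕ} {L : List (ℕ × ℕ)} {s : Store}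
    (h : HoldsTree G r src L s) (hL : L.length ≤ G.M + 1) (hs : G.sink ∈ L) (hr : G.Capacities r)
    (h1 : s.nat 2 (s.nat 20 0 0 0) 1 0 = src.1) (h2 : s.nat 2 (s.nat 20 0 0 0) 2 0 = src.2) :
    G.Capacities ((augment.run s).nat 11) ∧ G.Valid ((augment.run s).nat 11) (s.real 11) ∧
    ∀ v, v ≠ G.sink → G.net (fun e => (augment.run s).nat 11 e 1 0) v =
      G.net (fun e => r e 1 0) v + if src = v then 1 else 0 := by
  have hM : s.nat 13 0 0 0 = G.M := congrArg Net.M h.net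
  have hT : s.nat 0 3 0 0 = G.T := congrArg Net.T h.net
  set s₀ := (s.setNat 29 0 0 0 0).setNat 30 0 0 0 (G.T + 1) with hs₀
  have hrun : augment.run s = (count 21 (var 13 + 1)
      (ite (.and (.and (.nle (var 29) (.cell 2 (var 20) 1 0)) (.nle (.cell 2 (var 20) 1 0) (var 29)))
        (.and (.nle (var 30) (.cell 2 (var 20) 2 0)) (.nle (.cell 2 (var 20) 2 0) (var 30))))
      skip stepBack)).run s₀ := by
    simp [augment, Code.run, hT, hs₀]
  have h0 : Augmenting G (s.real 11) (s.nat 15) (s.nat 16) (G.net fun e => r e 1 0) src L s₀ := by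
    refine ⟨?_, ?_, ?_, ?_, ?_, ?_, ?_, ?_, ?_, ?_⟩
    · rw [← h.net]
      exact netOf_eq (by simp [hs₀]) (by simp [hs₀]) (by simp [hs₀]) (by simp [hs₀]) (by simp [hs₀])
    · simp [hs₀]
    · simp [hs₀]
    · simpa [hs₀] using h1
    · simpa [hs₀] using h2
    · simpa [hs₀, Net.sink] using hs
    · simpa [hs₀, h.res] using h.tree
    · simpa [hs₀, h.res] using hr
    · simpa [hs₀, h.res] using h.valid
    · intro v hv
      have : (0, G.T + 1) ≠ v := fun h => hv h.symm
      simp [hs₀, h.res, this]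
  rw [hrun]
  have key := run_count (x := 21) (e := var 13 + 1) (s := s₀)
    (c := ite (.and (.and (.nle (var 29) (.cell 2 (var 20) 1 0))
        (.nle (.cell 2 (var 20) 1 0) (var 29)))
        (.and (.nle (var 30) (.cell 2 (var 20) 2 0)) (.nle (.cell 2 (var 20) 2 0) (var 30))))
      skip stepBack)
    (fun k s' => ∃ L', Augmenting G (s.real 11) (s.nat 15) (s.nat 16) (G.net fun e => r e 1 0) src
      L' s' ∧ ((s'.nat 29 0 0 0, s'.nat 30 0 0 0) = src ∨ L'.length + k ≤ G.M + 1)) (N := G.M + 1)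
    (by simp [hs₀, hM]) ⟨L, h0.setNat 0, Or.inr hL⟩ ?_
  · obtain ⟨L', k1, k2⟩ := key
    -- Otherwise the list would be exhausted, but a tree is never empty.
    have hcur : _ = src := k2.resolve_right fun h => by
      have : L' = [] := List.eq_nil_of_length_eq_zero (by omega)
      have htree := k1.tree
      rw [this] at htree
      exact htree
    refine ⟨k1.caps, k1.valid, fun v hv => ?_⟩
    rw [k1.flow v hv, hcur]
  · rintro k hk s' - ⟨L', k1, k2⟩
    rw [Code.run]
    split_ifs with hcur
    · refine ⟨L', k1.setNat _, Or.inl ?_⟩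
      simp only [holds_and, holds_nle, eval_cell, eval_const, eval_zero, eval_one, eval_two, k1.loc,
        k1.time] at hcur
      simp [Code.run, Prod.ext_iff]
      omega
    · have hne : (s'.nat 29 0 0 0, s'.nat 30 0 0 0) ≠ src := fun h => hcur (by
        simp only [holds_and, holds_nle, eval_cell, eval_const, eval_zero, eval_one, eval_two,
          k1.loc, k1.time, ← h]
        simp)
      obtain ⟨L'', k3, k4⟩ := augmenting_stepBack hG k1 hne
      exact ⟨L'', k3.setNat _, Or.inr (by have := k2.resolve_left hne; omega)⟩

/-! All the drivers -/

variable {l n m : ℕ}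

/-- The node at which driver `i` enters. -/
noncomputable def source (E : Economy (Fin l) (Fin n) (Fin m)) (i : ℕ) : ℕ × ℕ :=
  ((inputStore E).nat 2 i 1 0, (inputStore E).nat 2 i 2 0)

lemma source_eq (E : Economy (Fin l) (Fin n) (Fin m)) (i : Fin n) :
    source E i = ((E.entryLoc i : ℕ), E.entryTime i) := by
  have hE : Input E (inputStore E) := ⟨fun _ _ => rfl, fun _ _ => rfl⟩
  rw [source, hE.entryLoc, hE.entryTime]

/-- The store holds an optimal flow for the first `k` drivers. -/
structure Routed (E : Economy (Fin l) (Fin n) (Fin m)) (k : ℕ) (s : Store) : Prop where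
  input : Input E s
  rep : Represents E (netOf s)
  caps : (netOf s).Capacities (s.nat 11)
  valid : (netOf s).Valid (s.nat 11) (s.real 11)
  sink : nodeVal (s.real 11) (netOf s).sink = 0
  flow : ∀ v, v ≠ (netOf s).sink → (netOf s).net (fun e => s.nat 11 e 1 0) v =
    ∑ i ∈ Finset.range k, if source E i = v then 1 else 0

lemma Routed.setNat {E : Economy (Fin l) (Fin n) (Fin m)} {k : ℕ} {s : Store} (h : Routed E k s)
    (i : ℕ) : Routed E k (s.setNat 20 0 0 0 i) := by
  have hnet : netOf (s.setNat 20 0 0 0 i) = netOf s :=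
    netOf_eq (by simp) (by simp) (by simp) (by simp) (by simp)
  obtain ⟨h1, h2, h3, h4, h5, h6⟩ := h
  refine ⟨h1.of_eq (fun A hA => by simp [show A ≠ 20 by omega]) fun A hA => rfl, ?_, ?_, ?_, ?_, ?_⟩
    <;> rw [hnet]
  exacts [h2, by simpa using h3, by simpa using h4, by simpa using h5, by simpa using h6]

/-- Of flow and potential, growing the tree changes only the potential and augmenting only the flow.
Validity survives both, and every driver adds one unit at her source. -/
lemma routed_route {E : Economy (Fin l) (Fin n) (Fin m)} {s : Store} (h : SetUp E s) :
    Routed E n (route.run s) := by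
  refine run_count (Routed E) (by simpa using h.input.drivers) ?_ ?_
  · refine Routed.setNat ⟨h.input, h.rep, h.caps, h.valid, h.sink, fun v _ => ?_⟩ 0
    simp only [Net.net, Finset.range_zero, Finset.sum_empty]
    exact Finset.sum_eq_zero fun e he => by simp [h.flow e (Finset.mem_range.1 he)]
  · intro k hk s' hk' hR
    refine Routed.setNat ?_ _
    have hG := hR.rep.proper
    have hsrc : (netOf s').Inner (source E k) := by
      have h1 := source_eq E ⟨k, hk⟩
      simp only at h1
      rw [h1]
      exact ⟨by rw [hR.rep.l_eq]; exact (E.entryLoc _).2, by rw [hR.rep.T_eq]; exact E.entryTime_le _⟩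
    have e1 : s'.nat 2 (s'.nat 20 0 0 0) 1 0 = (source E k).1 := by
      rw [hR.input.nat 2 (by omega), hk']
      rfl
    have e2 : s'.nat 2 (s'.nat 20 0 0 0) 2 0 = (source E k).2 := by
      rw [hR.input.nat 2 (by omega), hk']
      rfl
    have t0 := holdsTree_initTree rfl rfl hR.valid hR.sink e1 e2 hsrc
    obtain ⟨L, t1, hlen, hmem⟩ := holdsTree_grow hG hR.caps t0
    have f2 : (grow.run (initTree.run s')).nat 2 = s'.nat 2 := by
      rw [run_nat grow (by decide), run_nat initTree (by decide)]
    have f20 : (grow.run (initTree.run s')).nat 20 = s'.nat 20 := by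
      rw [run_nat grow (by decide), run_nat initTree (by decide)]
    obtain ⟨a1, a2, a3⟩ := run_augment hG t1 hlen hmem hR.caps (by rw [f2, f20, e1])
      (by rw [f2, f20, e2])
    have hnet : netOf (augment.run (grow.run (initTree.run s'))) = netOf s' := by
      rw [netOf_run (by decide) (by decide), t1.net]
    have f11 := run_real augment (show 11 ∉ _ by decide) (grow.run (initTree.run s'))
    simp only [Code.run]
    refine ⟨((hR.input.run (c := initTree) ?_ ?_).run (c := grow) ?_ ?_).run ?_ ?_, ?_, ?_, ?_, ?_, ?_⟩
    iterate 6 exact fun A hA => by interval_cases A <;> decide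
    · rw [hnet]
      exact hR.rep
    · rwa [hnet]
    · rwa [hnet, f11]
    · rw [hnet, f11]
      exact t1.sink
    · intro v hv
      rw [hnet] at hv ⊢
      rw [a3 v hv, hR.flow v hv, Finset.sum_range_succ]

end Algorithm
end Rideshare

namespace Rideshare

/-! ### Correctness of the output -/

namespace Algorithm

open Code

variable {l n m : ℕ} {E : Economy (Fin l) (Fin n) (Fin m)}

/-! Prices and pick-ups -/

/-- The loops also fill in entries for trips that are not feasible; these carry no meaning. -/
lemma run_writePrices {s : Store} (hE : Input E s) :
    (∀ a < l, ∀ b < l, ∀ t ≤ E.T, (writePrices.run s).real 3 a b t =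
      s.real 0 a b t + s.real 11 a t 0 - s.real 11 b (t + s.nat 1 a b 0) 0) ∧
    ∀ j < m, (writePrices.run s).nat 4 j 0 0 = s.nat 11 (n + j) 1 0 := by
  set c := count 23 locs (count 24 locs (count 25 (horizon + 1)
    (rset 3 (var 23) (var 24) (var 25) (.cell 0 (var 23) (var 24) (var 25) +
      .cell 11 (var 23) (var 25) 0 -
      .cell 11 (var 24) (var 25 + .cell 1 (var 23) (var 24) 0) 0)))) with hc
  have hrun : writePrices.run s =
      (count 20 riders (nset 4 (var 20) 0 0 (.cell 11 (drivers + var 20) 1 0))).run (c.run s) := rfl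
  rw [hrun, run_real (count 20 riders _) (show 3 ∉ _ by decide)]
  constructor
  · set F : ℕ → ℕ → ℕ → ℝ := fun a b t =>
      s.real 0 a b t + s.real 11 a t 0 - s.real 11 b (t + s.nat 1 a b 0) 0 with hF
    let Fr : Store → Prop := fun s' => (s'.nat 0 = s.nat 0 ∧ s'.nat 1 = s.nat 1) ∧
      s'.real 0 = s.real 0 ∧ s'.real 11 = s.real 11
    refine (run_count (s := s) (fun k s' => Fr s' ∧ ∀ a < k, ∀ b < l, ∀ t ≤ E.T,
      s'.real 3 a b t = F a b t) (N := l) (by simpa using hE.locs) (by simp [Fr]) ?_).2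
    rintro a - s₁ ha ⟨h1, h2⟩
    have key := run_count (x := 24) (e := locs) (s := s₁)
      (c := count 25 (horizon + 1)
        (rset 3 (var 23) (var 24) (var 25) (.cell 0 (var 23) (var 24) (var 25) +
          .cell 11 (var 23) (var 25) 0 -
          .cell 11 (var 24) (var 25 + .cell 1 (var 23) (var 24) 0) 0)))
      (fun k s' => (Fr s' ∧ s'.nat 23 0 0 0 = a) ∧ ∀ a' b t, t ≤ E.T →
        (a' < a ∧ b < l ∨ a' = a ∧ b < k) → s'.real 3 a' b t = F a' b t) (N := l)
      (by simp [h1.1.1, hE.locs])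
      ⟨by simpa [Fr, ha] using h1, fun a' b t ht h => h2 a' (by omega) b (by omega) t ht⟩ ?_
    · obtain ⟨⟨k1, k2⟩, k3⟩ := key
      exact ⟨by simpa [Fr] using k1, fun a' ha' b hb t ht => k3 a' b t ht (by omega)⟩
    · rintro b - s₂ hb ⟨⟨k1, k2⟩, k3⟩
      have key := run_count (x := 25) (e := horizon + 1) (s := s₂)
        (c := rset 3 (var 23) (var 24) (var 25) (.cell 0 (var 23) (var 24) (var 25) +
          .cell 11 (var 23) (var 25) 0 -
          .cell 11 (var 24) (var 25 + .cell 1 (var 23) (var 24) 0) 0))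
        (fun k s' => (Fr s' ∧ s'.nat 23 0 0 0 = a ∧ s'.nat 24 0 0 0 = b) ∧ ∀ a' b' t,
          ((a' < a ∧ b' < l ∨ a' = a ∧ b' < b) ∧ t ≤ E.T ∨ a' = a ∧ b' = b ∧ t < k) →
          s'.real 3 a' b' t = F a' b' t) (N := E.T + 1)
        (by simp [k1.1.1, hE.horizon])
        ⟨by simpa [Fr, k2, hb] using k1, fun a' b' t h => k3 a' b' t (by omega) (by omega)⟩ ?_
      · obtain ⟨⟨q1, q2, q3⟩, q4⟩ := key
        exact ⟨⟨by simpa [Fr] using q1, by simpa using q2⟩, fun a' b' t ht h =>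
          q4 a' b' t (by omega)⟩
      · rintro k hk s₃ hk' ⟨⟨⟨⟨q1, q2⟩, q3, q4⟩, q5, q6⟩, q7⟩
        simp only [Code.run, eval_cell, eval_zero, eval_const, eval_add, reval_add, reval_sub,
          reval_cell, q2, q3, q4, q5, q6, hk']
        refine ⟨by simp [Fr, q1, q2, q3, q4, q5, q6], fun a' b' t h => ?_⟩
        simp only [Store.setNat_real, Store.setReal_real_self, upd]
        split_ifs with heq
        · obtain ⟨rfl, rfl, rfl⟩ := heq
          rfl
        · exact q7 a' b' t (by omega)
  · have e11 := run_nat c (show 11 ∉ _ by decide) s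
    have e0 := run_nat c (show 0 ∉ _ by decide) s
    refine (run_count (fun k s' => (s'.nat 0 = s.nat 0 ∧ s'.nat 11 = s.nat 11) ∧
      ∀ j < k, s'.nat 4 j 0 0 = s.nat 11 (n + j) 1 0) (N := m)
      (by simp [e0, hE.riders]) (by simp [e0, e11]) ?_).2
    rintro k hk s' hk' ⟨⟨h1, h2⟩, h3⟩
    refine ⟨by simp [Code.run, h1, h2], fun j hj => ?_⟩
    simp only [Code.run, eval_cell, eval_zero, eval_const, eval_add, eval_one, hk', h1, h2,
      hE.drivers, Store.setNat_nat_of_ne, ne_eq, Nat.reduceEqDiff, not_false_eq_true,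
      Store.setNat_nat_self, upd, and_true]
    split_ifs with heq
    · rw [heq]
    · exact h3 j (by omega)

/-! Action paths -/

variable {G : Net} {f : ℕ → ℕ → ℕ → ℕ}

/-- The node at which an action path of driver `i` ends. -/
def endNode (E : Economy (Fin l) (Fin n) (Fin m)) (i : Fin n) (w : ActionPath (Fin l) (Fin m)) :
    ℕ × ℕ :=
  (((Economy.endLoc (E.entryLoc i) (w.map Prod.fst) : Fin l) : ℕ),
    E.endTime (E.entryTime i) (w.map Prod.fst))

open Classical in
/-- The store holds the action paths `z`, made of arcs with flow in `f`, and the rest of the flow. -/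
structure HoldsPaths (E : Economy (Fin l) (Fin n) (Fin m)) (G : Net) (f : ℕ → ℕ → ℕ → ℕ)
    (z : Fin n → ActionPath (Fin l) (Fin m)) (s : Store) : Prop where
  input : Input E s
  net : netOf s = G
  le : ∀ e, s.nat 11 e 1 0 ≤ f e 1 0
  empty : ∀ e < n, s.nat 11 e 1 0 = f e 1 0
  len : ∀ i : Fin n, s.nat 5 i 0 0 = (z i).length
  row : ∀ (i : Fin n) (k : ℕ) (hk : k < (z i).length),
    s.nat 6 i k 0 = (z i)[k].1.orig ∧ s.nat 6 i k 1 = (z i)[k].1.dest ∧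
    s.nat 6 i k 2 = (z i)[k].1.start ∧
    s.nat 6 i k 3 = (z i)[k].2.elim 0 (fun j => (j : ℕ) + 1)
  path : ∀ i, (z i).map Prod.fst ∈ E.paths i
  carried : ∀ i r j, (r, some j) ∈ z i → r = E.request j
  idle : ∀ i r, (r, none) ∈ z i → ∃ e < G.M, 1 ≤ f e 1 0 ∧ IsRow G e (relocationRow E r)
  count : ∀ j : Fin m, f (n + j) 1 0 = s.nat 11 (n + j) 1 0 +
    (Finset.univ.filter fun i => E.PicksUp (z i) j).card

open Classical in
/-- A trip along an arc with flow is appended to an action path. -/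
lemma HoldsPaths.append {z : Fin n → ActionPath (Fin l) (Fin m)} {s s' : Store}
    (h : HoldsPaths E G f z s) (hcap : ∀ j : Fin m, f (n + j) 1 0 ≤ 1)
    (i : Fin n) {e : ℕ} (he : e < G.M) (hne : n ≤ e) (hf : 1 ≤ s.nat 11 e 1 0)
    {r : Trip (Fin l)} {o : Option (Fin m)} (hr : r ∈ E.trips)
    (hend : endNode E i (z i) = ((r.orig : ℕ), r.start))
    (hsome : ∀ j, o = some j → r = E.request j ∧ e = n + j)
    (hnone : o = none → n + m ≤ e ∧ IsRow G e (relocationRow E r))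
    (hin : Input E s') (hnet : netOf s' = G)
    (h11 : s'.nat 11 = upd (s.nat 11) e 1 0 (s.nat 11 e 1 0 - 1))
    (h5 : s'.nat 5 = upd (s.nat 5) i 0 0 ((z i).length + 1))
    (h6 : s'.nat 6 = upd (upd (upd (upd (s.nat 6) i (z i).length 0 r.orig) i (z i).length 1 r.dest)
      i (z i).length 2 r.start) i (z i).length 3 (o.elim 0 fun j => (j : ℕ) + 1)) :
    HoldsPaths E G f (Function.update z i (z i ++ [(r, o)])) s' := by
  have hz : ∀ i', i' ≠ i → Function.update z i (z i ++ [(r, o)]) i' = z i' := fun i' hi' =>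
    Function.update_of_ne hi' _ _
  have hzi : Function.update z i (z i ++ [(r, o)]) i = z i ++ [(r, o)] := Function.update_self ..
  refine ⟨hin, hnet, fun e' => ?_, fun e' he' => ?_, fun i' => ?_, fun i' k hk => ?_, fun i' => ?_,
    fun i' r' j hm => ?_, fun i' r' hm => ?_, fun j => ?_⟩
  · have := h.le e'
    rw [h11]
    by_cases hee : e' = e
    · subst hee
      rw [upd_self]
      omega
    · simpa [upd, hee] using this
  · rw [h11]
    simpa [upd, show e' ≠ e by omega] using h.empty e' he'
  · rw [h5]
    by_cases hi : i' = i
    · subst hi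
      simp
    · rw [hz i' hi]
      simpa [upd, Fin.val_inj, hi] using h.len i'
  · rw [h6]
    by_cases hi : i' = i
    · subst hi
      simp only [hzi] at hk ⊢
      rcases Nat.lt_or_ge k (z i').length with hlt | hge
      · rw [List.getElem_append_left hlt]
        simpa [upd, hlt.ne] using h.row i' k hlt
      · have : k = (z i').length := by simp at hk; omega
        subst this
        simp [upd]
    · simp only [hz i' hi] at hk ⊢
      simpa [upd, Fin.val_inj, hi] using h.row i' k hk
  · by_cases hi : i' = i
    · subst hi
      rw [hzi, List.map_append]
      simp only [endNode, Prod.mk.injEq, Fin.val_inj] at hend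
      exact E.isPathFrom_concat (h.path i') hend.1.symm hend.2.symm hr
    · rw [hz i' hi]
      exact h.path i'
  · by_cases hi : i' = i
    · subst hi
      rw [hzi] at hm
      rcases List.mem_append.1 hm with hm | hm
      · exact h.carried i' r' j hm
      · simp only [List.mem_singleton, Prod.mk.injEq] at hm
        rw [hm.1]
        exact (hsome j hm.2.symm).1
    · rw [hz i' hi] at hm
      exact h.carried i' r' j hm
  · by_cases hi : i' = i
    · subst hi
      rw [hzi] at hm
      rcases List.mem_append.1 hm with hm | hm
      · exact h.idle i' r' hm
      · simp only [List.mem_singleton, Prod.mk.injEq] at hm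
        rw [hm.1]
        exact ⟨e, he, hf.trans (h.le e), (hnone hm.2.symm).2⟩
    · rw [hz i' hi] at hm
      exact h.idle i' r' hm
  · have hcount := h.count j
    by_cases hj : o = some j
    · obtain ⟨hrj, hej⟩ := hsome j hj
      have h1 := hcap j
      rw [← hej] at hcount h1 ⊢
      -- A unit is still left on the arc of rider `j`, which carried at most one, so nobody has
      -- picked her up yet.
      have h0 : (Finset.univ.filter fun i => E.PicksUp (z i) j) = ∅ :=
        Finset.card_eq_zero.1 (by omega)
      have hnot : ∀ i', ¬ E.PicksUp (z i') j := fun i' hp => by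
        have : i' ∈ (Finset.univ.filter fun i => E.PicksUp (z i) j) := by simpa using hp
        rw [h0] at this
        simp at this
      have h2 : (Finset.univ.filter fun i' =>
          E.PicksUp (Function.update z i (z i ++ [(r, o)]) i') j) = {i} := by
        ext i'
        simp only [Finset.mem_filter, Finset.mem_univ, true_and, Finset.mem_singleton]
        by_cases hi : i' = i
        · subst hi
          simp [Economy.PicksUp, hrj, hj]
        · simp [hnot, hi]
      rw [h2, h11, upd_self, Finset.card_singleton]
      rw [h0, Finset.card_empty] at hcount
      omega
    · have hne' : n + (j : ℕ) ≠ e := by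
        intro hje
        cases o with
        | none =>
          have := (hnone rfl).1
          omega
        | some j' =>
          have := (hsome j' rfl).2
          exact hj (by rw [Fin.ext (by omega : (j' : ℕ) = j)])
      have h2 : ∀ i', E.PicksUp (Function.update z i (z i ++ [(r, o)]) i') j ↔
          E.PicksUp (z i') j := fun i' => by
        by_cases hi : i' = i
        · subst hi
          have : some j ≠ o := fun h => hj h.symm
          simp [Economy.PicksUp, this]
        · rw [hz i' hi]
      simp only [h2, h11]
      simpa [upd, hne'] using hcount

end Algorithm
end Rideshare

/-! ### Decomposition of the flow into action paths -/

namespace Rideshare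

namespace Algorithm

open Code

variable {l n m : ℕ} {E : Economy (Fin l) (Fin n) (Fin m)} {G : Net} {f : ℕ → ℕ → ℕ → ℕ}

/-- Arc `e` has flow, leaves node `v`, and does not stand for an empty path. -/
def Usable (n : ℕ) (G : Net) (r : ℕ → ℕ → ℕ → ℕ) (v : ℕ × ℕ) (e : ℕ) : Prop :=
  e < G.M ∧ n ≤ e ∧ 1 ≤ r e 1 0 ∧ G.node e 0 = v

lemma run_findArc {s : Store} (hE : Input E s) (hG : netOf s = G) {v : ℕ × ℕ}
    (h29 : s.nat 29 0 0 0 = v.1) (h30 : s.nat 30 0 0 0 = v.2)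
    (h : ∃ e, Usable n G (s.nat 11) v e) :
    Usable n G (s.nat 11) v ((findArc.run s).nat 27 0 0 0) := by
  obtain ⟨e, he⟩ := h
  refine (run_count (s := s) (fun k s' => (s'.nat 0 = s.nat 0 ∧ s'.nat 10 = s.nat 10 ∧
    s'.nat 11 = s.nat 11 ∧ s'.nat 29 = s.nat 29 ∧ s'.nat 30 = s.nat 30) ∧
    ((∃ e < k, Usable n G (s.nat 11) v e) → Usable n G (s.nat 11) v (s'.nat 27 0 0 0))) (N := G.M)
    (by rw [← hG]; rfl) (by simp) ?_).2 ⟨e, he.1, he⟩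
  rintro k hk s' hk' ⟨⟨h1, h2, h3, h4, h5⟩, h6⟩
  have htest : (Test.and (.nle drivers (var 22)) (.and (.nle 1 (.cell 11 (var 22) 1 0))
        (.and (.and (.nle (var 29) (.cell 10 (var 22) 0 0)) (.nle (.cell 10 (var 22) 0 0) (var 29)))
          (.and (.nle (var 30) (.cell 10 (var 22) 1 0))
            (.nle (.cell 10 (var 22) 1 0) (var 30)))))).Holds s' ↔ Usable n G (s.nat 11) v k := by
    have hnode : G.node k 0 = (s.nat 10 k 0 0, s.nat 10 k 1 0) := by rw [← hG]; rfl
    simp only [holds_and, holds_nle, eval_cell, eval_zero, eval_one, eval_const, hk', h1, h2, h3,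
      h4, h5, hE.drivers, h29, h30, Usable, hnode, Prod.ext_iff]
    constructor
    · intro h
      omega
    · intro h
      omega
  rw [Code.run]
  split_ifs with hu <;> rw [htest] at hu
  · exact ⟨by simp [Code.run, h1, h2, h3, h4, h5], fun _ => by simpa [Code.run, hk'] using hu⟩
  · refine ⟨by simp [Code.run, h1, h2, h3, h4, h5], ?_⟩
    rintro ⟨e, he, heu⟩
    have : e ≠ k := fun h => hu (h ▸ heu)
    simpa [Code.run] using h6 ⟨e, by omega, heu⟩

lemma run_recordTrip {s : Store} (hE : Input E s) {i e : ℕ} (h20 : s.nat 20 0 0 0 = i)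
    (h27 : s.nat 27 0 0 0 = e) : recordTrip.run s =
      ((((s.setNat 6 i (s.nat 5 i 0 0) 0 (s.nat 29 0 0 0)).setNat 6 i (s.nat 5 i 0 0) 1
        (s.nat 10 e 0 1)).setNat 6 i (s.nat 5 i 0 0) 2 (s.nat 30 0 0 0)).setNat 6
        i (s.nat 5 i 0 0) 3 (if n + m ≤ e then 0 else e - n + 1)).setNat 5 i 0 0
        (s.nat 5 i 0 0 + 1) := by
  have h1 := hE.drivers
  have h2 := hE.riders
  by_cases h : n + m ≤ e
  · simp [recordTrip, Code.run, h20, h27, h1, h2, h]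
  · simp [recordTrip, Code.run, h20, h27, h1, h2, h]

/-- The flow without that on the arcs for empty paths. -/
def tripFlow (n : ℕ) (r : ℕ → ℕ → ℕ → ℕ) (e : ℕ) : ℕ := if e < n then 0 else r e 1 0

/-- The number of the drivers from `k` on that enter at node `v` and do not take the empty path. -/
noncomputable def demand (E : Economy (Fin l) (Fin n) (Fin m)) (f : ℕ → ℕ → ℕ → ℕ) (k : ℕ)
    (v : ℕ × ℕ) : ℤ :=
  ∑ i ∈ Finset.Ico k n, if f i 1 0 = 0 ∧ source E i = v then 1 else 0

/-- The action path ends where there is flow on the arc for exiting. -/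
def Exits (E : Economy (Fin l) (Fin n) (Fin m)) (G : Net) (f : ℕ → ℕ → ℕ → ℕ) (i : Fin n)
    (w : ActionPath (Fin l) (Fin m)) : Prop :=
  ∃ e < G.M, 1 ≤ f e 1 0 ∧ IsRow G e (exitRow E
    (Economy.endLoc (E.entryLoc i) (w.map Prod.fst)) (E.endTime (E.entryTime i) (w.map Prod.fst)))

/-- The store while the action path of driver `i` is being determined. -/
structure Following (E : Economy (Fin l) (Fin n) (Fin m)) (G : Net) (f : ℕ → ℕ → ℕ → ℕ) (i : Fin n)
    (z₀ z : Fin n → ActionPath (Fin l) (Fin m)) (s : Store) : Prop where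
  paths : HoldsPaths E G f z s
  driver : s.nat 20 0 0 0 = i
  other : ∀ i', i' ≠ i → z i' = z₀ i'
  flow : ∀ v, v ≠ G.sink → G.net (tripFlow n (s.nat 11)) v = demand E f (i + 1) v +
    if (s.nat 29 0 0 0, s.nat 30 0 0 0) = v then 1 else 0
  cur : (s.nat 30 0 0 0 ≤ E.T ∧ endNode E i (z i) = (s.nat 29 0 0 0, s.nat 30 0 0 0)) ∨
    ((s.nat 29 0 0 0, s.nat 30 0 0 0) = G.sink ∧ Exits E G f i (z i))

lemma HoldsPaths.of_eq {z : Fin n → ActionPath (Fin l) (Fin m)} {s s' : Store}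
    (h : HoldsPaths E G f z s) (hn : ∀ A ≤ 13, s'.nat A = s.nat A)
    (hr : ∀ A ≤ 10, s'.real A = s.real A) : HoldsPaths E G f z s' := by
  obtain ⟨h1, h2, h3, h4, h5, h6, h7, h8, h9, h10⟩ := h
  have e5 := hn 5 (by omega)
  have e6 := hn 6 (by omega)
  have e11 := hn 11 (by omega)
  refine ⟨h1.of_eq (fun A hA => hn A (by omega)) fun A hA => hr A (by omega), ?_, by rwa [e11],
    by rwa [e11], by rwa [e5], by rwa [e6], h7, h8, h9, by rwa [e11]⟩
  rw [← h2]
  exact netOf_eq (hn 0 (by omega)) (hn 10 (by omega)) (hn 12 (by omega)) (hn 13 (by omega))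
      (hr 10 (by omega))

lemma tripFlow_upd {r : ℕ → ℕ → ℕ → ℕ} {e : ℕ} (he : e < G.M) (hn : n ≤ e) (hr : 1 ≤ r e 1 0)
    (v : ℕ × ℕ) : G.net (tripFlow n (upd r e 1 0 (r e 1 0 - 1))) v = G.net (tripFlow n r) v -
      (if G.node e 0 = v then 1 else 0) + if G.node e 1 = v then 1 else 0 := by
  rw [G.net_of_eq (f := tripFlow n r) (c := -1) he]
  · ring
  · intro e' he'
    simp [tripFlow, upd, he']
  · simp [tripFlow, show ¬ e < n by omega]
    omega

/-- The unit at the current node moves on along an arc with flow. A trip arc lengthens the action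
path, while an exit arc leads to the sink and is not recorded. Time increases in both cases. -/
lemma following_stepForward (hG : Represents E G) (hcap : ∀ j : Fin m, f (n + j) 1 0 ≤ 1)
    {i : Fin n} {z₀ z : Fin n → ActionPath (Fin l) (Fin m)} {s : Store}
    (h : Following E G f i z₀ z s) (hdem : ∀ v, 0 ≤ demand E f (i + 1) v)
    (ht : s.nat 30 0 0 0 ≤ E.T) :
    ∃ z', Following E G f i z₀ z' (stepForward.run s) ∧
      s.nat 30 0 0 0 < (stepForward.run s).nat 30 0 0 0 := by
  obtain ⟨hp, hi, hother, hflow, hcur⟩ := h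
  set v := (s.nat 29 0 0 0, s.nat 30 0 0 0) with hv
  have hvs : v ≠ G.sink := fun h => by
    have := congrArg Prod.snd h
    simp only [hv, Net.sink, hG.T_eq] at this
    omega
  have hend : endNode E i (z i) = v := by
    rcases hcur with ⟨_, h⟩ | ⟨h, _⟩
    exacts [h, absurd h hvs]
  -- The net outflow at the current node is the unit being followed plus the demand of later
  -- drivers, hence positive.
  have hex : ∃ e, Usable n G (s.nat 11) v e := by
    have hpos : 0 < G.net (tripFlow n (s.nat 11)) v := by
      rw [hflow v hvs]
      have := hdem v
      simp only [if_true]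
      omega
    obtain ⟨e, he, hf, hn⟩ := G.exists_of_net_pos hpos
    rw [tripFlow] at hf
    split_ifs at hf with hen
    · omega
    · exact ⟨e, he, by omega, hf, hn⟩
  have hu := run_findArc hp.input hp.net rfl rfl hex
  have hp₁ : HoldsPaths E G f z (findArc.run s) := hp.of_eq
    (fun A hA => run_nat findArc (by interval_cases A <;> decide) s)
    fun A hA => run_real findArc (by interval_cases A <;> decide) s
  have e11 := run_nat findArc (show 11 ∉ _ by decide) s
  have e20 := run_nat findArc (show 20 ∉ _ by decide) s
  have e29 := run_nat findArc (show 29 ∉ _ by decide) s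
  have e30 := run_nat findArc (show 30 ∉ _ by decide) s
  rw [stepForward, Code.run]
  generalize findArc.run s = s₁ at *
  generalize he : s₁.nat 27 0 0 0 = e at hu
  obtain ⟨heM, hne, hf, hnode⟩ := hu
  rw [← e11] at hf hflow
  rw [← e20] at hi
  set s₂ := s₁.setNat 11 e 1 0 (s₁.nat 11 e 1 0 - 1) with hs₂
  have hends : s₁.nat 10 = G.ends := by rw [← hp₁.net]; rfl
  have hT : s₁.nat 0 3 0 0 = E.T := hp₁.input.horizon
  have hE₂ : Input E s₂ := hp₁.input.of_eq (fun A hA => by simp [hs₂, show A ≠ 11 by omega])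
    fun A hA => rfl
  have hflow' : ∀ w, w ≠ G.sink →
      G.net (tripFlow n (upd (s₁.nat 11) e 1 0 (s₁.nat 11 e 1 0 - 1))) w =
      demand E f (i + 1) w + if G.node e 1 = w then 1 else 0 := fun w hw => by
    rw [tripFlow_upd heM hne hf, hflow w hw, hnode]
    ring
  have hlt : s.nat 30 0 0 0 < (G.node e 1).2 := by
    have := hG.proper.time_lt e heM
    rwa [hnode] at this
  -- the arc stands for a trip
  have trip : ∀ (r : Trip (Fin l)) (o : Option (Fin m)), r ∈ E.trips →
      G.node e 0 = ((r.orig : ℕ), r.start) → G.node e 1 = ((r.dest : ℕ), E.arrival r) →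
      (∀ j, o = some j → r = E.request j ∧ e = n + j) →
      (o = none → n + m ≤ e ∧ IsRow G e (relocationRow E r)) →
      ∃ z', Following E G f i z₀ z' ((nset 11 (var 27) 1 0 (.cell 11 (var 27) 1 0 - 1) ;;
        ite (.nle (.cell 10 (var 27) 1 1) horizon) recordTrip skip ;;
        assign 29 (.cell 10 (var 27) 0 1) ;; assign 30 (.cell 10 (var 27) 1 1)).run s₁) ∧
      s.nat 30 0 0 0 < ((nset 11 (var 27) 1 0 (.cell 11 (var 27) 1 0 - 1) ;;
        ite (.nle (.cell 10 (var 27) 1 1) horizon) recordTrip skip ;;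
        assign 29 (.cell 10 (var 27) 0 1) ;; assign 30 (.cell 10 (var 27) 1 1)).run s₁).nat
          30 0 0 0 := by
    intro r o hr h0 h1 hsome hnone
    have hr' : E.arrival r ≤ E.T := hr
    have htag : (if n + m ≤ e then 0 else e - n + 1) = o.elim 0 fun j => (j : ℕ) + 1 := by
      cases o with
      | none => simp [(hnone rfl).1]
      | some j =>
        have := (hsome j rfl).2
        simp [this]
    have hdest : G.ends e 0 1 = r.dest := congrArg Prod.fst h1
    have harr : G.ends e 1 1 = E.arrival r := congrArg Prod.snd h1
    have hrv : v = ((r.orig : ℕ), r.start) := hnode.symm.trans h0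
    have horig : s₁.nat 29 0 0 0 = r.orig := by rw [e29]; exact congrArg Prod.fst hrv
    have hstart : s₁.nat 30 0 0 0 = r.start := by rw [e30]; exact congrArg Prod.snd hrv
    have hrec := run_recordTrip hE₂ (i := i) (e := e) (by simpa [hs₂] using hi)
      (by simpa [hs₂] using he)
    have hrun : (nset 11 (var 27) 1 0 (.cell 11 (var 27) 1 0 - 1) ;;
        ite (.nle (.cell 10 (var 27) 1 1) horizon) recordTrip skip ;;
        assign 29 (.cell 10 (var 27) 0 1) ;; assign 30 (.cell 10 (var 27) 1 1)).run s₁ =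
        ((recordTrip.run s₂).setNat 29 0 0 0 r.dest).setNat 30 0 0 0 (E.arrival r) := by
      have q1 : (recordTrip.run s₂).nat 10 = G.ends := by
        rw [run_nat recordTrip (by decide), ← hends, hs₂]
        simp
      have q2 : (recordTrip.run s₂).nat 27 0 0 0 = e := by
        rw [run_nat recordTrip (by decide), ← he, hs₂]
        simp
      rw [hs₂] at q1 q2 ⊢
      simp [Code.run, he, hends, q1, q2, hdest, harr, hT, hr']
    rw [hrun, hrec]
    simp only [hs₂, hends, hdest, horig, hstart, htag, Store.setNat_nat_of_ne, ne_eq,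
      Nat.reduceEqDiff, not_false_eq_true, hp₁.len i]
    refine ⟨Function.update z i (z i ++ [(r, o)]), ⟨?_, ?_, ?_, ?_, ?_⟩, ?_⟩
    · refine hp₁.append hcap i heM hne hf hr (hend.trans hrv) hsome hnone ?_ ?_ ?_ ?_ ?_
      · exact hp₁.input.of_eq (fun A hA => by
          simp [show A ≠ 11 by omega, show A ≠ 6 by omega, show A ≠ 5 by omega,
            show A ≠ 29 by omega, show A ≠ 30 by omega]) fun A hA => rfl
      · rw [← hp₁.net]
        exact netOf_eq (by simp) (by simp) (by simp) (by simp) (by simp)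
      · simp
      · simp
      · simp
    · simpa using hi
    · intro i' hi'
      rw [Function.update_of_ne hi', hother i' hi']
    · intro w hw
      simpa [h1] using hflow' w hw
    · refine Or.inl ⟨by simpa using hr', ?_⟩
      simp [endNode, Economy.endLoc_concat, Economy.endTime_concat]
    · rw [h1] at hlt
      simpa using hlt
  rcases hG.exists_row heM with ⟨i', hi', _⟩ | ⟨j, hj, hR⟩ | ⟨hge, a, t, hta, hR⟩ | ⟨hge, r, hr, hR⟩
  · omega
  · refine trip (E.request j) (some j) (E.request_mem j) hR.tail hR.head (fun j' hj' => ?_) (by simp)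
    obtain rfl : j = j' := by simpa using hj'
    exact ⟨rfl, hj⟩
  · have h1 := hR.head
    simp only [exitRow] at h1
    have hloc : G.ends e 0 1 = 0 := congrArg Prod.fst h1
    have htime : G.ends e 1 1 = E.T + 1 := congrArg Prod.snd h1
    have hrun : (nset 11 (var 27) 1 0 (.cell 11 (var 27) 1 0 - 1) ;;
        ite (.nle (.cell 10 (var 27) 1 1) horizon) recordTrip skip ;;
        assign 29 (.cell 10 (var 27) 0 1) ;; assign 30 (.cell 10 (var 27) 1 1)).run s₁ =
        (s₂.setNat 29 0 0 0 0).setNat 30 0 0 0 (E.T + 1) := by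
      simp [Code.run, hs₂, he, hends, hloc, htime, hT]
    rw [hrun]
    simp only [hs₂]
    have hend' := hend.trans (hnode.symm.trans hR.tail)
    simp only [endNode, exitRow, Prod.mk.injEq, Fin.val_inj] at hend'
    refine ⟨z, ⟨?_, ?_, hother, ?_, ?_⟩, ?_⟩
    · obtain ⟨q1, q2, q3, q4, q5, q6, q7, q8, q9, q10⟩ := hp₁
      refine ⟨?_, ?_, fun e' => ?_, fun e' he' => ?_, by simpa using q5, by simpa using q6, q7, q8, q9,
        fun j => ?_⟩
      · exact q1.of_eq (fun A hA => by
          simp [show A ≠ 11 by omega, show A ≠ 29 by omega, show A ≠ 30 by omega]) fun A hA => rfl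
      · rw [← q2]
        exact netOf_eq (by simp) (by simp) (by simp) (by simp) (by simp)
      · have := q3 e'
        by_cases hee : e' = e
        · subst hee
          simp
          omega
        · simpa [upd, hee] using this
      · simpa [upd, show e' ≠ e by omega] using q4 e' he'
      · simpa [upd, show n + (j : ℕ) ≠ e by omega] using q10 j
    · simpa using hi
    · intro w hw
      have := hflow' w hw
      rw [h1] at this
      simpa using this
    · refine Or.inr ⟨by simp [Net.sink, hG.T_eq], e, heM, hf.trans (hp₁.le e), ?_⟩
      rw [hend'.1, hend'.2]
      exact hR
    · rw [h1] at hlt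
      simpa using hlt
  · exact trip r none hr hR.tail hR.head (by simp) fun _ => ⟨hge, hR⟩

lemma Following.setNat {i : Fin n} {z₀ z : Fin n → ActionPath (Fin l) (Fin m)} {s : Store}
    (h : Following E G f i z₀ z s) (k : ℕ) : Following E G f i z₀ z (s.setNat 21 0 0 0 k) :=
  ⟨h.paths.of_eq (fun A hA => by simp [show A ≠ 21 by omega]) fun A hA => rfl,
    by simpa using h.driver, h.other, by simpa using h.flow, by simpa using h.cur⟩

/-- As time increases in each step, after `T + 1` rounds it exceeds `T`, and the only node this late
that can be reached is the sink. -/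
lemma run_follow (hG : Represents E G) (hcap : ∀ j : Fin m, f (n + j) 1 0 ≤ 1)
    {i : Fin n} {z : Fin n → ActionPath (Fin l) (Fin m)} {s : Store} (hp : HoldsPaths E G f z s)
    (hi : s.nat 20 0 0 0 = i) (hz : z i = []) (hdem : ∀ v, 0 ≤ demand E f (i + 1) v)
    (hflow : ∀ v, v ≠ G.sink → G.net (tripFlow n (s.nat 11)) v = demand E f (i + 1) v +
      if source E i = v then 1 else 0) :
    ∃ z', HoldsPaths E G f z' (follow.run s) ∧ (∀ i', i' ≠ i → z' i' = z i') ∧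
      Exits E G f i (z' i) ∧ ∀ v, v ≠ G.sink →
        G.net (tripFlow n ((follow.run s).nat 11)) v = demand E f (i + 1) v := by
  have hsrc := source_eq E i
  set s₀ := (s.setNat 29 0 0 0 (E.entryLoc i)).setNat 30 0 0 0 (E.entryTime i) with hs₀
  have hrun : follow.run s = (count 21 (horizon + 1)
      (ite (.nle (var 30) horizon) stepForward skip)).run s₀ := by
    simp [follow, Code.run, hi, hs₀, hp.input.entryLoc, hp.input.entryTime]
  have h0 : Following E G f i z z s₀ := by
    refine ⟨hp.of_eq (fun A hA => ?_) fun A hA => rfl, ?_, fun _ _ => rfl, fun v hv => ?_, Or.inl ?_⟩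
    · simp [hs₀, show A ≠ 29 by omega, show A ≠ 30 by omega]
    · simpa [hs₀] using hi
    · have := hflow v hv
      rw [hsrc] at this
      simpa [hs₀] using this
    · simp [hs₀, hz, endNode, Economy.endLoc, Economy.endTime, E.entryTime_le i]
  rw [hrun]
  have key := run_count (x := 21) (e := horizon + 1) (s := s₀)
    (c := ite (.nle (var 30) horizon) stepForward skip)
    (fun k s' => ∃ z', Following E G f i z z' s' ∧ k ≤ s'.nat 30 0 0 0) (N := E.T + 1)
    (by simp [hs₀, hp.input.horizon]) ⟨z, h0.setNat 0, Nat.zero_le _⟩ ?_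
  · obtain ⟨z', k1, k2⟩ := key
    refine ⟨z', k1.paths, k1.other, ?_⟩
    rcases k1.cur with ⟨h, _⟩ | ⟨h1, h2⟩
    · omega
    · refine ⟨h2, fun v hv => ?_⟩
      rw [k1.flow v hv, h1, if_neg hv.symm, add_zero]
  · rintro k hk s' - ⟨z', k1, k2⟩
    rw [Code.run]
    have htest : (Test.nle (var 30) horizon).Holds s' ↔ s'.nat 30 0 0 0 ≤ E.T := by
      simp [k1.paths.input.horizon]
    split_ifs with ht <;> rw [htest] at ht
    · obtain ⟨z'', k3, k4⟩ := following_stepForward hG hcap k1 hdem ht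
      refine ⟨z'', k3.setNat _, ?_⟩
      rw [Store.setNat_nat_of_ne _ _ _ _ _ (by decide)]
      omega
    · refine ⟨z', k1.setNat _, ?_⟩
      simp only [Code.run]
      rw [Store.setNat_nat_of_ne _ _ _ _ _ (by decide)]
      omega

lemma demand_nonneg (k : ℕ) (v : ℕ × ℕ) : 0 ≤ demand E f k v :=
  Finset.sum_nonneg fun i _ => by split_ifs <;> simp

lemma demand_eq {k : ℕ} (hk : k < n) (v : ℕ × ℕ) : demand E f k v =
    (if f k 1 0 = 0 ∧ source E k = v then 1 else 0) + demand E f (k + 1) v :=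
  Finset.sum_eq_sum_Ico_succ_bot hk _

/-- One path is peeled off for each driver who does not take the empty one. What remains has no
sources, so it vanishes for lack of circulations (`Proper.eq_zero_of_net`). Hence each unit on the
arc of a rider has become a pick-up. -/
lemma run_writePaths (hG : Represents E G) {s : Store} (hcap : ∀ j : Fin m, s.nat 11 (n + j) 1 0 ≤ 1)
    (hp : HoldsPaths E G (s.nat 11) (fun _ => []) s)
    (hflow : ∀ v, v ≠ G.sink →
      G.net (tripFlow n (s.nat 11)) v = demand E (s.nat 11) 0 v) :
    ∃ z, HoldsPaths E G (s.nat 11) z (writePaths.run s) ∧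
      (∀ i : Fin n, s.nat 11 i 1 0 ≠ 0 → z i = []) ∧
      (∀ i : Fin n, s.nat 11 i 1 0 = 0 → Exits E G (s.nat 11) i (z i)) ∧
      ∀ e < G.M, n ≤ e → (writePaths.run s).nat 11 e 1 0 = 0 := by
  have hset : ∀ {z : Fin n → ActionPath (Fin l) (Fin m)} {s' : Store} (k : ℕ),
      HoldsPaths E G (s.nat 11) z s' → HoldsPaths E G (s.nat 11) z (s'.setNat 20 0 0 0 k) :=
    fun k h => h.of_eq (fun A hA => by simp [show A ≠ 20 by omega]) fun A hA => rfl
  have key := run_count (x := 20) (e := drivers) (s := s)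
    (c := ite (.nle (.cell 11 (var 20) 1 0) 0) follow skip)
    (fun k s' => ∃ z, HoldsPaths E G (s.nat 11) z s' ∧
      (∀ i : Fin n, k ≤ i ∨ s.nat 11 i 1 0 ≠ 0 → z i = []) ∧
      (∀ i : Fin n, i < k → s.nat 11 i 1 0 = 0 → Exits E G (s.nat 11) i (z i)) ∧
      ∀ v, v ≠ G.sink → G.net (tripFlow n (s'.nat 11)) v = demand E (s.nat 11) k v) (N := n)
    (by simpa using hp.input.drivers)
    ⟨fun _ => [], hset 0 hp, fun _ _ => rfl, fun i hi => absurd hi (by omega), by simpa using hflow⟩ ?_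
  · obtain ⟨z, k1, k2, k3, k4⟩ := key
    refine ⟨z, k1, fun i hi => k2 i (Or.inr hi), fun i hi => k3 i i.2 hi, fun e he hn => ?_⟩
    have := hG.proper.eq_zero_of_net (f := tripFlow n ((writePaths.run s).nat 11))
      (fun v hv => by rw [writePaths, k4 v hv]; simp [demand]) he
    simpa [tripFlow, show ¬ e < n by omega] using this
  · rintro k hk s' hk' ⟨z, k1, k2, k3, k4⟩
    have htest : (Test.nle (.cell 11 (var 20) 1 0) 0).Holds s' ↔ s.nat 11 k 1 0 = 0 := by
      simp [hk', k1.empty k hk]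
    rw [Code.run]
    split_ifs with h0 <;> rw [htest] at h0
    · obtain ⟨z', q1, q2, q3, q4⟩ := run_follow (i := ⟨k, hk⟩) hG hcap k1 hk'
        (k2 ⟨k, hk⟩ (Or.inl le_rfl)) (demand_nonneg _) (fun v hv => by
          rw [k4 v hv, demand_eq hk]
          simp only [h0, true_and]
          ring)
      refine ⟨z', hset _ q1, fun i hi => ?_, fun i hi hi' => ?_, fun v hv => by simpa using q4 v hv⟩
      · have hne : i ≠ ⟨k, hk⟩ := by
          rintro rfl
          simp only at hi
          omega
        rw [q2 i hne]
        exact k2 i (by omega)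
      · by_cases hik : i = ⟨k, hk⟩
        · rw [hik]
          exact q3
        · rw [q2 i hik]
          refine k3 i ?_ hi'
          have : (i : ℕ) ≠ k := fun h => hik (Fin.ext h)
          omega
    · refine ⟨z, hset _ k1, fun i hi => k2 i (by omega), fun i hi hi' => ?_, fun v hv => ?_⟩
      · refine k3 i ?_ hi'
        have : (i : ℕ) ≠ k := fun h => h0 (by rw [← h]; exact hi')
        omega
      · have := k4 v hv
        rw [demand_eq hk] at this
        simpa [h0, Code.run] using this

end Algorithm
end Rideshare

namespace Rideshare

namespace Algorithm

open Code

variable {l n m : ℕ} {E : Economy (Fin l) (Fin n) (Fin m)} {G : Net}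

/-! ### Optimality of the output -/

/-- Half of complementary slackness, for arcs with residual capacity; `IsRow.le_of_flow` is the
other half, for arcs in use. -/
lemma IsRow.le_of_free {e : ℕ} {R : Row} (hR : IsRow G e R) (he : e < G.M)
    {r : ℕ → ℕ → ℕ → ℕ} {V : ℕ → ℕ → ℕ → ℝ} (hV : G.Valid r V) (hr : 1 ≤ r e 0 0) :
    R.gain + nodeVal V R.head ≤ nodeVal V R.tail := by
  have := hV e he 0 (by omega) hr
  rwa [hR.gain, hR.tail, hR.head] at this

lemma IsRow.le_of_flow {e : ℕ} {R : Row} (hR : IsRow G e R) (he : e < G.M)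
    {r : ℕ → ℕ → ℕ → ℕ} {V : ℕ → ℕ → ℕ → ℝ} (hV : G.Valid r V) (hr : 1 ≤ r e 1 0) :
    nodeVal V R.tail ≤ R.gain + nodeVal V R.head := by
  have := hV e he 1 (by omega) hr
  rw [hR.gain_one, hR.tail, hR.head] at this
  linarith

/-- The arc for the empty path of a driver leads from her source to the sink, so discarding its flow
cancels her contribution exactly if she takes that path. Drivers with a common source are told apart
by these arcs. -/
lemma Routed.net_tripFlow {s : Store} (h : Routed E n s) {v : ℕ × ℕ} (hv : v ≠ (netOf s).sink) :
    (netOf s).net (tripFlow n (s.nat 11)) v = demand E (s.nat 11) 0 v := by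
  have hflow := h.flow v hv
  have hM := h.rep.le_M
  set G := netOf s
  have hsplit : G.net (fun e => s.nat 11 e 1 0) v = G.net (tripFlow n (s.nat 11)) v +
      ∑ i ∈ Finset.range n, (s.nat 11 i 1 0 : ℤ) * if source E i = v then 1 else 0 := by
    have h1 : ∑ i ∈ Finset.range n, (s.nat 11 i 1 0 : ℤ) * (if source E i = v then 1 else 0) =
        ∑ e ∈ Finset.range G.M, ((if e < n then s.nat 11 e 1 0 else 0 : ℕ) : ℤ) *
          ((if G.node e 0 = v then 1 else 0) - (if G.node e 1 = v then 1 else 0)) := by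
      have hsub : Finset.range n ⊆ Finset.range G.M := fun e he => by
        simp only [Finset.mem_range] at he ⊢
        omega
      rw [← Finset.sum_subset hsub fun e _ he => by simp [show ¬ e < n by simpa using he]]
      refine Finset.sum_congr rfl fun e he => ?_
      have he := Finset.mem_range.1 he
      have hR := h.rep.empty ⟨e, he⟩
      have ht := hR.tail
      have hh := hR.head
      have hs := source_eq E ⟨e, he⟩
      simp only [emptyPathRow] at ht hh hs
      have hne : G.node e 1 ≠ v := fun hc => hv (by rw [← hc, hh, Net.sink, h.rep.T_eq])
      rw [if_pos he, if_neg hne, ht, hs, sub_zero]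
    rw [h1, Net.net, Net.net, ← Finset.sum_add_distrib]
    refine Finset.sum_congr rfl fun e _ => ?_
    by_cases he : e < n <;> simp [tripFlow, he]
  have hd : demand E (s.nat 11) 0 v = ∑ i ∈ Finset.range n, ((if source E i = v then 1 else 0) -
      (s.nat 11 i 1 0 : ℤ) * if source E i = v then 1 else 0) := by
    rw [demand, ← Finset.range_eq_Ico]
    refine Finset.sum_congr rfl fun i hi => ?_
    have hi := Finset.mem_range.1 hi
    have h1 : (s.nat 11 i 1 0) = 0 ∨ (s.nat 11 i 1 0) = 1 := by
      have h2 := (h.caps i (show i < G.M by omega)).2 (h.rep.empty ⟨i, hi⟩).dec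
      omega
    by_cases hs : source E i = v <;> rcases h1 with h1 | h1 <;> simp [hs, h1]
  rw [hd, Finset.sum_sub_distrib, ← hflow, hsplit]
  ring

/-- Each kind of arc yields one hypothesis of `isCE_of_potential`. Relocation arcs are unlimited, so
prices are nonnegative, and zero where a relocation is used. The arc of a rider compares value and
price according to whether it has flow, and the arc of an empty path decides whether a driver gains
from entering. -/
theorem isCE_of_routed {s : Store} (h : Routed E n s) (hlen : ∀ i, s.nat 5 i 0 0 = 0) :
    ∃ d p, HoldsPlan E (writePaths.run (writePrices.run s)) d p ∧ E.IsCE d p := by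
  classical
  obtain ⟨hprice, hpick⟩ := run_writePrices h.input
  have g11 := run_nat writePrices (show 11 ∉ _ by decide) s
  have g5 := run_nat writePrices (show 5 ∉ _ by decide) s
  have hin₁ : Input E (writePrices.run s) := h.input.run
    (fun A hA => by interval_cases A <;> decide) fun A hA => by interval_cases A <;> decide
  have hnet₁ := netOf_run (c := writePrices) (by decide) (by decide) s
  generalize writePrices.run s = s₁ at *
  have hG := h.rep
  have hV := h.valid
  have hcaps := h.caps
  have hM := hG.le_M
  have hsink : nodeVal (s.real 11) (0, E.T + 1) = 0 := by
    have := h.sink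
    rwa [Net.sink, hG.T_eq] at this
  have hnf : ∀ v, v ≠ (netOf s).sink → _ := fun v hv => h.net_tripFlow hv
  set G := netOf s
  have hunit : ∀ e < n + m, s.nat 11 e 0 0 + s.nat 11 e 1 0 = 1 := fun e he => by
    refine (hcaps e (by omega)).2 ?_
    rcases Nat.lt_or_ge e n with h1 | h1
    · exact (hG.empty ⟨e, h1⟩).dec
    · have := (hG.rider ⟨e - n, by omega⟩).dec
      rwa [show n + (e - n) = e by omega] at this
  have hp₁ : HoldsPaths E G (s₁.nat 11) (fun _ => []) s₁ := by
    refine ⟨hin₁, hnet₁, fun _ => le_rfl, fun _ _ => rfl, ?_, ?_, fun _ => trivial, ?_, ?_, ?_⟩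
    · intro i
      rw [g5]
      exact hlen i
    all_goals simp [Economy.PicksUp]
  obtain ⟨z, hz, hz0, hz1, hrest⟩ := run_writePaths hG
    (fun j => by rw [g11]; have := hunit (n + j) (by omega); omega) hp₁
    (by rw [g11]; exact hnf)
  rw [g11] at hz hz0 hz1
  have e4 := run_nat writePaths (show 4 ∉ _ by decide) s₁
  have e3 := run_real writePaths (show 3 ∉ _ by decide) s₁
  generalize writePaths.run s₁ = s₂ at *
  set p : Trip (Fin l) → ℝ := fun r => s₂.real 3 r.orig r.dest r.start with hpdef
  have hxval : ∀ j : Fin m, s.nat 11 (n + j) 1 0 ≤ 1 := fun j => by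
    have := hunit (n + j) (by omega)
    omega
  have hp : ∀ r ∈ E.trips, p r = E.tripCost r + s.real 11 r.orig r.start 0 -
      s.real 11 r.dest (E.arrival r) 0 := fun r hr => by
    have hr' : E.arrival r ≤ E.T := hr
    have := E.start_lt_arrival r
    simp only [hpdef]
    rw [e3, hprice _ r.orig.2 _ r.dest.2 _ (by omega), h.input.tripCost hr, h.input.dist,
      Economy.arrival]
  have hlow : ∀ (a : Fin l) (t : ℕ), t ≤ E.T → - E.exitCost (E.T - t) ≤ s.real 11 a t 0 := by
    intro a t ht
    obtain ⟨e, he, _, hR⟩ := hG.exit a t ht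
    have := hR.le_of_free he hV ((hcaps e he).1 hR.dec)
    simp only [exitRow, hsink, add_zero] at this
    exact this
  refine ⟨⟨fun j => s.nat 11 (n + j) 1 0, z⟩, p, ⟨fun j => ?_, hz.len, hz.row, fun _ _ => rfl⟩, ?_⟩
  · rw [e4]
    exact hpick j j.2
  refine E.isCE_of_potential (V := fun a t => s.real 11 a t 0)
    ⟨fun i => ⟨hz.path i, hz.carried i⟩, fun j => ⟨?_, ?_⟩⟩ hp ?_ hlow ?_ ?_ ?_ ?_
  -- No flow is left on the arc of the rider, so the flow it had equals the number of pick-ups.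
  · have h1 := hz.count j
    rw [hrest (n + j) (by omega) (by omega), zero_add] at h1
    simp only [h1, Finset.card_filter]
  · have := hxval j
    simp only
    omega
  · intro r hr
    obtain ⟨e, he, _, hR⟩ := hG.relocation r hr
    have h1 := hR.le_of_free he hV ((hcaps e he).1 hR.dec)
    simp only [relocationRow, nodeVal] at h1
    rw [hp r hr]
    linarith
  · intro j hj
    have h0 := hunit (n + j) (by omega)
    have h1 := (hG.rider j).le_of_free (by omega) hV (by simp only at hj; omega)
    simp only [riderRow, nodeVal] at h1
    rw [hp _ (E.request_mem j)]
    linarith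
  · intro j hj
    have h1 := (hG.rider j).le_of_flow (by omega) hV (by simp only at hj; omega)
    simp only [riderRow, nodeVal] at h1
    rw [hp _ (E.request_mem j)]
    linarith
  · intro i r hr
    obtain ⟨e, he, hf, hR⟩ := hz.idle i r hr
    have h1 := hR.le_of_flow he hV hf
    simp only [relocationRow, nodeVal] at h1
    rw [hp r (E.mem_trips_of_mem (hz.path i) (List.mem_map_of_mem (f := Prod.fst) hr))]
    linarith
  · intro i
    have h0 := hunit i (by omega)
    by_cases hf : s.nat 11 i 1 0 = 0
    · right
      have h1 := (hG.empty i).le_of_free (by omega) hV (by omega)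
      simp only [emptyPathRow, hsink, add_zero] at h1
      refine ⟨h1, le_antisymm ?_ (hlow _ _ (E.endTime_le (hz.path i) (E.entryTime_le i)))⟩
      -- The exit arc at the end of the path carries flow, which gives the inequality opposite to
      -- `hlow`.
      obtain ⟨e, he, hfe, hR⟩ := hz1 i hf
      have h2 := hR.le_of_flow he hV hfe
      simp only [exitRow, hsink, add_zero] at h2
      exact h2
    · left
      refine ⟨hz0 i hf, ?_⟩
      have h1 := (hG.empty i).le_of_flow (by omega) hV (by omega)
      simp only [emptyPathRow, hsink, add_zero] at h1
      exact h1

end Algorithm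
end Rideshare

namespace Rideshare

namespace Algorithm

open Code

variable {l n m : ℕ}

/-! ### The program -/

def program : Program := .seq setup.compile solve.compile

open Polynomial in
/-- A bound for the lengths of the loops. -/
noncomputable def loopBound : ℕ[X] := X + (X * (X + 1) + X * (X * (X + 1))) + X + 3

open Polynomial in
/-- The running time. -/
noncomputable def runningTime : ℕ[X] := setup.time.comp (X + 2) + solve.time.comp loopBound

lemma bounds_setup : setup.bounds = [drivers, riders, locs, horizon + 1, locs, locs, horizon + 1,
    riders, locs, horizon + 1] := rfl

lemma bounds_solve : solve.bounds = [drivers, locs, horizon + 2, var 13, var 13, locs, horizon + 2,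
    var 13 + 1, locs, locs, horizon + 1, riders, drivers, horizon + 1, var 13] := rfl

lemma eval_bounds_setup {E : Economy (Fin l) (Fin n) (Fin m)} {s : Store} (hE : Input E s) :
    ∀ e ∈ setup.bounds, e.eval s ≤ l + n + m + E.T + 2 := by
  rw [bounds_setup]
  simp only [List.forall_mem_cons, eval_cell, eval_zero, eval_one, eval_two, eval_three, eval_add,
    hE.locs, hE.drivers, hE.riders, hE.horizon, List.not_mem_nil, false_imp_iff, implies_true,
    and_true]
  omega

lemma eval_bounds_solve {E : Economy (Fin l) (Fin n) (Fin m)} {s : Store} (hE : Input E s) :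
    ∀ e ∈ solve.bounds, e.eval s ≤ s.nat 13 0 0 0 + (l + n + m + E.T) + 3 := by
  rw [bounds_solve]
  simp only [List.forall_mem_cons, eval_cell, eval_zero, eval_one, eval_two, eval_three, eval_add,
    eval_const, hE.locs, hE.drivers, hE.riders, hE.horizon, List.not_mem_nil, false_imp_iff,
    implies_true, and_true]
  omega

lemma SetUp.le_loopBound {E : Economy (Fin l) (Fin n) (Fin m)} {s : Store} (h : SetUp E s) :
    s.nat 13 0 0 0 + (l + n + m + E.T) + 3 ≤ loopBound.eval (l + n + m + E.T) := by
  have hM : s.nat 13 0 0 0 ≤ n + m + (l * (E.T + 1) + l * (l * (E.T + 1))) := h.M_le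
  generalize hN : l + n + m + E.T = N
  have a1 : l * (E.T + 1) ≤ N * (N + 1) := Nat.mul_le_mul (by omega) (by omega)
  have a2 : l * (l * (E.T + 1)) ≤ N * (N * (N + 1)) := Nat.mul_le_mul (by omega) a1
  simp only [loopBound, Polynomial.eval_add, Polynomial.eval_mul, Polynomial.eval_X,
    Polynomial.eval_one, Polynomial.eval_ofNat]
  omega

lemma run_solve (s : Store) : solve.run s = writePaths.run (writePrices.run (route.run s)) := by
  simp only [solve, Code.run]

/-- The loops of `setup` are estimated in the input store, those of `solve` in the store that
`setup` leaves, where the number of arcs is polynomially bounded. -/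
theorem exists_exec_program (E : Economy (Fin l) (Fin n) (Fin m)) :
    ∃ (t : ℕ) (s : Store), Exec program (inputStore E) t s ∧
      t ≤ runningTime.eval (l + n + m + E.T) ∧ ∃ d p, HoldsPlan E s d p ∧ E.IsCE d p := by
  have hE₀ : Input E (inputStore E) := ⟨fun _ _ => rfl, fun _ _ => rfl⟩
  obtain ⟨t₁, ht₁, hx₁⟩ := exec_compile wellFormed_setup (eval_bounds_setup hE₀)
  have hS := setUp_setup E
  generalize setup.run (inputStore E) = s at hS hx₁
  obtain ⟨t₂, ht₂, hx₂⟩ := exec_compile wellFormed_solve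
    fun e he => (eval_bounds_solve hS.input e he).trans hS.le_loopBound
  have hlen : ∀ i, (route.run s).nat 5 i 0 0 = 0 := by
    rw [run_nat route (by decide)]
    exact hS.len
  obtain ⟨d, p, hd⟩ := isCE_of_routed (routed_route hS) hlen
  rw [← run_solve] at hd
  refine ⟨t₁ + t₂, solve.run s, hx₁.seq hx₂, ?_, d, p, hd⟩
  simp only [runningTime, Polynomial.eval_add, Polynomial.eval_comp, Polynomial.eval_X,
    Polynomial.eval_ofNat]
  exact Nat.add_le_add ht₁ ht₂

end Algorithm
end Rideshare

namespace Rideshare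

/-! ### Renaming locations, drivers and riders -/

section Reindex

variable {Loc Drv Rdr Loc' Drv' Rdr' : Type*}

/-- The trip between the corresponding locations. -/
def Trip.map (f : Loc → Loc') (r : Trip Loc) : Trip Loc' := ⟨f r.orig, f r.dest, r.start⟩

@[simp] lemma Trip.map_symm_map (a : Loc ≃ Loc') (r : Trip Loc) : (r.map a).map a.symm = r := by
  simp [map]

@[simp] lemma Trip.map_map_symm (a : Loc ≃ Loc') (r : Trip Loc') : (r.map a.symm).map a = r := by
  simp [map]

lemma Trip.map_injective (a : Loc ≃ Loc') : Function.Injective (Trip.map a) :=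
  Function.LeftInverse.injective (Trip.map_symm_map a)

namespace Economy

/-- The economy with renamed locations, drivers and riders. -/
def reindex (E : Economy Loc Drv Rdr) (a : Loc ≃ Loc') (b : Drv ≃ Drv') (c : Rdr ≃ Rdr') :
    Economy Loc' Drv' Rdr' where
  T := E.T
  dist x y := E.dist (a.symm x) (a.symm y)
  dist_pos x y := E.dist_pos _ _
  dist_self x := E.dist_self _
  tripCost r := E.tripCost (r.map a.symm)
  tripCost_nonneg r hr := E.tripCost_nonneg _ hr
  exitCost := E.exitCost
  exitCost_nonneg := E.exitCost_nonneg
  exitCost_zero := E.exitCost_zero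
  entered i := E.entered (b.symm i)
  entryLoc i := a (E.entryLoc (b.symm i))
  entryTime i := E.entryTime (b.symm i)
  exitTime i := E.exitTime (b.symm i)
  entryTime_lt_exitTime i := E.entryTime_lt_exitTime _
  entryTime_le i := E.entryTime_le _
  le_exitTime i := E.le_exitTime _
  request j := (E.request (c.symm j)).map a
  request_mem j := by simpa [Trip.map] using E.request_mem (c.symm j)
  value j := E.value (c.symm j)
  value_nonneg j := E.value_nonneg _

variable (E : Economy Loc Drv Rdr) (a : Loc ≃ Loc') (b : Drv ≃ Drv') (c : Rdr ≃ Rdr')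

lemma arrival_reindex (r : Trip Loc) : (E.reindex a b c).arrival (r.map a) = E.arrival r := by
  simp [arrival, reindex, Trip.map]

lemma mem_trips_reindex (r : Trip Loc) : r.map a ∈ (E.reindex a b c).trips ↔ r ∈ E.trips := by
  rw [trips, Set.mem_ofPred_eq, arrival_reindex]
  rfl

lemma isPathFrom_reindex (x : Loc) (t : ℕ) (P : List (Trip Loc)) :
    (E.reindex a b c).IsPathFrom (a x) t (P.map (Trip.map a)) ↔ E.IsPathFrom x t P := by
  induction P generalizing x t with
  | nil => exact Iff.rfl
  | cons r P ih =>
    simp only [List.map_cons, IsPathFrom, mem_trips_reindex, arrival_reindex]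
    rw [show (Trip.map a r).dest = a r.dest from rfl, ih]
    simp [Trip.map]

lemma endTime_reindex (t : ℕ) (P : List (Trip Loc)) :
    (E.reindex a b c).endTime t (P.map (Trip.map a)) = E.endTime t P := by
  induction P generalizing t with
  | nil => rfl
  | cons r P ih => simp only [List.map_cons, endTime, arrival_reindex, ih]

lemma mem_paths_reindex (i : Drv) (P : List (Trip Loc)) :
    P.map (Trip.map a) ∈ (E.reindex a b c).paths (b i) ↔ P ∈ E.paths i := by
  simp only [paths, Set.mem_ofPred_eq]
  rw [← E.isPathFrom_reindex a b c]
  simp [reindex]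

lemma pathCost_reindex (i : Drv) (P : List (Trip Loc)) :
    (E.reindex a b c).pathCost (b i) (P.map (Trip.map a)) = E.pathCost i P := by
  simp only [pathCost]
  have h1 : (E.reindex a b c).entryTime (b i) = E.entryTime i := by simp [reindex]
  have h2 : (E.reindex a b c).entered (b i) = E.entered i := by simp [reindex]
  have h3 : (P.map (Trip.map a)).map (E.reindex a b c).tripCost = P.map E.tripCost := by
    rw [List.map_map]
    exact List.map_congr_left fun r _ => by simp [reindex]
  rw [h1, h2, h3, endTime_reindex]
  simp [reindex]

/-- The action path of the corresponding trips and riders. -/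
def mapPath (w : ActionPath Loc Rdr) : ActionPath Loc' Rdr' :=
  w.map (Prod.map (Trip.map a) (Option.map c))

lemma mapPath_fst (w : ActionPath Loc Rdr) :
    (mapPath a c w).map Prod.fst = (w.map Prod.fst).map (Trip.map a) := by
  simp [mapPath]

lemma mapPath_surjective : Function.Surjective (mapPath a c) := by
  refine List.map_surjective_iff.2 ?_
  rintro ⟨r, o⟩
  refine ⟨(r.map a.symm, o.map c.symm), ?_⟩
  simp [Function.comp_def]

lemma mem_mapPath (w : ActionPath Loc Rdr) (r : Trip Loc) (j : Rdr) :
    (r.map a, some (c j)) ∈ mapPath a c w ↔ (r, some j) ∈ w := by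
  have : Function.Injective (Prod.map (Trip.map a) (Option.map c)) :=
    (Trip.map_injective a).prodMap (Option.map_injective c.injective)
  exact List.mem_map_of_injective this (a := (r, some j))

lemma picksUp_reindex (w : ActionPath Loc Rdr) (j : Rdr) :
    (E.reindex a b c).PicksUp (mapPath a c w) (c j) ↔ E.PicksUp w j := by
  rw [PicksUp, PicksUp, ← mem_mapPath a c]
  simp [reindex]

lemma revenue_mapPath (p : Trip Loc' → ℝ) (w : ActionPath Loc Rdr) :
    revenue p (mapPath a c w) = revenue (fun r => p (r.map a)) w := by
  simp [revenue, mapPath, Function.comp_def]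

variable [Fintype Drv] [Fintype Rdr] [Fintype Drv'] [Fintype Rdr']

/-- The machine handles only economies on initial segments of the natural numbers. Renaming of
action paths is surjective, so an equilibrium found there can be pulled back. -/
theorem exists_isCE_of_reindex {d' : Dispatch Loc' Drv' Rdr'} {p' : Trip Loc' → ℝ}
    (h : (E.reindex a b c).IsCE d' p') : ∃ d p, E.IsCE d p := by
  classical
  choose z hz using fun i => mapPath_surjective a c (d'.z (b i))
  have hfeas : E.IsFeasible ⟨fun j => d'.x (c j), z⟩ := by
    refine ⟨fun i => ⟨?_, fun r j hm => ?_⟩, fun j => ⟨?_, (h.1.2 (c j)).2⟩⟩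
    · have h1 := (h.1.1 (b i)).1
      rwa [← hz, mapPath_fst, mem_paths_reindex] at h1
    · have h1 := (h.1.1 (b i)).2 (r.map a) (c j) (by rwa [← hz, mem_mapPath])
      refine Trip.map_injective a (h1.trans ?_)
      simp [reindex]
    · have h1 := (h.1.2 (c j)).1
      simp only at h1 ⊢
      rw [h1, ← Equiv.sum_comp b]
      refine Finset.sum_congr rfl fun i _ => ?_
      rw [← hz]
      simp only [picksUp_reindex]
  refine ⟨⟨fun j => d'.x (c j), z⟩, fun r => p' (r.map a), hfeas, fun j => ?_, fun i => ?_⟩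
  · have h1 := h.2.1 (c j)
    simpa [reindex] using h1
  · have h1 := h.2.2 (b i)
    rw [driverUtility_priced _ h.1] at h1
    rw [driverUtility_priced _ hfeas]
    have hu : revenue p' (d'.z (b i)) - (E.reindex a b c).driverCost d' (b i) =
        revenue (fun r => p' (r.map a)) (z i) -
          E.driverCost ⟨fun j => d'.x (c j), z⟩ i := by
      rw [driverCost, driverCost, ← hz, revenue_mapPath, mapPath_fst, pathCost_reindex]
    rw [← hu]
    -- The two sets of attainable utilities coincide: paths correspond, with equal prices and costs.
    convert h1 using 1
    ext y
    constructor
    · rintro ⟨P, hP, rfl⟩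
      refine ⟨P.map (Trip.map a), (E.mem_paths_reindex a b c i P).2 hP, ?_⟩
      simp only [pathCost_reindex, List.map_map]
      rfl
    · rintro ⟨P', hP', rfl⟩
      obtain ⟨P, rfl⟩ : ∃ P, P.map (Trip.map a) = P' :=
        ⟨P'.map (Trip.map a.symm), by simp [Function.comp_def]⟩
      refine ⟨P, (E.mem_paths_reindex a b c i P).1 hP', ?_⟩
      simp only [pathCost_reindex, List.map_map]
      rfl

end Economy

end Reindex

/-- Every economy has an equilibrium. -/
theorem Economy.exists_isCE {Loc Drv Rdr : Type*} [Finite Loc] [Fintype Drv] [Fintype Rdr]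
    (E : Economy Loc Drv Rdr) : ∃ d p, E.IsCE d p := by
  obtain ⟨_, _, _, _, d, p, _, h⟩ := Algorithm.exists_exec_program
    (E.reindex (Finite.equivFin Loc) (Fintype.equivFin Drv) (Fintype.equivFin Rdr))
  exact E.exists_isCE_of_reindex _ _ _ h

end Rideshare

theorem lemma3 :
    (∀ (Loc Drv Rdr : Type*) [Finite Loc] [Fintype Drv] [Fintype Rdr]
      (E : Rideshare.Economy Loc Drv Rdr),
      -- a dispatch is welfare-optimal iff some anonymous trip prices make it an equilibrium
      (∀ d, E.IsWelfareOptimal d ↔ ∃ p, E.IsCE d p) ∧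
      -- optimal equilibrium plans exist
      (∃ d p, E.IsWelfareOptimal d ∧ E.IsCE d p) ∧
      -- properties of all these plans
      (∀ d p, E.IsCE d p →
        E.StrictBudgetBalance (E.priced d p) ∧
        E.RiderIR (E.priced d p) ∧ E.DriverIR (E.priced d p) ∧
        E.RiderEnvyFree (E.priced d p) ∧ E.DriverEnvyFree (E.priced d p))) ∧
    -- one program computes an optimal equilibrium plan of every economy in polynomial time
    (∃ (c : Rideshare.Program) (B : Polynomial ℕ),
      ∀ (l n m : ℕ) (E : Rideshare.Economy (Fin l) (Fin n) (Fin m)),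
        ∃ (steps : ℕ) (s : Rideshare.Store),
          Rideshare.Exec c (Rideshare.inputStore E) steps s ∧
          steps ≤ B.eval (l + n + m + E.T) ∧
          ∃ d p, Rideshare.HoldsPlan E s d p ∧ E.IsWelfareOptimal d ∧ E.IsCE d p) := by
  refine ⟨fun Loc Drv Rdr _ _ _ E => ?_,
    Rideshare.Algorithm.program, Rideshare.Algorithm.runningTime, fun l n m E => ?_⟩
  -- The prices of this one equilibrium support every optimal dispatch.
  · obtain ⟨d₀, p₀, h₀⟩ := E.exists_isCE
    exact ⟨fun d => ⟨fun hd => ⟨p₀, h₀.of_isWelfareOptimal hd⟩, fun ⟨_, hp⟩ => hp.isWelfareOptimal⟩,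
      ⟨d₀, p₀, h₀.isWelfareOptimal, h₀⟩, fun d p h => ⟨h.strictBudgetBalance, h.riderIR, h.driverIR,
        h.riderEnvyFree, h.driverEnvyFree⟩⟩
  · obtain ⟨t, s, h1, h2, d, p, h3, h4⟩ := Rideshare.Algorithm.exists_exec_program E
    exact ⟨t, s, h1, h2, d, p, h3, h4.isWelfareOptimal, h4⟩
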